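/- **Conventions.** Manifolds are smooth and Hausdorff, $d\eta(X,Y)=X\eta(Y)-Y\eta(X)-\eta([X,Y])$, and wedge products carry no factors: $(\eta\wedge\Phi)(X,Y,Z)=\eta(X)\Phi(Y,Z)+\eta(Y)\Phi(Z,X)+\eta(Z)\Phi(X,Y)$. Even permutations $(i,j,k)$ are those of $(1,2,3)$. **Almost 3-contact metric manifolds.** Let $(M,\varphi_i,\xi_i,\eta_i,g)_{i=1,2,3}$ be an almost 3-contact metric manifold of dimension $4n+3$, $n\ge 0$: $\varphi_i$ are smooth $(1,1)$-tensor fields, $\xi_i$ vector fields, $\eta_i$ 1-forms and $g$ is a Riemannian metric with $\varphi_i^2=-I+\eta_i\otimes\xi_i$, $\eta_i(\xi_i)=1$, $g(\varphi_iX,\varphi_iY)=g(X,Y)-\eta_i(X)\eta_i(Y)$, and, for every even permutation, $\varphi_k=\varphi_i\varphi_j-\eta_j\otimes\xi_i=-\varphi_j\varphi_i+\eta_i\otimes\xi_j$, $\xi_k=\varphi_i\xi_j=-\varphi_j\xi_i$, $\eta_k=\eta_i\circ\varphi_j=-\eta_j\circ\varphi_i$. Put $\Phi_i(X,Y)=g(X,\varphi_iY)$,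 $\mathcal H=\bigcap_i\ker\eta_i$, $N_i=[\varphi_i,\varphi_i]+d\eta_i\otimes\xi_i$ (where $[\varphi,\varphi](X,Y)=[\varphi X,\varphi Y]+\varphi^2[X,Y]-\varphi[\varphi X,Y]-\varphi[X,\varphi Y]$), $N_i(X,Y,Z)=g(N_i(X,Y),Z)$, and $$A_{ij}(X,Y)=g((\mathcal L_{\xi_j}\varphi_i)X,Y)+d\eta_j(X,\varphi_iY)+d\eta_j(\varphi_iX,Y).$$ A *Reeb Killing function* is a smooth function $\beta$ such that, on $\mathcal H$, $A_{ii}=0$ and $A_{ij}=-A_{ji}=\beta\Phi_k$ for every even permutation $(i,j,k)$. The manifold is *canonical* if (i) each $N_i(X,Y,Z)$ is totally skew-symmetric on $\mathcal H$; (ii) each $\xi_i$ is a Killing vector field; (iii) for all $i,j$ and all $X,Y,Z\in\Gamma(\mathcal H)$, $N_i(X,Y,Z)-d\Phi_i(\varphi_iX,\varphi_iY,\varphi_iZ)=N_j(X,Y,Z)-d\Phi_j(\varphi_jX,\varphi_jY,\varphi_jZ)$; (iv) it admits a Reeb Killing function. It is *3-$(\alpha,\delta)$-Sasaki* ($\alpha\neq0$,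 $\delta$ real constants) if $d\eta_i=2\alpha\Phi_i+2(\alpha-\delta)\,\eta_j\wedge\eta_k$ for every even permutation $(i,j,k)$. **Statement.** Let $(M,\varphi_i,\xi_i,\eta_i,g)$ be a canonical almost 3-contact metric manifold with a constant Reeb Killing function $\beta<0$. Let $a=-\beta/2>0$, and let $(\bar M,\bar g)=(M\times\mathbb R^+,\,a^2r^2g+dr^2)$ be the cone, with the structures $J_1,J_2,J_3$ given by $$J_i(ar\partial_r)=\varepsilon_i\xi_i,\qquad J_i(\xi_i)=-\varepsilon_i\,ar\partial_r,\qquad J_i(V)=-\varepsilon_i\varphi_i(V)\ \text{ for } V\perp\xi_i,\partial_r,$$ where $\varepsilon_1=\varepsilon_2=1$ and $\varepsilon_3=-1$. Then: 1. $(\bar g,J_1,J_2,J_3)$ is an almost hyperhermitian structure, with $J_1J_2=J_3=-J_2J_1$. 2. The following connections exist: the canonical connection $\nabla$, i.e. the metric connection on $M$ with skew torsion $T$ for which $\nabla_X\varphi_i=\beta(\eta_k(X)\varphi_j-\eta_j(X)\varphi_k)$ for every even permutation $(i,j,k)$; the metric connection $\nabla'$ on $M$ with skew torsion $T'=T+\beta\sum_{i=1}^3\eta_i\wedge\Phi_i$;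 and its appendant connection $\bar\nabla'$, i.e. the metric connection on $(\bar M,\bar g)$ with skew torsion $\bar T$ given by $\bar T(X,Y)=T'(X,Y)$ (torsions being regarded as $TM$- resp. $T\bar M$-valued) for $X,Y\perp\partial_r$ and $\partial_r\lrcorner\bar T=0$. Moreover $\bar\nabla'J_1=\bar\nabla'J_2=\bar\nabla'J_3=0$. 3. If, furthermore, $M$ is a 3-$(\alpha,\delta)$-Sasaki manifold for some $\alpha\ne0$ and $\delta$, then $(\bar M,\bar g,J_1,J_2,J_3)$ is an HKT manifold: $J_1,J_2,J_3$ are integrable and there is a metric connection with skew torsion for which all three $J_i$ are parallel. -/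

import Mathlib

open Bundle VectorField
open scoped Manifold ContDiff

noncomputable section

/-! ### Tensor calculus on a smooth manifold -/

section Calculus

variable {E : Type*} [NormedAddCommGroup E] [NormedSpace ℝ E]
  {H : Type*} [TopologicalSpace H] (I : ModelWithCorners ℝ E H)
  (M : Type*) [TopologicalSpace M] [ChartedSpace H M] [IsManifold I ∞ M]

/-- Vector fields (not necessarily smooth). -/
abbrev VField : Type _ := Π x : M, TangentSpace I x

/-- Differential `1`-forms (not necessarily smooth). -/
abbrev OneForm : Type _ := Π x : M, TangentSpace I x →L[ℝ] ℝ

/-- Fields of bilinear forms; `2`-forms are of this kind. -/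
abbrev TwoTensor : Type _ := Π x : M, TangentSpace I x → TangentSpace I x → ℝ

/-- `(1,1)`-tensor fields (not necessarily smooth). -/
abbrev EndoField : Type _ := Π x : M, TangentSpace I x →L[ℝ] TangentSpace I x

/-- Smooth Riemannian metrics. -/
abbrev RMetric : Type _ := ContMDiffRiemannianMetric I ∞ E (fun x : M => TangentSpace I x)

/-- Linear connections. For `D : LinConn I M`, the value `D Y x (X x)` is `∇_X Y` at `x`. -/
abbrev LinConn : Type _ := CovariantDerivative I E (fun x : M => TangentSpace I x)

variable {I M}

/-- Smoothness of a vector field. -/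
def SmoothVF (X : VField I M) : Prop :=
  ContMDiff I (I.prod 𝓘(ℝ, E)) ∞
    (fun x => TotalSpace.mk' E (E := fun x : M => TangentSpace I x) x (X x))

/-- Smoothness of a `1`-form. -/
def SmoothOneForm (η : OneForm I M) : Prop :=
  ContMDiff I (I.prod 𝓘(ℝ, E →L[ℝ] ℝ)) ∞
    (fun x => TotalSpace.mk' (E →L[ℝ] ℝ) (E := fun x : M => TangentSpace I x →L[ℝ] ℝ) x (η x))

/-- Smoothness of a `(1,1)`-tensor field. -/
def SmoothEndo (φ : EndoField I M) : Prop :=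
  ContMDiff I (I.prod 𝓘(ℝ, E →L[ℝ] E)) ∞
    (fun x => TotalSpace.mk' (E →L[ℝ] E)
      (E := fun x : M => TangentSpace I x →L[ℝ] TangentSpace I x) x (φ x))

/-- The vector field `φ X`. -/
def endoApply (φ : EndoField I M) (X : VField I M) : VField I M := fun x => φ x (X x)

/-- The derivative `X f` of a function along a vector field. -/
def lieFun (X : VField I M) (f : M → ℝ) (x : M) : ℝ := mvfderiv I f x (X x)

/-- `dη(X,Y) = X η(Y) - Y η(X) - η([X,Y])`. -/
def dOne (η : OneForm I M) (X Y : VField I M) (x : M) : ℝ :=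
  lieFun X (fun y => η y (Y y)) x - lieFun Y (fun y => η y (X y)) x
    - η x (mlieBracket I X Y x)

/-- `dΦ(X,Y,Z)`, the cyclic sum of `X Φ(Y,Z) - Φ([X,Y],Z)`. -/
def dTwo (Φ : TwoTensor I M) (X Y Z : VField I M) (x : M) : ℝ :=
  (lieFun X (fun y => Φ y (Y y) (Z y)) x - Φ x (mlieBracket I X Y x) (Z x))
  + (lieFun Y (fun y => Φ y (Z y) (X y)) x - Φ x (mlieBracket I Y Z x) (X x))
  + (lieFun Z (fun y => Φ y (X y) (Y y)) x - Φ x (mlieBracket I Z X x) (Y x))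

/-- The Lie derivative `(L_V φ)X = [V, φX] - φ[V, X]`. -/
def lieEndo (V : VField I M) (φ : EndoField I M) (X : VField I M) (x : M) : TangentSpace I x :=
  mlieBracket I V (endoApply φ X) x - φ x (mlieBracket I V X x)

/-- `V` is a Killing vector field: `(L_V g)(X,Y) = V g(X,Y) - g([V,X],Y) - g(X,[V,Y])`
vanishes for all vector fields `X`, `Y`. -/
def IsKilling (g : RMetric I M) (V : VField I M) : Prop :=
  ∀ X Y : VField I M, SmoothVF X → SmoothVF Y → ∀ x,
    lieFun V (fun y => g.inner y (X y) (Y y)) x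
      - g.inner x (mlieBracket I V X x) (Y x) - g.inner x (X x) (mlieBracket I V Y x) = 0

/-- The Nijenhuis torsion
`[φ,φ](X,Y) = [φX,φY] + φ²[X,Y] - φ[φX,Y] - φ[X,φY]` of a `(1,1)`-tensor field. -/
def nijenhuis (φ : EndoField I M) (X Y : VField I M) (x : M) : TangentSpace I x :=
  mlieBracket I (endoApply φ X) (endoApply φ Y) x + φ x (φ x (mlieBracket I X Y x))
    - φ x (mlieBracket I (endoApply φ X) Y x) - φ x (mlieBracket I X (endoApply φ Y) x)

/-- The `3`-form `η ∧ Φ` for a `1`-form `η` and a `2`-form `Φ`. -/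
def wedgeOneTwo (η : OneForm I M) (Φ : TwoTensor I M) (x : M) (u v w : TangentSpace I x) : ℝ :=
  η x u * Φ x v w + η x v * Φ x w u + η x w * Φ x u v

section Connections

variable [FiniteDimensional ℝ E]

/-- The torsion as a `(0,3)`-tensor, `T(u,v,w) = g(T(u,v),w)`. -/
def torsionForm (g : RMetric I M) (D : LinConn I M) (x : M) (u v w : TangentSpace I x) : ℝ :=
  g.inner x (D.torsion x u v) w

/-- `D` is a smooth metric connection whose torsion is totally skew-symmetric
(skew-symmetry of `T(u,v,w)` in `u, v` is automatic). -/
structure IsMetricSkew (g : RMetric I M) (D : LinConn I M) : Prop where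
  smooth : CovariantDerivative.ContMDiffCovariantDerivative D ∞
  metric : ∀ X Y Z : VField I M, SmoothVF X → SmoothVF Y → SmoothVF Z → ∀ x,
    lieFun X (fun y => g.inner y (Y y) (Z y)) x =
      g.inner x (D Y x (X x)) (Z x) + g.inner x (Y x) (D Z x (X x))
  skew : ∀ x (u v w : TangentSpace I x), torsionForm g D x u v w = - torsionForm g D x u w v

/-- `(∇_X φ) Y = ∇_X (φY) - φ (∇_X Y)`. -/
def covEndo (D : LinConn I M) (φ : EndoField I M) (X Y : VField I M) (x : M) :
    TangentSpace I x :=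
  D (endoApply φ Y) x (X x) - φ x (D Y x (X x))

/-- `∇ φ = 0`. -/
def IsParallelEndo (D : LinConn I M) (φ : EndoField I M) : Prop :=
  ∀ X Y : VField I M, SmoothVF X → SmoothVF Y → ∀ x, covEndo D φ X Y x = 0

end Connections

end Calculus

/-! ### Almost `3`-contact metric structures -/

section ThreeContact

variable {E : Type*} [NormedAddCommGroup E] [NormedSpace ℝ E]
  {H : Type*} [TopologicalSpace H] (I : ModelWithCorners ℝ E H)
  (M : Type*) [TopologicalSpace M] [ChartedSpace H M] [IsManifold I ∞ M]

/-- An almost `3`-contact metric structure `(φ_i, ξ_i, η_i, g)` on a manifold. The indices are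
`0, 1, 2`, and the even permutations of the indices are the triples `(i, i + 1, i + 2)`,
`i : Fin 3`. -/
structure AlmostThreeContactMetric where
  g : RMetric I M
  φ : Fin 3 → EndoField I M
  ξ : Fin 3 → VField I M
  η : Fin 3 → OneForm I M
  smooth_φ : ∀ i, SmoothEndo (φ i)
  smooth_ξ : ∀ i, SmoothVF (ξ i)
  smooth_η : ∀ i, SmoothOneForm (η i)
  φ_sq : ∀ i x (v : TangentSpace I x), φ i x (φ i x v) = - v + η i x v • ξ i x
  η_ξ : ∀ i x, η i x (ξ i x) = 1
  φ_mul : ∀ (i : Fin 3) x (v : TangentSpace I x),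
    φ (i + 2) x v = φ i x (φ (i + 1) x v) - η (i + 1) x v • ξ i x
  φ_mul' : ∀ (i : Fin 3) x (v : TangentSpace I x),
    φ (i + 2) x v = - φ (i + 1) x (φ i x v) + η i x v • ξ (i + 1) x
  φ_ξ : ∀ (i : Fin 3) x, ξ (i + 2) x = φ i x (ξ (i + 1) x)
  φ_ξ' : ∀ (i : Fin 3) x, ξ (i + 2) x = - φ (i + 1) x (ξ i x)
  η_φ : ∀ (i : Fin 3) x (v : TangentSpace I x), η (i + 2) x v = η i x (φ (i + 1) x v)
  η_φ' : ∀ (i : Fin 3) x (v : TangentSpace I x), η (i + 2) x v = - η (i + 1) x (φ i x v)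
  compat : ∀ i x (u v : TangentSpace I x),
    g.inner x (φ i x u) (φ i x v) = g.inner x u v - η i x u * η i x v

namespace AlmostThreeContactMetric

variable {I M} (S : AlmostThreeContactMetric I M)

/-- The identity `φ_i ξ_i = 0`. -/
theorem φ_ξ_self (i : Fin 3) (x : M) : S.φ i x (S.ξ i x) = 0 := by
  have h0 : S.φ i x (S.φ i x (S.ξ i x)) = 0 := by simp [S.φ_sq, S.η_ξ]
  have h1 := S.φ_sq i x (S.φ i x (S.ξ i x))
  rw [h0, map_zero] at h1
  have h2 : S.φ i x (S.ξ i x) = S.η i x (S.φ i x (S.ξ i x)) • S.ξ i x := by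
    rw [eq_comm, neg_add_eq_zero] at h1
    exact h1
  have h3 := congrArg (S.φ i x) h2
  rw [h0, map_smul, h2, smul_smul] at h3
  have h4 := congrArg (S.η i x) h3
  simp only [map_zero, map_smul, S.η_ξ, smul_eq_mul, mul_one] at h4
  have h5 : S.η i x (S.φ i x (S.ξ i x)) = 0 := by
    simpa using h4.symm
  rw [h2, h5, zero_smul]

/-- The fundamental `2`-forms `Φ_i(u,v) = g(u, φ_i v)`. -/
def Phi (i : Fin 3) : TwoTensor I M := fun x u v => S.g.inner x u (S.φ i x v)

/-- `X` is a smooth horizontal vector field, i.e. a smooth section of `⋂ i, ker η_i`. -/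
def Horizontal (X : VField I M) : Prop :=
  SmoothVF X ∧ ∀ i x, S.η i x (X x) = 0

/-- The tensor `N_i(X,Y) = [φ_i,φ_i](X,Y) + dη_i(X,Y) ξ_i`. -/
def N (i : Fin 3) (X Y : VField I M) (x : M) : TangentSpace I x :=
  nijenhuis (S.φ i) X Y x + dOne (S.η i) X Y x • S.ξ i x

/-- `N_i(X,Y,Z) = g(N_i(X,Y),Z)`. -/
def N3 (i : Fin 3) (X Y Z : VField I M) (x : M) : ℝ := S.g.inner x (S.N i X Y x) (Z x)

/-- `A_ij(X,Y) = g((L_{ξ_j} φ_i) X, Y) + dη_j(X, φ_i Y) + dη_j(φ_i X, Y)`. -/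
def A (i j : Fin 3) (X Y : VField I M) (x : M) : ℝ :=
  S.g.inner x (lieEndo (S.ξ j) (S.φ i) X x) (Y x)
    + dOne (S.η j) X (endoApply (S.φ i) Y) x + dOne (S.η j) (endoApply (S.φ i) X) Y x

/-- `β` is a Reeb Killing function: it is smooth, and on horizontal vector fields `A_ii = 0` and
`A_ij = - A_ji = β Φ_k` for every even permutation `(i,j,k)`. -/
def IsReebKillingFunction (β : M → ℝ) : Prop :=
  ContMDiff I 𝓘(ℝ, ℝ) ∞ β ∧
  ∀ (i : Fin 3) (X Y : VField I M), S.Horizontal X → S.Horizontal Y → ∀ x,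
    S.A i i X Y x = 0 ∧
    S.A i (i + 1) X Y x = β x * S.Phi (i + 2) x (X x) (Y x) ∧
    S.A (i + 1) i X Y x = - (β x * S.Phi (i + 2) x (X x) (Y x))

/-- Canonical almost `3`-contact metric manifolds. In the second field, skew-symmetry of
`N_i(X,Y,Z)` in `X, Y` is automatic. -/
structure IsCanonical : Prop where
  skew : ∀ (i : Fin 3) (X Y Z : VField I M), S.Horizontal X → S.Horizontal Y → S.Horizontal Z →
    ∀ x, S.N3 i X Y Z x = - S.N3 i X Z Y x
  killing : ∀ i, IsKilling S.g (S.ξ i)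
  compare : ∀ (i j : Fin 3) (X Y Z : VField I M),
    S.Horizontal X → S.Horizontal Y → S.Horizontal Z → ∀ x,
    S.N3 i X Y Z x
        - dTwo (S.Phi i) (endoApply (S.φ i) X) (endoApply (S.φ i) Y) (endoApply (S.φ i) Z) x
      = S.N3 j X Y Z x
        - dTwo (S.Phi j) (endoApply (S.φ j) X) (endoApply (S.φ j) Y) (endoApply (S.φ j) Z) x
  reebKilling : ∃ β : M → ℝ, S.IsReebKillingFunction β

/-- `3`-`(α,δ)`-Sasaki manifolds: `α ≠ 0` and `dη_i = 2αΦ_i + 2(α - δ) η_j ∧ η_k` for every even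
permutation `(i,j,k)`. -/
def IsThreeSasaki (α δ : ℝ) : Prop :=
  α ≠ 0 ∧ ∀ (i : Fin 3) (X Y : VField I M), SmoothVF X → SmoothVF Y → ∀ x,
    dOne (S.η i) X Y x = 2 * α * S.Phi i x (X x) (Y x)
      + 2 * (α - δ) * (S.η (i + 1) x (X x) * S.η (i + 2) x (Y x)
          - S.η (i + 1) x (Y x) * S.η (i + 2) x (X x))

variable [FiniteDimensional ℝ E]

/-- `D` is a canonical connection, `β` being the Reeb Killing function: a metric connection with
skew torsion such that `∇_X φ_i = β (η_k(X) φ_j - η_j(X) φ_k)` for every even permutation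
`(i,j,k)`. -/
structure IsCanonicalConnection (β : M → ℝ) (D : LinConn I M) : Prop where
  metricSkew : IsMetricSkew S.g D
  cov_φ : ∀ (i : Fin 3) (X Y : VField I M), SmoothVF X → SmoothVF Y → ∀ x,
    covEndo D (S.φ i) X Y x =
      β x • (S.η (i + 2) x (X x) • S.φ (i + 1) x (Y x)
        - S.η (i + 1) x (X x) • S.φ (i + 2) x (Y x))

/-- `D'` is the metric connection with skew torsion `T' = T + β ∑ i, η_i ∧ Φ_i`, where `T` is the
torsion of `D`. -/
structure IsModifiedConnection (β : ℝ) (D D' : LinConn I M) : Prop where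
  metricSkew : IsMetricSkew S.g D'
  torsion_eq : ∀ x (u v w : TangentSpace I x),
    torsionForm S.g D' x u v w =
      torsionForm S.g D x u v w + β * ∑ i : Fin 3, wedgeOneTwo (S.η i) (S.Phi i) x u v w

end AlmostThreeContactMetric

end ThreeContact

/-! ### Almost hyperhermitian structures and HKT manifolds -/

section Hyper

variable {E : Type*} [NormedAddCommGroup E] [NormedSpace ℝ E]
  {H : Type*} [TopologicalSpace H] {I : ModelWithCorners ℝ E H}
  {M : Type*} [TopologicalSpace M] [ChartedSpace H M] [IsManifold I ∞ M]

/-- `(g, J_1, J_2, J_3)` is an almost hyperhermitian structure: each `J_i` is an almost complex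
structure, `g` is hermitian for each `J_i`, and `J_1 J_2 = J_3 = - J_2 J_1`. -/
structure IsAlmostHyperhermitian (g : RMetric I M) (J : Fin 3 → EndoField I M) : Prop where
  smooth : ∀ i, SmoothEndo (J i)
  sq : ∀ i x (v : TangentSpace I x), J i x (J i x v) = - v
  hermitian : ∀ i x (u v : TangentSpace I x), g.inner x (J i x u) (J i x v) = g.inner x u v
  mul : ∀ x (v : TangentSpace I x), J 0 x (J 1 x v) = J 2 x v
  mul' : ∀ x (v : TangentSpace I x), J 1 x (J 0 x v) = - J 2 x v

/-- Hyper-Kähler manifolds with torsion: an almost hyperhermitian structure whose almost complex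
structures are integrable (vanishing Nijenhuis tensor), admitting a metric connection with skew
torsion for which `J_1`, `J_2`, `J_3` are parallel. -/
structure IsHKT [FiniteDimensional ℝ E] (g : RMetric I M) (J : Fin 3 → EndoField I M) : Prop where
  hyperhermitian : IsAlmostHyperhermitian g J
  integrable : ∀ (i : Fin 3) (X Y : VField I M), SmoothVF X → SmoothVF Y → ∀ x,
    nijenhuis (J i) X Y x = 0
  connection : ∃ D : LinConn I M, IsMetricSkew g D ∧ ∀ i, IsParallelEndo D (J i)

end Hyper

/-! ### The metric cone -/

section Cone

variable {E : Type*} [NormedAddCommGroup E] [NormedSpace ℝ E]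
  {H : Type*} [TopologicalSpace H] {I : ModelWithCorners ℝ E H}
  {M : Type*} [TopologicalSpace M] [ChartedSpace H M]

/-- The half line `ℝ⁺ = (0, ∞)` as an open subset of `ℝ`. -/
abbrev PosHalfLine : TopologicalSpace.Opens ℝ := ⟨Set.Ioi 0, isOpen_Ioi⟩

variable (M) in
/-- The space `M × ℝ⁺` underlying the cone. -/
abbrev ConeSpace : Type _ := M × PosHalfLine

variable (I) in
/-- The model of the cone. Its tangent space at `(x, r)` is `T_x M × ℝ`. -/
abbrev coneModel : ModelWithCorners ℝ (E × ℝ) (ModelProd H ℝ) := I.prod 𝓘(ℝ, ℝ)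

/-- The differential at `p` of the projection from the cone to `M`
(see `mfderiv_coneProj`). -/
def coneProj (p : ConeSpace M) :
    TangentSpace (coneModel I) p →L[ℝ] TangentSpace I p.1 :=
  ContinuousLinearMap.fst ℝ E ℝ

/-- The `1`-form `dr` on the cone (see `mfderiv_coneDr`). -/
def coneDr (p : ConeSpace M) : TangentSpace (coneModel I) p →L[ℝ] ℝ :=
  ContinuousLinearMap.snd ℝ E ℝ

/-- The inclusion of the vectors tangent to `M` into the tangent space of the cone. -/
def coneIncl (p : ConeSpace M) :
    TangentSpace I p.1 →L[ℝ] TangentSpace (coneModel I) p :=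
  ContinuousLinearMap.inl ℝ E ℝ

/-- The vector field `∂_r` on the cone. -/
def coneRadial : VField (coneModel I) (ConeSpace M) := fun _ => ((0, 1) : E × ℝ)

theorem coneProj_incl (p : ConeSpace M) (u : TangentSpace I p.1) :
    coneProj p (coneIncl p u) = u := rfl

theorem coneDr_incl (p : ConeSpace M) (u : TangentSpace I p.1) :
    coneDr p (coneIncl p u) = 0 := rfl

theorem coneProj_radial (p : ConeSpace M) :
    coneProj p (coneRadial (I := I) p) = 0 := rfl

theorem coneDr_radial (p : ConeSpace M) :
    coneDr p (coneRadial (I := I) p) = 1 := rfl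

theorem cone_decomp (p : ConeSpace M) (w : TangentSpace (coneModel I) p) :
    w = coneIncl p (coneProj p w) + coneDr p w • coneRadial p := by
  have h : ∀ z : E × ℝ, z = (z.1, 0) + z.2 • ((0, 1) : E × ℝ) := fun z => by ext <;> simp
  exact h w

theorem mfderiv_coneProj (p : ConeSpace M) :
    mfderiv (coneModel I) I (Prod.fst : ConeSpace M → M) p = coneProj p :=
  mfderiv_fst

theorem mfderiv_coneDr (p : ConeSpace M) :
    mvfderiv (coneModel I) (fun q : ConeSpace M => (q.2 : ℝ)) p = coneDr p := by
  have h1 : HasMFDerivAt 𝓘(ℝ, ℝ) 𝓘(ℝ, ℝ) (Subtype.val : PosHalfLine → ℝ) p.2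
      (ContinuousLinearMap.id ℝ ℝ) := by
    refine ⟨continuous_subtype_val.continuousAt, ?_⟩
    have hr : (p.2 : ℝ) ∈ Set.Ioi (0 : ℝ) := p.2.2
    have h2 : (fun s : ℝ => s) =ᶠ[nhds (p.2 : ℝ)]
        writtenInExtChartAt 𝓘(ℝ, ℝ) 𝓘(ℝ, ℝ) p.2 (Subtype.val : PosHalfLine → ℝ) := by
      filter_upwards [isOpen_Ioi.mem_nhds hr] with s hs
      have h5 := OpenPartialHomeomorph.map_subtype_source (s := PosHalfLine) ⟨p.2⟩
        (e := chartAt ℝ (p.2 : ℝ)) (x := ⟨s, hs⟩) (by rw [chartAt_self_eq]; trivial)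
      have h4 := OpenPartialHomeomorph.subtypeRestr_symm_eqOn (chartAt ℝ (p.2 : ℝ))
        (U := PosHalfLine) ⟨p.2⟩ h5
      simpa [writtenInExtChartAt, extChartAt] using! h4
    simpa using! ((hasFDerivAt_id (𝕜 := ℝ) (p.2 : ℝ)).congr_of_eventuallyEq h2.symm).hasFDerivWithinAt
  have h3 := h1.comp p (hasMFDerivAt_snd (I := I) (I' := 𝓘(ℝ, ℝ)) p)
  exact h3.mfderiv

set_option synthInstance.maxHeartbeats 200000 in
theorem contMDiffAt_smulRight_self {F : Type*} [NormedAddCommGroup F] [NormedSpace ℝ F]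
    {p₀ : ConeSpace M} {B : ConeSpace M → F →L[ℝ] ℝ}
    (hB : ContMDiffAt (coneModel I) 𝓘(ℝ, F →L[ℝ] ℝ) ∞ B p₀) :
    ContMDiffAt (coneModel I) 𝓘(ℝ, F →L[ℝ] F →L[ℝ] ℝ) ∞
      (fun q => (B q).smulRight (B q)) p₀ := by
  have h0 : IsBoundedBilinearMap ℝ
      (fun c : (F →L[ℝ] ℝ) × (F →L[ℝ] ℝ) => c.1.smulRight c.2) :=
    (ContinuousLinearMap.smulRightL ℝ F (F →L[ℝ] ℝ)).isBoundedBilinearMap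
  have h : ContDiff ℝ ∞ (fun c : F →L[ℝ] ℝ => c.smulRight c) :=
    ContDiff.comp (g := fun c : (F →L[ℝ] ℝ) × (F →L[ℝ] ℝ) => c.1.smulRight c.2)
      (f := fun c : F →L[ℝ] ℝ => (c, c)) h0.contDiff (contDiff_id.prodMk contDiff_id)
  exact h.contMDiff.contMDiffAt.comp p₀ hB

variable [IsManifold I ∞ M]

/-- The bilinear form `a² r² g + dr²` on the tangent space of the cone at `(x, r)`. -/
def coneForm (g : RMetric I M) (a : ℝ) (p : ConeSpace M) :
    TangentSpace (coneModel I) p →L[ℝ] TangentSpace (coneModel I) p →L[ℝ] ℝ :=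
  (a ^ 2 * (p.2 : ℝ) ^ 2) • ((ContinuousLinearMap.precomp ℝ (coneProj p)).comp ((g.inner p.1).comp (coneProj p)))
    + (coneDr p).smulRight (coneDr p)

theorem coneForm_apply (g : RMetric I M) (a : ℝ) (p : ConeSpace M)
    (u v : TangentSpace (coneModel I) p) :
    coneForm g a p u v =
      a ^ 2 * (p.2 : ℝ) ^ 2 * g.inner p.1 (coneProj p u) (coneProj p v)
        + coneDr p u * coneDr p v := rfl

theorem contMDiff_coneForm (g : RMetric I M) (a : ℝ) :
    ContMDiff (coneModel I) ((coneModel I).prod 𝓘(ℝ, E × ℝ →L[ℝ] E × ℝ →L[ℝ] ℝ)) ∞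
      (fun p : ConeSpace M => TotalSpace.mk' (E × ℝ →L[ℝ] E × ℝ →L[ℝ] ℝ)
        (E := fun p : ConeSpace M =>
          TangentSpace (coneModel I) p →L[ℝ] TangentSpace (coneModel I) p →L[ℝ] ℝ)
        p (coneForm g a p)) := by
  intro p₀
  rw [contMDiffAt_hom_bundle]
  refine ⟨contMDiffAt_id, ?_⟩
  have hA := ContMDiffAt.mfderiv_const (m := ∞) (n := ∞) (x₀ := p₀)
    (contMDiffAt_fst (I := I) (J := 𝓘(ℝ, ℝ)) (M := M) (N := PosHalfLine)) (by simp)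
  have hr : ContMDiff (coneModel I) 𝓘(ℝ, ℝ) ∞ (fun q : ConeSpace M => (q.2 : ℝ)) :=
    contMDiff_subtype_val.comp contMDiff_snd
  have hB := ContMDiffAt.mfderiv_const (m := ∞) (n := ∞) (x₀ := p₀) hr.contMDiffAt (by simp)
  have hG := g.contMDiff p₀.1
  rw [contMDiffAt_hom_bundle] at hG
  have hG' := ContMDiffAt.comp p₀ hG.2
    (contMDiffAt_fst (I := I) (J := 𝓘(ℝ, ℝ)) (M := M) (N := PosHalfLine) (n := ∞))
  have hc : ContMDiffAt (coneModel I) 𝓘(ℝ, ℝ) ∞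
      (fun q : ConeSpace M => a ^ 2 * (q.2 : ℝ) ^ 2) p₀ :=
    (contMDiffAt_const.mul (hr.contMDiffAt.pow 2))
  have hGA := hG'.clm_comp hA
  have hF := (hA.clm_precomp (F₃ := ℝ)).clm_comp hGA
  have hBB := contMDiffAt_smulRight_self hB
  refine ((hc.smul hF).add hBB).congr_of_eventuallyEq ?_
  have h1 : ∀ᶠ q : ConeSpace M in nhds p₀,
      q.1 ∈ (trivializationAt E (TangentSpace I : M → Type _) p₀.1).baseSet :=
    continuous_fst.continuousAt.eventually
      ((trivializationAt E (TangentSpace I : M → Type _) p₀.1).open_baseSet.mem_nhds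
        (FiberBundle.mem_baseSet_trivializationAt' p₀.1))
  have h2 : ∀ᶠ q : ConeSpace M in nhds p₀,
      q ∈ (trivializationAt (E × ℝ) (TangentSpace (coneModel I) : ConeSpace M → Type _) p₀).baseSet :=
    (trivializationAt (E × ℝ)
      (TangentSpace (coneModel I) : ConeSpace M → Type _) p₀).open_baseSet.mem_nhds
        (FiberBundle.mem_baseSet_trivializationAt' p₀)
  filter_upwards [h1, h2] with q hq1 hq2
  refine ContinuousLinearMap.ext fun u => ContinuousLinearMap.ext fun v => ?_
  refine (inCoordinates_apply_eq₂ hq2 hq2 (by simp)).trans ?_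
  have hAu : ∀ u : E × ℝ, inTangentCoordinates (I.prod 𝓘(ℝ, ℝ)) I id Prod.fst
      (mfderiv (I.prod 𝓘(ℝ, ℝ)) I (Prod.fst : ConeSpace M → M)) p₀ q u =
      (trivializationAt E (TangentSpace I : M → Type _) p₀.1).continuousLinearMapAt ℝ q.1
        (coneProj q ((trivializationAt (E × ℝ)
          (TangentSpace (coneModel I) : ConeSpace M → Type _) p₀).symm q u)) := by
    intro u
    rw [← mfderiv_coneProj, ← Trivialization.symmL_apply (R := ℝ) _ hq2]
    rfl
  have hBu : ∀ u : E × ℝ, inTangentCoordinates (coneModel I) 𝓘(ℝ, ℝ) id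
      (fun q : ConeSpace M => (q.2 : ℝ))
      (mfderiv (coneModel I) 𝓘(ℝ, ℝ) (fun q : ConeSpace M => (q.2 : ℝ))) p₀ q u =
        (coneDr q ((trivializationAt (E × ℝ)
          (TangentSpace (coneModel I) : ConeSpace M → Type _) p₀).symm q u)) := by
    intro u
    rw [← mfderiv_coneDr, ← Trivialization.symmL_apply (R := ℝ) _ hq2]
    have h := TangentBundle.continuousLinearMapAt_model_space (𝕜 := ℝ) (F := ℝ) (p₀.2 : ℝ) (q.2 : ℝ)
    exact congrArg (fun L : ℝ →L[ℝ] ℝ => L (mfderiv (coneModel I) 𝓘(ℝ, ℝ)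
      (fun q : ConeSpace M => (q.2 : ℝ)) q ((trivializationAt (E × ℝ)
          (TangentSpace (coneModel I) : ConeSpace M → Type _) p₀).symmL ℝ q u))) h
  have hsymm : ∀ w : TangentSpace I q.1,
      (trivializationAt E (TangentSpace I : M → Type _) p₀.1).symm q.1
        ((trivializationAt E (TangentSpace I : M → Type _) p₀.1).continuousLinearMapAt ℝ q.1 w)
          = w := by
    intro w
    rw [← Trivialization.symmL_apply (R := ℝ) _ hq1]
    exact Trivialization.symmL_continuousLinearMapAt _ hq1 w
  have hGu : ∀ u v : E, ContinuousLinearMap.inCoordinates E (TangentSpace I) (E →L[ℝ] ℝ)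
      (fun b => TangentSpace I b →L[ℝ] ℝ) p₀.1 q.1 p₀.1 q.1 (g.inner q.1) u v =
      g.inner q.1 ((trivializationAt E (TangentSpace I : M → Type _) p₀.1).symm q.1 u)
        ((trivializationAt E (TangentSpace I : M → Type _) p₀.1).symm q.1 v) := by
    intro u v
    refine (inCoordinates_apply_eq₂ hq1 hq1 (by simp)).trans ?_
    simp
  have e1 := hGu (inTangentCoordinates (I.prod 𝓘(ℝ, ℝ)) I id Prod.fst
      (mfderiv (I.prod 𝓘(ℝ, ℝ)) I (Prod.fst : ConeSpace M → M)) p₀ q u)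
      (inTangentCoordinates (I.prod 𝓘(ℝ, ℝ)) I id Prod.fst
      (mfderiv (I.prod 𝓘(ℝ, ℝ)) I (Prod.fst : ConeSpace M → M)) p₀ q v)
  rw [hAu, hAu, hsymm, hsymm, ← hAu, ← hAu] at e1
  have e2 := congrArg₂ (fun s t : ℝ => a ^ 2 * (q.2 : ℝ) ^ 2 * s + t) e1.symm
    (congrArg₂ (fun s t : ℝ => s * t) (hBu u).symm (hBu v).symm)
  simp only [Trivial.fiberBundle_trivializationAt', Trivial.linearMapAt_trivialization,
    LinearMap.id_coe, id_eq]
  exact e2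

/-- The metric cone `(M × ℝ⁺, a² r² g + dr²)` with cone constant `a > 0`. -/
def coneMetric (g : RMetric I M) (a : ℝ) (ha : 0 < a) : RMetric (coneModel I) (ConeSpace M) where
  inner := coneForm g a
  symm p u v := by
    rw [coneForm_apply, coneForm_apply, g.symm, mul_comm (coneDr p u)]
  pos p w hw := by
    have hr : (0 : ℝ) < p.2 := p.2.2
    rw [coneForm_apply]
    by_cases h : coneProj p w = 0
    · have h' : coneDr p w ≠ 0 := by
        intro h'
        apply hw
        rw [cone_decomp p w, h, h', map_zero, zero_smul, add_zero]
      rw [h]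
      have := mul_self_pos.2 h'
      simpa using this
    · have h1 := g.pos p.1 _ h
      have h2 := mul_self_nonneg (coneDr p w)
      positivity
  isVonNBounded p := by
    have hr : (0 : ℝ) < p.2 := p.2.2
    have har : 0 < a * (p.2 : ℝ) := mul_pos ha hr
    have h1 : Bornology.IsVonNBounded ℝ
        (((a * (p.2 : ℝ))⁻¹ • coneIncl p) '' {v : TangentSpace I p.1 | g.inner p.1 v v < 1}) :=
      (g.isVonNBounded p.1).image _
    have h2 : Bornology.IsVonNBounded ℝ
        ((ContinuousLinearMap.toSpanSingleton ℝ (coneRadial (I := I) p)) '' Metric.ball (0 : ℝ) 1) :=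
      (NormedSpace.isVonNBounded_ball ℝ ℝ 1).image
        (ContinuousLinearMap.toSpanSingleton ℝ (coneRadial (I := I) p))
    refine (h1.add h2).subset ?_
    intro w hw
    rw [Set.mem_ofPred_eq, coneForm_apply] at hw
    have h3 : 0 ≤ g.inner p.1 (coneProj p w) (coneProj p w) := by
      by_cases h : coneProj p w = 0
      · simp [h]
      · exact (g.pos p.1 _ h).le
    refine Set.mem_add.2 ⟨coneIncl p (coneProj p w), ?_, coneDr p w • coneRadial p, ?_,
      (cone_decomp p w).symm⟩
    · refine ⟨(a * (p.2 : ℝ)) • coneProj p w, ?_, ?_⟩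
      · simp only [Set.mem_ofPred_eq, map_smul, smul_apply, smul_eq_mul]
        nlinarith [mul_self_nonneg (coneDr p w)]
      · rw [map_smul, smul_apply, smul_smul, mul_inv_cancel₀ har.ne', one_smul]
    · refine ⟨coneDr p w, ?_, by simp⟩
      rw [mem_ball_zero_iff, Real.norm_eq_abs, abs_lt]
      have h4 : coneDr p w * coneDr p w < 1 := by
        have : 0 ≤ a ^ 2 * (p.2 : ℝ) ^ 2 * g.inner p.1 (coneProj p w) (coneProj p w) := by
          positivity
        linarith
      constructor <;> nlinarith
  contMDiff := contMDiff_coneForm g a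

/-- `Dbar` is the appendant connection, on the cone with cone constant `a`, of the metric
connection `D` with skew torsion on `M`: the metric connection whose skew torsion `Tbar` is given by
`Tbar(X,Y) = T(X,Y)` for `X, Y ⊥ ∂_r` and `∂_r ⌟ Tbar = 0`. -/
structure IsAppendant [FiniteDimensional ℝ E] (g : RMetric I M) (a : ℝ) (ha : 0 < a)
    (D : LinConn I M) (Dbar : LinConn (coneModel I) (ConeSpace M)) : Prop where
  metricSkew : IsMetricSkew (coneMetric g a ha) Dbar
  torsion_incl : ∀ (p : ConeSpace M) (u v : TangentSpace I p.1),
    Dbar.torsion p (coneIncl p u) (coneIncl p v) = coneIncl p (D.torsion p.1 u v)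
  torsion_radial : ∀ (p : ConeSpace M) (w : TangentSpace (coneModel I) p),
    Dbar.torsion p (coneRadial p) w = 0

namespace AlmostThreeContactMetric

variable (S : AlmostThreeContactMetric I M)

/-- The signs `1, 1, -1` which make `J_1 J_2 = J_3`. -/
def coneSign : Fin 3 → ℝ := ![1, 1, -1]

/-- The almost complex structures of the cone. Up to the sign `ε_i`, the tensor `J_i` maps
`a r ∂_r` to `ξ_i`, `ξ_i` to `- a r ∂_r`, and `V` to `- φ_i V` for `V ⊥ ξ_i, ∂_r`
(see `coneJ_radial`, `coneJ_reeb`, `coneJ_perp`). -/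
def coneJ (a : ℝ) (i : Fin 3) : EndoField (coneModel I) (ConeSpace M) := fun p =>
  coneSign i •
    ((coneIncl p).comp
        ((coneDr p).smulRight ((a * (p.2 : ℝ))⁻¹ • S.ξ i p.1) - (S.φ i p.1).comp (coneProj p))
      - (a * (p.2 : ℝ)) • ((S.η i p.1).comp (coneProj p)).smulRight (coneRadial p))

theorem coneJ_radial {a : ℝ} (ha : 0 < a) (i : Fin 3) (p : ConeSpace M) :
    S.coneJ a i p ((a * (p.2 : ℝ)) • coneRadial p) = coneSign i • coneIncl p (S.ξ i p.1) := by
  have hr : (0 : ℝ) < p.2 := p.2.2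
  have har : a * (p.2 : ℝ) ≠ 0 := (mul_pos ha hr).ne'
  simp only [coneJ, smul_apply, map_smul, sub_apply,
    ContinuousLinearMap.comp_apply, ContinuousLinearMap.smulRight_apply, coneProj_radial,
    coneDr_radial, map_zero, zero_smul, smul_zero, sub_zero, one_smul]
  rw [smul_comm _ (coneSign i), smul_smul (a * (p.2 : ℝ)), mul_inv_cancel₀ har, one_smul]

theorem coneJ_reeb (a : ℝ) (i : Fin 3) (p : ConeSpace M) :
    S.coneJ a i p (coneIncl p (S.ξ i p.1)) =
      coneSign i • (-((a * (p.2 : ℝ)) • coneRadial p)) := by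
  have hφ : S.φ i p.1 (S.ξ i p.1) = 0 := S.φ_ξ_self i p.1
  simp [coneJ, coneProj_incl, coneDr_incl, hφ, S.η_ξ]

theorem coneJ_perp (a : ℝ) (i : Fin 3) (p : ConeSpace M) (v : TangentSpace I p.1)
    (hv : S.η i p.1 v = 0) :
    S.coneJ a i p (coneIncl p v) = coneSign i • (- coneIncl p (S.φ i p.1 v)) := by
  simp [coneJ, coneProj_incl, coneDr_incl, hv]

end AlmostThreeContactMetric

end Cone

end

open Bundle VectorField
open scoped Manifold ContDiff

noncomputable section

set_option linter.unusedSectionVars false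

/-! ### Pointwise calculus of vector fields -/

section PointwiseCalculus

variable {E : Type*} [NormedAddCommGroup E] [NormedSpace ℝ E]
  {H : Type*} [TopologicalSpace H] {I : ModelWithCorners ℝ E H}
  {M : Type*} [TopologicalSpace M] [ChartedSpace H M] [IsManifold I ∞ M]

/-- Differentiability of a vector field at a point. -/
def DiffVFAt (X : VField I M) (x : M) : Prop :=
  MDifferentiableAt I (I.prod 𝓘(ℝ, E))
    (fun x => TotalSpace.mk' E (E := fun x : M => TangentSpace I x) x (X x)) x

/-- Smoothness of a vector field at a point. -/
def SmoothVFAt (X : VField I M) (x : M) : Prop :=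
  ContMDiffAt I (I.prod 𝓘(ℝ, E)) ∞
    (fun x => TotalSpace.mk' E (E := fun x : M => TangentSpace I x) x (X x)) x

/-- Differentiability of a function at a point. -/
abbrev DiffFunAt (I : ModelWithCorners ℝ E H) (f : M → ℝ) (x : M) : Prop :=
  MDifferentiableAt I 𝓘(ℝ, ℝ) f x

/-- Smoothness of a function at a point. -/
abbrev SmoothFunAt (I : ModelWithCorners ℝ E H) (f : M → ℝ) (x : M) : Prop :=
  ContMDiffAt I 𝓘(ℝ, ℝ) ∞ f x

theorem SmoothVF.at {X : VField I M} (hX : SmoothVF X) (x : M) : SmoothVFAt X x := hX x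

theorem SmoothVFAt.diff {X : VField I M} {x : M} (hX : SmoothVFAt X x) : DiffVFAt X x :=
  ContMDiffAt.mdifferentiableAt hX (by simp)

theorem SmoothVF.diff {X : VField I M} (hX : SmoothVF X) (x : M) : DiffVFAt X x := (hX.at x).diff

theorem SmoothFunAt.diff {f : M → ℝ} {x : M} (hf : SmoothFunAt I f x) : DiffFunAt I f x :=
  ContMDiffAt.mdifferentiableAt hf (by simp)

section

variable {X Y : VField I M} {x : M} {f : M → ℝ}

theorem DiffVFAt.add (hX : DiffVFAt X x) (hY : DiffVFAt Y x) : DiffVFAt (X + Y) x :=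
  mdifferentiableAt_add_section hX hY

theorem DiffVFAt.smul (hf : DiffFunAt I f x) (hX : DiffVFAt X x) : DiffVFAt (f • X) x :=
  MDifferentiableAt.smul_section hf hX

theorem SmoothVFAt.sub (hX : SmoothVFAt X x) (hY : SmoothVFAt Y x) : SmoothVFAt (X - Y) x :=
  ContMDiffAt.sub_section hX hY

theorem SmoothVFAt.smul (hf : SmoothFunAt I f x) (hX : SmoothVFAt X x) : SmoothVFAt (f • X) x :=
  ContMDiffAt.smul_section hf hX

theorem SmoothVFAt.sum {ι : Type*} [Fintype ι] {s : ι → VField I M}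
    (hs : ∀ i, SmoothVFAt (s i) x) : SmoothVFAt (fun y => ∑ i, s i y) x :=
  ContMDiffAt.sum_section fun i _ => hs i

theorem SmoothVFAt.congr (hX : SmoothVFAt X x) (h : ∀ᶠ y in nhds x, Y y = X y) :
    SmoothVFAt Y x :=
  ContMDiffAt.congr_of_eventuallyEq hX (h.mono fun y hy => by simp [hy])

theorem SmoothVFAt.bracket [CompleteSpace E] (hX : SmoothVFAt X x) (hY : SmoothVFAt Y x) :
    SmoothVFAt (mlieBracket I X Y) x := by
  have h2 : IsManifold I (minSmoothness ℝ 2) M := by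
    rw [minSmoothness_of_isRCLikeNormedField]; infer_instance
  have h3 : IsManifold I (((⊤ : ℕ∞) : WithTop ℕ∞) + 1) M := by
    exact ‹IsManifold I ∞ M›
  exact ContMDiffAt.mlieBracket_vectorField (m := ⊤) (n := ⊤) hX hY (by simp)

theorem endo_smoothAt {φ : EndoField I M} (hφ : SmoothEndo φ) (hX : SmoothVFAt X x) :
    SmoothVFAt (endoApply φ X) x :=
  ContMDiffAt.clm_bundle_apply (hφ x) hX

theorem endo_diffAt {φ : EndoField I M} (hφ : SmoothEndo φ) (hX : DiffVFAt X x) :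
    DiffVFAt (endoApply φ X) x :=
  MDifferentiableAt.clm_bundle_apply ((hφ x).mdifferentiableAt (by simp)) hX

theorem endo_smooth {φ : EndoField I M} (hφ : SmoothEndo φ) (hX : SmoothVF X) :
    SmoothVF (endoApply φ X) := fun x => endo_smoothAt hφ (hX.at x)

theorem form_smoothAt {η : OneForm I M} (hη : SmoothOneForm η) (hX : SmoothVFAt X x) :
    SmoothFunAt I (fun y => η y (X y)) x := by
  have h := ContMDiffAt.clm_bundle_apply (E₂ := Bundle.Trivial M ℝ) (F₂ := ℝ) (hη x) hX
  exact ((contMDiffAt_totalSpace).1 h).2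

theorem form_diffAt {η : OneForm I M} (hη : SmoothOneForm η) (hX : DiffVFAt X x) :
    DiffFunAt I (fun y => η y (X y)) x := by
  have h := MDifferentiableAt.clm_bundle_apply (E₂ := Bundle.Trivial M ℝ) (F₂ := ℝ)
    ((hη x).mdifferentiableAt (by simp)) hX
  exact ((mdifferentiableAt_totalSpace I _).1 h).2

theorem inner_smoothAt (g : RMetric I M) (hX : SmoothVFAt X x) (hY : SmoothVFAt Y x) :
    SmoothFunAt I (fun y => g.inner y (X y) (Y y)) x := by
  have h := ContMDiffAt.clm_bundle_apply₂ (E₃ := Bundle.Trivial M ℝ) (F₃ := ℝ)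
    (g.contMDiff x) hX hY
  exact ((contMDiffAt_totalSpace).1 h).2

theorem inner_diffAt (g : RMetric I M) (hX : DiffVFAt X x) (hY : DiffVFAt Y x) :
    DiffFunAt I (fun y => g.inner y (X y) (Y y)) x := by
  have h := MDifferentiableAt.clm_bundle_apply₂ (E₃ := Bundle.Trivial M ℝ) (F₃ := ℝ)
    ((g.contMDiff x).mdifferentiableAt (by simp)) hX hY
  exact ((mdifferentiableAt_totalSpace I _).1 h).2

end

section

variable {X Y Z : VField I M} {x : M} {f h : M → ℝ}

theorem lieFun_add (hf : DiffFunAt I f x) (hh : DiffFunAt I h x) :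
    lieFun X (fun y => f y + h y) x = lieFun X f x + lieFun X h x := by
  simp [lieFun, mvfderiv_fun_add hf hh]

theorem lieFun_neg : lieFun X (fun y => - f y) x = - lieFun X f x := by
  simp [lieFun, mvfderiv_fun_neg]

theorem lieFun_mul (hf : DiffFunAt I f x) (hh : DiffFunAt I h x) :
    lieFun X (fun y => f y * h y) x = f x * lieFun X h x + h x * lieFun X f x := by
  simp [lieFun, mvfderiv_fun_mul hf hh]

theorem lieFun_const (c : ℝ) : lieFun X (fun _ => c) x = 0 := by
  simp [lieFun, mvfderiv_const]

theorem lieFun_add_left : lieFun (X + Y) f x = lieFun X f x + lieFun Y f x := by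
  simp [lieFun]

theorem lieFun_smul_left : lieFun (h • X) f x = h x * lieFun X f x := by
  simp [lieFun]

theorem lieFun_smoothAt (hX : SmoothVFAt X x) (hf : SmoothFunAt I f x) :
    SmoothFunAt I (lieFun X f) x := by
  have h1 := ContMDiffAt.mfderiv_const (m := ∞) (n := ∞) hf (by simp)
  have h2 := ContMDiffAt.clm_apply_of_inCoordinates (b₁ := id) (b₂ := f)
    (E₁ := fun x : M => TangentSpace I x) (E₂ := fun x : ℝ => TangentSpace 𝓘(ℝ, ℝ) x)
    (v := X) h1 hX hf
  exact (contMDiff_snd_tangentBundle_modelSpace ℝ 𝓘(ℝ, ℝ)).contMDiffAt.comp x h2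

variable [CompleteSpace E]

theorem bracket_add_left (hX : DiffVFAt X x) (hY : DiffVFAt Y x) :
    mlieBracket I (X + Y) Z x = mlieBracket I X Z x + mlieBracket I Y Z x :=
  mlieBracket_add_left hX hY

theorem bracket_add_right (hX : DiffVFAt X x) (hY : DiffVFAt Y x) :
    mlieBracket I Z (X + Y) x = mlieBracket I Z X x + mlieBracket I Z Y x :=
  mlieBracket_add_right hX hY

theorem bracket_smul_left (hf : DiffFunAt I f x) (hX : DiffVFAt X x) :
    mlieBracket I (f • X) Y x = f x • mlieBracket I X Y x - lieFun Y f x • X x := by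
  rw [mlieBracket_smul_left hf hX, neg_smul, neg_add_eq_sub]; rfl

theorem bracket_smul_right (hf : DiffFunAt I f x) (hX : DiffVFAt X x) :
    mlieBracket I Y (f • X) x = f x • mlieBracket I Y X x + lieFun Y f x • X x := by
  rw [mlieBracket_smul_right hf hX, add_comm]; rfl

theorem bracket_swap : mlieBracket I X Y x = - mlieBracket I Y X x := mlieBracket_swap_apply

end

end PointwiseCalculus

/-! ### Frames and smoothness -/

section Frames

variable {E : Type*} [NormedAddCommGroup E] [NormedSpace ℝ E] [FiniteDimensional ℝ E]
  {H : Type*} [TopologicalSpace H] {I : ModelWithCorners ℝ E H}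
  {M : Type*} [TopologicalSpace M] [ChartedSpace H M] [IsManifold I ∞ M]

instance tangentSpace_finiteDimensional (x : M) : FiniteDimensional ℝ (TangentSpace I x) :=
  inferInstanceAs (FiniteDimensional ℝ E)

/-- Every tangent vector extends to a global smooth vector field. -/
theorem exists_smoothVF_eq [T2Space M] {x : M} (v : TangentSpace I x) :
    ∃ V : VField I M, SmoothVF V ∧ V x = v := by
  obtain ⟨s, hs, hsm⟩ := FiberBundle.exists_contMDiffOn_extend (k := ∞) I E v
  obtain ⟨u, hus, hu, hxu⟩ := mem_nhds_iff.1 hs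
  obtain ⟨f, -, hf⟩ := (SmoothBumpFunction.nhds_basis_tsupport (I := I) x).mem_iff.1
    (hu.mem_nhds hxu)
  refine ⟨(f : M → ℝ) • FiberBundle.extend E v, ?_, ?_⟩
  · exact ContMDiffOn.smul_section_of_tsupport f.contMDiff.contMDiffOn hu hf (hsm.mono hus)
  · simp

/-- There are global smooth vector fields forming a basis at a given point. -/
theorem exists_frame [T2Space M] (x : M) :
    ∃ (s : Fin (Module.finrank ℝ E) → VField I M)
      (b : Module.Basis (Fin (Module.finrank ℝ E)) ℝ (TangentSpace I x)),
      (∀ i, SmoothVF (s i)) ∧ ∀ i, s i x = b i := by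
  let b : Module.Basis (Fin (Module.finrank ℝ E)) ℝ (TangentSpace I x) := Module.finBasis ℝ E
  choose s hs hb using fun i => exists_smoothVF_eq (I := I) (b i)
  exact ⟨s, b, hs, hb⟩

theorem det_smoothAt {ι : Type*} [Fintype ι] [DecidableEq ι] {A : M → Matrix ι ι ℝ} {x : M}
    (hA : ∀ i j, SmoothFunAt I (fun y => A y i j) x) : SmoothFunAt I (fun y => (A y).det) x := by
  simp only [Matrix.det_apply']
  refine ContMDiffAt.sum fun σ _ => ?_
  exact contMDiffAt_const.mul (ContMDiffAt.prod fun i _ => hA _ _)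

theorem inv_smoothAt {ι : Type*} [Fintype ι] [DecidableEq ι] {A : M → Matrix ι ι ℝ} {x : M}
    (hA : ∀ i j, SmoothFunAt I (fun y => A y i j) x) (hx : (A x).det ≠ 0) (i j : ι) :
    SmoothFunAt I (fun y => (A y)⁻¹ i j) x := by
  have h1 : (fun y => (A y)⁻¹ i j) = fun y => ((A y).det)⁻¹ * (A y).adjugate i j := by
    funext y
    rw [Matrix.inv_def, Ring.inverse_eq_inv']
    rfl
  rw [h1]
  refine ContMDiffAt.mul ((det_smoothAt hA).inv₀ hx) ?_
  simp only [Matrix.adjugate_apply]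
  refine det_smoothAt fun k l => ?_
  by_cases hk : k = j
  · subst hk
    simp only [Matrix.updateRow_self]
    exact contMDiffAt_const
  · simp only [Matrix.updateRow_ne hk]
    exact hA k l

/-- The Gram matrix of a family of vector fields. -/
def gramField {ι : Type*} (g : RMetric I M) (s : ι → VField I M) (y : M) : Matrix ι ι ℝ :=
  Matrix.of fun i j => g.inner y (s i y) (s j y)

theorem RMetric.eq_zero_of_inner_self (g : RMetric I M) {x : M} {v : TangentSpace I x}
    (h : g.inner x v v = 0) : v = 0 := by
  by_contra hv
  exact (g.pos x v hv).ne' h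

theorem RMetric.eq_of_inner (g : RMetric I M) {x : M} {v w : TangentSpace I x}
    (h : ∀ u, g.inner x v u = g.inner x w u) : v = w := by
  rw [← sub_eq_zero]
  apply RMetric.eq_zero_of_inner_self g
  rw [map_sub, map_sub, sub_apply, sub_apply, h, h]
  ring

theorem gramField_det_ne_zero_iff {ι : Type*} [Fintype ι] [DecidableEq ι] (g : RMetric I M)
    (s : ι → VField I M) (y : M) :
    (gramField g s y).det ≠ 0 ↔ LinearIndependent ℝ (fun i => s i y) := by
  have key : ∀ c : ι → ℝ, ∀ i, (gramField g s y).mulVec c i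
      = g.inner y (s i y) (∑ j, c j • s j y) := by
    intro c i
    simp only [gramField, Matrix.mulVec, dotProduct, Matrix.of_apply, map_sum, map_smul,
      smul_eq_mul]
    exact Finset.sum_congr rfl fun j _ => mul_comm _ _
  rw [Fintype.linearIndependent_iff]
  constructor
  · intro h c hc i
    by_contra hi
    apply h
    rw [← Matrix.exists_mulVec_eq_zero_iff]
    refine ⟨c, fun h0 => hi (by rw [h0]; rfl), ?_⟩
    funext i
    rw [key, hc, map_zero]; rfl
  · intro h h0
    obtain ⟨c, hc, hc'⟩ := Matrix.exists_mulVec_eq_zero_iff.2 h0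
    apply hc
    funext i
    refine h c ?_ i
    apply RMetric.eq_zero_of_inner_self g
    rw [map_sum]
    refine Finset.sum_eq_zero fun i _ => ?_
    rw [map_smul, g.symm, ← key, hc']; simp

/-- A vector field whose products with a local frame are smooth has smooth coefficients. -/
theorem exists_smooth_coeff {ι : Type*} [Fintype ι] (g : RMetric I M)
    {s : ι → VField I M} {x : M} (hs : ∀ i, SmoothVFAt (s i) x)
    (b : Module.Basis ι ℝ (TangentSpace I x)) (hb : ∀ i, s i x = b i) {W : VField I M}
    (hW : ∀ j, SmoothFunAt I (fun y => g.inner y (W y) (s j y)) x) :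
    ∃ c : ι → M → ℝ, (∀ i, SmoothFunAt I (c i) x) ∧
      ∀ᶠ y in nhds x, W y = ∑ i, c i y • s i y := by
  classical
  have hG : ∀ i j, SmoothFunAt I (fun y => gramField g s y i j) x := fun i j =>
    inner_smoothAt g (hs i) (hs j)
  have hx : (gramField g s x).det ≠ 0 := by
    rw [gramField_det_ne_zero_iff]
    simpa only [hb] using b.linearIndependent
  refine ⟨fun i y => ∑ j, (gramField g s y)⁻¹ i j * g.inner y (W y) (s j y), fun i => ?_, ?_⟩
  · exact ContMDiffAt.sum fun j _ => (inv_smoothAt hG hx i j).mul (hW j)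
  · have hev : ∀ᶠ y in nhds x, (gramField g s y).det ≠ 0 :=
      (det_smoothAt hG).continuousAt.eventually_ne hx
    filter_upwards [hev] with y hy
    have hli := (gramField_det_ne_zero_iff g s y).1 hy
    have hcard : Fintype.card ι = Module.finrank ℝ (TangentSpace I y) := by
      have := Module.finrank_eq_card_basis b
      rw [← this]; rfl
    let by' := basisOfLinearIndependentOfCardEqFinrank' _ hli hcard
    set G := gramField g s y with hGdef
    set c : ι → ℝ := fun i => ∑ j, G⁻¹ i j * g.inner y (W y) (s j y) with hc
    have hmul : G.mulVec c = fun j => g.inner y (W y) (s j y) := by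
      have : c = G⁻¹.mulVec (fun j => g.inner y (W y) (s j y)) := rfl
      rw [this, Matrix.mulVec_mulVec, Matrix.mul_nonsing_inv _ (isUnit_iff_ne_zero.2 hy),
        Matrix.one_mulVec]
    have hflip : g.inner y (W y) = g.inner y (∑ i, c i • s i y) := by
      apply ContinuousLinearMap.coe_injective
      refine by'.ext fun j => ?_
      have e : by' j = s j y := by simp [by']
      rw [e]
      have h1 := congrFun hmul j
      simp only [ContinuousLinearMap.coe_coe]
      rw [← h1, g.symm]
      simp only [Matrix.mulVec, dotProduct, map_sum, map_smul, smul_eq_mul]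
      refine Finset.sum_congr rfl fun i _ => ?_
      rw [hGdef, gramField, Matrix.of_apply, mul_comm]
    exact RMetric.eq_of_inner g fun u => DFunLike.congr_fun hflip u

theorem smoothVFAt_of_inner {ι : Type*} [Fintype ι] (g : RMetric I M)
    {s : ι → VField I M} {x : M} (hs : ∀ i, SmoothVFAt (s i) x)
    (b : Module.Basis ι ℝ (TangentSpace I x)) (hb : ∀ i, s i x = b i) {W : VField I M}
    (hW : ∀ j, SmoothFunAt I (fun y => g.inner y (W y) (s j y)) x) : SmoothVFAt W x := by
  obtain ⟨c, hc, hev⟩ := exists_smooth_coeff g hs b hb hW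
  exact SmoothVFAt.congr (SmoothVFAt.sum fun i => SmoothVFAt.smul (hc i) (hs i)) hev

/-- An endomorphism field is smooth if it maps a local frame to smooth vector fields. -/
theorem endo_contMDiffAt_of_frame {ι : Type*} [Fintype ι] (g : RMetric I M)
    {s : ι → VField I M} {x : M} (hs : ∀ i, SmoothVFAt (s i) x)
    (b : Module.Basis ι ℝ (TangentSpace I x)) (hb : ∀ i, s i x = b i) {L : EndoField I M}
    (hL : ∀ i, SmoothVFAt (endoApply L (s i)) x) :
    ContMDiffAt I (I.prod 𝓘(ℝ, E →L[ℝ] E)) ∞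
      (fun x => TotalSpace.mk' (E →L[ℝ] E)
        (E := fun x : M => TangentSpace I x →L[ℝ] TangentSpace I x) x (L x)) x := by
  rw [contMDiffAt_hom_bundle]
  refine ⟨contMDiffAt_id, ?_⟩
  set e := trivializationAt E (TangentSpace I : M → Type _) x with he
  have hxe : x ∈ e.baseSet := FiberBundle.mem_baseSet_trivializationAt' x
  have key : ∀ v : E, SmoothVFAt (endoApply L (fun y => e.symm y v)) x := by
    intro v
    have hv : SmoothVFAt (fun y => e.symm y v) x := by
      have := e.contMDiffAt_section_iff (IB := I) (n := ∞) (s := fun y => e.symm y v) hxe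
      refine this.2 ?_
      refine (contMDiffAt_const (c := v)).congr_of_eventuallyEq ?_
      filter_upwards [e.open_baseSet.mem_nhds hxe] with y hy
      rw [e.apply_mk_symm hy]
    obtain ⟨c, hc, hev⟩ := exists_smooth_coeff g hs b hb fun j => inner_smoothAt g hv (hs j)
    refine SmoothVFAt.congr (SmoothVFAt.sum fun i => SmoothVFAt.smul (hc i) (hL i)) ?_
    filter_upwards [hev] with y hy
    simp only [endoApply] at hy ⊢
    rw [hy, map_sum]
    exact Finset.sum_congr rfl fun i _ => by rw [map_smul]; rfl
  let β := Module.finBasis ℝ E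
  set F : M → E →L[ℝ] E := fun y => ContinuousLinearMap.inCoordinates E (TangentSpace I) E
    (TangentSpace I) x y x y (L y) with hF
  have h1 : ∀ y, F y = ∑ i, ContinuousLinearMap.smulRightL ℝ E E
      (LinearMap.toContinuousLinearMap (β.coord i)) (F y (β i)) := by
    intro y
    apply ContinuousLinearMap.coe_injective
    refine β.ext fun j => ?_
    simp [Finsupp.single_apply]
  have h2 : ∀ v : E, ContMDiffAt I 𝓘(ℝ, E) ∞ (fun y => F y v) x := by
    intro v
    have h3 := (e.contMDiffAt_section_iff (IB := I) (n := ∞) hxe).1 (key v)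
    refine h3.congr_of_eventuallyEq ?_
    filter_upwards [e.open_baseSet.mem_nhds hxe] with y hy
    have h4 := ContinuousLinearMap.inCoordinates_eq (F := E)
      (E := (TangentSpace I : M → Type _)) (F' := E) (E' := (TangentSpace I : M → Type _))
      (x₀ := x) (x := y) (y₀ := x) (y := y) (ϕ := L y) hy hy
    simp only [hF]
    rw [h4]
    simp only [ContinuousLinearMap.comp_apply, endoApply]
    rfl
  change ContMDiffAt I 𝓘(ℝ, E →L[ℝ] E) ∞ F x
  rw [funext h1]
  exact ContMDiffAt.sum fun i _ =>
    (ContinuousLinearMap.contMDiff _).contMDiffAt.comp x (h2 (β i))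

end Frames

/-! ### The Koszul formula -/

section Koszul

variable {E : Type*} [NormedAddCommGroup E] [NormedSpace ℝ E] [FiniteDimensional ℝ E]
  {H : Type*} [TopologicalSpace H] {I : ModelWithCorners ℝ E H}
  {M : Type*} [TopologicalSpace M] [ChartedSpace H M] [IsManifold I ∞ M]

/-- The right hand side of the Koszul formula, `2 g(∇_X Y, Z)` for the Levi-Civita connection. -/
def koszul (g : RMetric I M) (X Y Z : VField I M) (x : M) : ℝ :=
  lieFun X (fun y => g.inner y (Y y) (Z y)) x + lieFun Y (fun y => g.inner y (X y) (Z y)) x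
    - lieFun Z (fun y => g.inner y (X y) (Y y)) x
    + g.inner x (mlieBracket I X Y x) (Z x) - g.inner x (mlieBracket I X Z x) (Y x)
    - g.inner x (mlieBracket I Y Z x) (X x)

variable (g : RMetric I M) {X X' Y Y' Z Z' : VField I M} {x : M} {f : M → ℝ}

theorem lieFun_inner_add_left (hX : DiffVFAt X x) (hX' : DiffVFAt X' x) (hY : DiffVFAt Y x) :
    lieFun Z (fun y => g.inner y ((X + X') y) (Y y)) x =
      lieFun Z (fun y => g.inner y (X y) (Y y)) x
        + lieFun Z (fun y => g.inner y (X' y) (Y y)) x := by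
  simp only [Pi.add_apply, map_add, add_apply]
  exact lieFun_add (inner_diffAt g hX hY) (inner_diffAt g hX' hY)

theorem lieFun_inner_smul_left (hf : DiffFunAt I f x) (hX : DiffVFAt X x) (hY : DiffVFAt Y x) :
    lieFun Z (fun y => g.inner y ((f • X) y) (Y y)) x =
      f x * lieFun Z (fun y => g.inner y (X y) (Y y)) x + g.inner x (X x) (Y x) * lieFun Z f x := by
  simp only [Pi.smul_apply', map_smul, smul_apply, smul_eq_mul]
  exact lieFun_mul hf (inner_diffAt g hX hY)

theorem lieFun_inner_comm :
    lieFun Z (fun y => g.inner y (X y) (Y y)) x = lieFun Z (fun y => g.inner y (Y y) (X y)) x := by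
  simp only [g.symm]

theorem lieFun_inner_add_right (hX : DiffVFAt X x) (hX' : DiffVFAt X' x) (hY : DiffVFAt Y x) :
    lieFun Z (fun y => g.inner y (Y y) ((X + X') y)) x =
      lieFun Z (fun y => g.inner y (Y y) (X y)) x
        + lieFun Z (fun y => g.inner y (Y y) (X' y)) x := by
  rw [lieFun_inner_comm, lieFun_inner_add_left g hX hX' hY, lieFun_inner_comm g (X := X),
    lieFun_inner_comm g (X := X')]

theorem lieFun_inner_smul_right (hf : DiffFunAt I f x) (hX : DiffVFAt X x) (hY : DiffVFAt Y x) :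
    lieFun Z (fun y => g.inner y (Y y) ((f • X) y)) x =
      f x * lieFun Z (fun y => g.inner y (Y y) (X y)) x + g.inner x (Y x) (X x) * lieFun Z f x := by
  rw [lieFun_inner_comm, lieFun_inner_smul_left g hf hX hY, lieFun_inner_comm g (X := X),
    g.symm x (Y x)]

theorem koszul_add_left (hX : DiffVFAt X x) (hX' : DiffVFAt X' x) (hY : DiffVFAt Y x)
    (hZ : DiffVFAt Z x) : koszul g (X + X') Y Z x = koszul g X Y Z x + koszul g X' Y Z x := by
  simp only [koszul]
  rw [lieFun_add_left, lieFun_inner_add_left g hX hX' hZ, lieFun_inner_add_left g hX hX' hY,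
    bracket_add_left hX hX', bracket_add_left hX hX']
  simp only [Pi.add_apply, map_add, add_apply]
  ring

theorem koszul_smul_left (hf : DiffFunAt I f x) (hX : DiffVFAt X x) (hY : DiffVFAt Y x)
    (hZ : DiffVFAt Z x) : koszul g (f • X) Y Z x = f x * koszul g X Y Z x := by
  simp only [koszul]
  rw [lieFun_smul_left, lieFun_inner_smul_left g hf hX hZ, lieFun_inner_smul_left g hf hX hY,
    bracket_smul_left hf hX, bracket_smul_left hf hX]
  simp only [Pi.smul_apply', map_smul, smul_apply, map_sub, sub_apply, smul_eq_mul]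
  ring

theorem koszul_add_mid (hX : DiffVFAt X x) (hY : DiffVFAt Y x) (hY' : DiffVFAt Y' x)
    (hZ : DiffVFAt Z x) : koszul g X (Y + Y') Z x = koszul g X Y Z x + koszul g X Y' Z x := by
  simp only [koszul]
  rw [lieFun_add_left, lieFun_inner_add_left g hY hY' hZ, lieFun_inner_add_right g hY hY' hX,
    bracket_add_right hY hY', bracket_add_left hY hY']
  simp only [Pi.add_apply, map_add, add_apply]
  ring

theorem koszul_smul_mid (hf : DiffFunAt I f x) (hX : DiffVFAt X x) (hY : DiffVFAt Y x)
    (hZ : DiffVFAt Z x) :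
    koszul g X (f • Y) Z x
      = f x * koszul g X Y Z x + 2 * lieFun X f x * g.inner x (Y x) (Z x) := by
  simp only [koszul]
  rw [lieFun_smul_left, lieFun_inner_smul_left g hf hY hZ, lieFun_inner_smul_right g hf hY hX,
    bracket_smul_right hf hY, bracket_smul_left hf hY]
  simp only [Pi.smul_apply', map_smul, smul_apply, map_sub, sub_apply, map_add, add_apply,
    smul_eq_mul]
  rw [g.symm x (X x)]
  ring

theorem koszul_metric :
    koszul g X Y Z x + koszul g X Z Y x = 2 * lieFun X (fun y => g.inner y (Y y) (Z y)) x := by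
  simp only [koszul]
  rw [lieFun_inner_comm g (X := Z) (Y := Y), bracket_swap (X := Z) (Y := Y)]
  simp only [map_neg, neg_apply]
  ring

theorem koszul_torsion :
    koszul g X Y Z x - koszul g Y X Z x = 2 * g.inner x (mlieBracket I X Y x) (Z x) := by
  simp only [koszul]
  rw [lieFun_inner_comm g (X := Y) (Y := X), bracket_swap (X := Y) (Y := X)]
  simp only [map_neg, neg_apply]
  ring

theorem koszul_add_right (hX : DiffVFAt X x) (hY : DiffVFAt Y x) (hZ : DiffVFAt Z x)
    (hZ' : DiffVFAt Z' x) : koszul g X Y (Z + Z') x = koszul g X Y Z x + koszul g X Y Z' x := by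
  have h1 := koszul_metric g (X := X) (Y := Y) (Z := Z + Z') (x := x)
  have h2 := koszul_metric g (X := X) (Y := Y) (Z := Z) (x := x)
  have h3 := koszul_metric g (X := X) (Y := Y) (Z := Z') (x := x)
  rw [koszul_add_mid g hX hZ hZ' hY, lieFun_inner_add_right g hZ hZ' hY] at h1
  linarith

theorem koszul_smul_right (hf : DiffFunAt I f x) (hX : DiffVFAt X x) (hY : DiffVFAt Y x)
    (hZ : DiffVFAt Z x) : koszul g X Y (f • Z) x = f x * koszul g X Y Z x := by
  have h1 := koszul_metric g (X := X) (Y := Y) (Z := f • Z) (x := x)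
  have h2 := koszul_metric g (X := X) (Y := Y) (Z := Z) (x := x)
  rw [koszul_smul_mid g hf hX hZ hY, lieFun_inner_smul_right g hf hZ hY, g.symm x (Z x)] at h1
  linear_combination h1 - f x * h2

theorem koszul_smoothAt (hX : SmoothVFAt X x) (hY : SmoothVFAt Y x) (hZ : SmoothVFAt Z x) :
    SmoothFunAt I (koszul g X Y Z) x :=
  ((((((lieFun_smoothAt hX (inner_smoothAt g hY hZ)).add
    (lieFun_smoothAt hY (inner_smoothAt g hX hZ))).sub
    (lieFun_smoothAt hZ (inner_smoothAt g hX hY))).add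
    (inner_smoothAt g (hX.bracket hY) hZ)).sub
    (inner_smoothAt g (hX.bracket hZ) hY)).sub
    (inner_smoothAt g (hY.bracket hZ) hX))

/-- The Koszul formula for a metric connection with skew torsion. -/
theorem IsMetricSkew.koszul {D : LinConn I M} (hD : IsMetricSkew g D) (hX : SmoothVF X)
    (hY : SmoothVF Y) (hZ : SmoothVF Z) (x : M) :
    2 * g.inner x (D Y x (X x)) (Z x) =
      koszul g X Y Z x + torsionForm g D x (X x) (Y x) (Z x) := by
  have m1 := hD.metric X Y Z hX hY hZ x
  have m2 := hD.metric Y X Z hY hX hZ x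
  have m3 := hD.metric Z X Y hZ hX hY x
  have t1 := D.torsion_apply (hX.diff x) (hY.diff x)
  have t2 := D.torsion_apply (hX.diff x) (hZ.diff x)
  have t3 := D.torsion_apply (hY.diff x) (hZ.diff x)
  have s1 := hD.skew x (X x) (Y x) (Z x)
  have s2 := hD.skew x (Y x) (Z x) (X x)
  have s3 : torsionForm g D x (Y x) (X x) (Z x) = - torsionForm g D x (X x) (Y x) (Z x) := by
    simp only [torsionForm]
    rw [D.torsion_antisymm, map_neg, neg_apply]
  simp only [torsionForm, t1, t2, t3, map_sub, sub_apply] at s1 s2 s3 ⊢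
  have t1' := D.torsion_apply (hY.diff x) (hX.diff x)
  simp only [t1', map_sub, sub_apply] at s2 s3
  simp only [_root_.koszul]
  have c1 := g.symm x (X x) (D Z x (Y x))
  have c2 := g.symm x (X x) (D Y x (Z x))
  have c3 := g.symm x (Y x) (D Z x (X x))
  linarith

end Koszul

/-! ### Connections with prescribed skew torsion -/

section PrescribedTorsion

variable {E : Type*} [NormedAddCommGroup E] [NormedSpace ℝ E] [FiniteDimensional ℝ E]
  {H : Type*} [TopologicalSpace H] {I : ModelWithCorners ℝ E H}
  {M : Type*} [TopologicalSpace M] [ChartedSpace H M] [IsManifold I ∞ M]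

instance tangentSpace_t2Space (x : M) : T2Space (TangentSpace I x) :=
  inferInstanceAs (T2Space E)

/-- Smooth `3`-forms, smoothness being tested on a smooth frame around each point. -/
structure IsSmoothThreeForm (T : Π x : M, TangentSpace I x → TangentSpace I x →
    TangentSpace I x → ℝ) : Prop where
  add : ∀ x (u v w w' : TangentSpace I x), T x u v (w + w') = T x u v w + T x u v w'
  smul : ∀ x (c : ℝ) (u v w : TangentSpace I x), T x u v (c • w) = c * T x u v w
  swap₁₂ : ∀ x (u v w : TangentSpace I x), T x u v w = - T x v u w
  swap₂₃ : ∀ x (u v w : TangentSpace I x), T x u v w = - T x u w v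
  smooth : ∀ x, ∃ (m : ℕ) (s : Fin m → VField I M)
    (b : Module.Basis (Fin m) ℝ (TangentSpace I x)), (∀ i, SmoothVF (s i)) ∧
      (∀ i, s i x = b i) ∧ ∀ i j k, SmoothFunAt I (fun y => T y (s i y) (s j y) (s k y)) x

namespace IsSmoothThreeForm

variable {T : Π x : M, TangentSpace I x → TangentSpace I x → TangentSpace I x → ℝ}
theorem add_left (hT : IsSmoothThreeForm T) (x : M) (u u' v w : TangentSpace I x) :
    T x (u + u') v w = T x u v w + T x u' v w := by
  rw [hT.swap₁₂, hT.swap₂₃, hT.add, hT.swap₁₂ x u, hT.swap₂₃ x v u, hT.swap₁₂ x u',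
    hT.swap₂₃ x v u']
  ring

theorem add_mid (hT : IsSmoothThreeForm T) (x : M) (u v v' w : TangentSpace I x) :
    T x u (v + v') w = T x u v w + T x u v' w := by
  rw [hT.swap₂₃, hT.add, hT.swap₂₃ x u v, hT.swap₂₃ x u v']
  ring

theorem smul_left (hT : IsSmoothThreeForm T) (x : M) (c : ℝ) (u v w : TangentSpace I x) :
    T x (c • u) v w = c * T x u v w := by
  rw [hT.swap₁₂, hT.swap₂₃, hT.smul, hT.swap₁₂ x u, hT.swap₂₃ x v u]
  ring

theorem smul_mid (hT : IsSmoothThreeForm T) (x : M) (c : ℝ) (u v w : TangentSpace I x) :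
    T x u (c • v) w = c * T x u v w := by
  rw [hT.swap₂₃, hT.smul, hT.swap₂₃ x u v]
  ring

theorem cycle (hT : IsSmoothThreeForm T) (x : M) (u v w : TangentSpace I x) : T x u v w = T x v w u := by
  rw [hT.swap₁₂, hT.swap₂₃, neg_neg]

/-- A `3`-form as a linear map in its last argument. -/
def lin (hT : IsSmoothThreeForm T) (x : M) (u v : TangentSpace I x) : TangentSpace I x →ₗ[ℝ] ℝ where
  toFun w := T x u v w
  map_add' := hT.add x u v
  map_smul' c w := hT.smul x c u v w

theorem sum_right (hT : IsSmoothThreeForm T) {ι : Type*} (s : Finset ι) (x : M) (u v : TangentSpace I x)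
    (c : ι → ℝ) (w : ι → TangentSpace I x) :
    T x u v (∑ i ∈ s, c i • w i) = ∑ i ∈ s, c i * T x u v (w i) := by
  have := map_sum (hT.lin x u v) (fun i => c i • w i) s
  simp only [map_smul, smul_eq_mul] at this
  exact this

theorem smoothAt (hT : IsSmoothThreeForm T) (g : RMetric I M) {X Y Z : VField I M} {x : M} (hX : SmoothVFAt X x)
    (hY : SmoothVFAt Y x) (hZ : SmoothVFAt Z x) :
    SmoothFunAt I (fun y => T y (X y) (Y y) (Z y)) x := by
  obtain ⟨m, s, b, hs, hb, hsm⟩ := hT.smooth x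
  have hs' : ∀ i, SmoothVFAt (s i) x := fun i => (hs i).at x
  have step : ∀ (A B : VField I M), (∀ k, SmoothFunAt I (fun y => T y (A y) (B y) (s k y)) x) →
      ∀ {W : VField I M}, SmoothVFAt W x → SmoothFunAt I (fun y => T y (A y) (B y) (W y)) x := by
    intro A B h W hW
    obtain ⟨c, hc, hev⟩ := exists_smooth_coeff g hs' b hb fun j => inner_smoothAt g hW (hs' j)
    refine (ContMDiffAt.sum (t := Finset.univ)
      (f := fun k y => c k y * T y (A y) (B y) (s k y)) fun k _ =>
      (hc k).mul (h k)).congr_of_eventuallyEq ?_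
    filter_upwards [hev] with y hy
    rw [hy, hT.sum_right]
  have h1 : ∀ i j, SmoothFunAt I (fun y => T y (s i y) (s j y) (Z y)) x := fun i j =>
    step _ _ (hsm i j) hZ
  have h2 : ∀ j, SmoothFunAt I (fun y => T y (s j y) (Z y) (X y)) x := fun j =>
    step _ _ (fun k => (h1 k j).congr_of_eventuallyEq (.of_forall fun y =>
      (hT.cycle y (s k y) (s j y) (Z y)).symm)) hX
  have h3 := step Z X (fun k => (h2 k).congr_of_eventuallyEq (.of_forall fun y =>
      (hT.cycle y (s k y) (Z y) (X y)).symm)) hY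
  exact h3.congr_of_eventuallyEq (.of_forall fun y => (hT.cycle y (Z y) (X y) (Y y)).symm)

end IsSmoothThreeForm

theorem RMetric.exists_sharp (g : RMetric I M) {x : M} (l : TangentSpace I x →ₗ[ℝ] ℝ) :
    ∃ v : TangentSpace I x, ∀ w, g.inner x v w = l w := by
  let F : TangentSpace I x →ₗ[ℝ] Module.Dual ℝ (TangentSpace I x) :=
    (ContinuousLinearMap.coeLM ℝ).comp (g.inner x).toLinearMap
  have hF : Function.Injective F := by
    intro v w h
    exact RMetric.eq_of_inner g fun u => DFunLike.congr_fun h u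
  have hs := (LinearMap.injective_iff_surjective_of_finrank_eq_finrank
    (Subspace.dual_finrank_eq (K := ℝ) (V := TangentSpace I x)).symm).1 hF
  obtain ⟨v, hv⟩ := hs l
  exact ⟨v, fun w => DFunLike.congr_fun hv w⟩

theorem exists_koszulMap (g : RMetric I M)
    {T : Π x : M, TangentSpace I x → TangentSpace I x → TangentSpace I x → ℝ}
    (hT : IsSmoothThreeForm T) {Y : VField I M} {x : M} (hY : DiffVFAt Y x) :
    ∃ L : TangentSpace I x →L[ℝ] TangentSpace I x, ∀ X Z : VField I M, DiffVFAt X x →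
      DiffVFAt Z x → 2 * g.inner x (L (X x)) (Z x)
        = koszul g X Y Z x + T x (X x) (Y x) (Z x) := by
  let Ψ : VField I M → VField I M → ℝ := fun X Z => koszul g X Y Z x + T x (X x) (Y x) (Z x)
  have h1 : ∀ Z, DiffVFAt Z x → TensorialAt I E (Ψ · Z) x := fun Z hZ =>
    { smul := fun {f X} hf hX => by
        simp only [Ψ, koszul_smul_left g hf hX hY hZ, Pi.smul_apply', hT.smul_left, smul_eq_mul]
        ring
      add := fun {X X'} hX hX' => by
        simp only [Ψ, koszul_add_left g hX hX' hY hZ, Pi.add_apply, hT.add_left]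
        ring }
  have h2 : ∀ X, DiffVFAt X x → TensorialAt I E (Ψ X) x := fun X hX =>
    { smul := fun {f Z} hf hZ => by
        simp only [Ψ, koszul_smul_right g hf hX hY hZ, Pi.smul_apply', hT.smul, smul_eq_mul]
        ring
      add := fun {Z Z'} hZ hZ' => by
        simp only [Ψ, koszul_add_right g hX hY hZ hZ', Pi.add_apply, hT.add]
        ring }
  let B := TensorialAt.mkHom₂ Ψ x h1 h2
  have hB : ∀ X Z : VField I M, DiffVFAt X x → DiffVFAt Z x → B (X x) (Z x) = Ψ X Z :=
    fun X Z hX hZ => TensorialAt.mkHom₂_apply h1 h2 hX hZ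
  choose L hL using fun v : TangentSpace I x =>
    RMetric.exists_sharp g ((2⁻¹ : ℝ) • (B v).toLinearMap)
  let L' : TangentSpace I x →ₗ[ℝ] TangentSpace I x :=
    { toFun := L
      map_add' := fun v w => RMetric.eq_of_inner g fun u => by
        simp only [hL, map_add, add_apply, LinearMap.smul_apply, ContinuousLinearMap.coe_coe,
          smul_eq_mul]
        ring
      map_smul' := fun c v => RMetric.eq_of_inner g fun u => by
        simp only [hL, map_smul, smul_apply, LinearMap.smul_apply, ContinuousLinearMap.coe_coe,
          smul_eq_mul, RingHom.id_apply]
        ring }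
  refine ⟨LinearMap.toContinuousLinearMap L', fun X Z hX hZ => ?_⟩
  have : LinearMap.toContinuousLinearMap L' (X x) = L (X x) := rfl
  rw [this, hL]
  simp only [LinearMap.smul_apply, ContinuousLinearMap.coe_coe, smul_eq_mul, hB X Z hX hZ]
  ring

open scoped Classical in
/-- The metric connection whose torsion is a given `3`-form. -/
def koszulConn (g : RMetric I M)
    {T : Π x : M, TangentSpace I x → TangentSpace I x → TangentSpace I x → ℝ}
    (hT : IsSmoothThreeForm T) : Π _ : VField I M, EndoField I M := fun Y x =>
  if h : DiffVFAt Y x then (exists_koszulMap g hT h).choose else 0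

variable (g : RMetric I M)
  {T : Π x : M, TangentSpace I x → TangentSpace I x → TangentSpace I x → ℝ}
  (hT : IsSmoothThreeForm T)

theorem koszulConn_inner {X Y Z : VField I M} {x : M} (hX : DiffVFAt X x) (hY : DiffVFAt Y x)
    (hZ : DiffVFAt Z x) : 2 * g.inner x (koszulConn g hT Y x (X x)) (Z x) =
      koszul g X Y Z x + T x (X x) (Y x) (Z x) := by
  rw [koszulConn, dif_pos hY]
  exact (exists_koszulMap g hT hY).choose_spec X Z hX hZ

theorem diffVFAt_extend {x : M} (v : TangentSpace I x) :
    DiffVFAt (FiberBundle.extend E v : VField I M) x :=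
  FiberBundle.mdifferentiableAt_extend I E v

theorem RMetric.eq_of_inner_vf {x : M} {v w : TangentSpace I x}
    (h : ∀ Z : VField I M, DiffVFAt Z x → g.inner x v (Z x) = g.inner x w (Z x)) : v = w := by
  refine RMetric.eq_of_inner g fun u => ?_
  simpa using h _ (diffVFAt_extend u)

theorem endo_ext_vf {x : M} {L L' : TangentSpace I x →L[ℝ] TangentSpace I x}
    (h : ∀ X : VField I M, DiffVFAt X x → L (X x) = L' (X x)) : L = L' := by
  ext u
  simpa using h _ (diffVFAt_extend u)

theorem isCovariantDerivativeOn_koszulConn :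
    IsCovariantDerivativeOn (I := I) (V := (TangentSpace I : M → Type _)) E
      (koszulConn g hT) Set.univ where
  add {Y Y'} {x} hY hY' _ := by
    refine endo_ext_vf fun X hX => RMetric.eq_of_inner_vf g fun Z hZ => ?_
    have h1 := koszulConn_inner g hT hX hY hZ
    have h2 := koszulConn_inner g hT hX hY' hZ
    have h3 := koszulConn_inner g hT hX (DiffVFAt.add hY hY') hZ
    rw [koszul_add_mid g hX hY hY' hZ, Pi.add_apply, hT.add_mid] at h3
    rw [add_apply, map_add, add_apply]
    linarith
  leibniz {Y f} {x} hY hf _ := by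
    refine endo_ext_vf fun X hX => RMetric.eq_of_inner_vf g fun Z hZ => ?_
    have h1 := koszulConn_inner g hT hX hY hZ
    have h3 := koszulConn_inner g hT hX (DiffVFAt.smul hf hY) hZ
    rw [koszul_smul_mid g hf hX hY hZ, Pi.smul_apply', hT.smul_mid] at h3
    rw [add_apply, map_add, add_apply, smul_apply, map_smul, smul_apply,
      ContinuousLinearMap.smulRight_apply, map_smul, smul_apply, smul_eq_mul, smul_eq_mul]
    have h4 : mvfderiv I f x (X x) = lieFun X f x := rfl
    rw [h4]
    linear_combination h3 / 2 - f x * h1 / 2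

/-- Every smooth `3`-form is the torsion of a metric connection. -/
theorem exists_metricSkew (hT : IsSmoothThreeForm T) [T2Space M] :
    ∃ D : LinConn I M, IsMetricSkew g D ∧ ∀ x u v w, torsionForm g D x u v w = T x u v w := by
  let D : LinConn I M := ⟨koszulConn g hT, isCovariantDerivativeOn_koszulConn g hT⟩
  have hD : ∀ {X Y Z : VField I M} {x : M}, DiffVFAt X x → DiffVFAt Y x → DiffVFAt Z x →
      2 * g.inner x (D Y x (X x)) (Z x) = koszul g X Y Z x + T x (X x) (Y x) (Z x) :=
    fun hX hY hZ => koszulConn_inner g hT hX hY hZ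
  have htor : ∀ x u v w, torsionForm g D x u v w = T x u v w := by
    intro x u v w
    obtain ⟨X, hX, rfl⟩ := exists_smoothVF_eq (I := I) u
    obtain ⟨Y, hY, rfl⟩ := exists_smoothVF_eq (I := I) v
    obtain ⟨Z, hZ, rfl⟩ := exists_smoothVF_eq (I := I) w
    rw [torsionForm, D.torsion_apply (hX.diff x) (hY.diff x)]
    simp only [map_sub, sub_apply]
    have h1 := hD (hX.diff x) (hY.diff x) (hZ.diff x)
    have h2 := hD (hY.diff x) (hX.diff x) (hZ.diff x)
    have h3 := koszul_torsion g (X := X) (Y := Y) (Z := Z) (x := x)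
    rw [hT.swap₁₂ x (Y x) (X x)] at h2
    linarith
  refine ⟨D, ⟨⟨⟨?_⟩⟩, ?_, ?_⟩, htor⟩
  · intro Y hY x _
    rw [contMDiffOn_univ] at hY
    have hY' : SmoothVF Y := hY
    obtain ⟨s, b, hs, hb⟩ := exists_frame (I := I) x
    have h : ContMDiffAt I (I.prod 𝓘(ℝ, E →L[ℝ] E)) ∞
      (fun x => TotalSpace.mk' (E →L[ℝ] E)
        (E := fun x : M => TangentSpace I x →L[ℝ] TangentSpace I x) x (D Y x)) x := by
      refine endo_contMDiffAt_of_frame g (fun i => (hs i).at x) b hb fun i => ?_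
      refine smoothVFAt_of_inner g (fun i => (hs i).at x) b hb fun j => ?_
      have h1 : (fun y => g.inner y (endoApply (D Y) (s i) y) (s j y)) = fun y =>
          2⁻¹ * (koszul g (s i) Y (s j) y + T y (s i y) (Y y) (s j y)) := by
        funext y
        rw [← hD ((hs i).diff y) (hY'.diff y) ((hs j).diff y)]
        simp [endoApply]
      rw [h1]
      exact contMDiffAt_const.mul ((koszul_smoothAt g ((hs i).at x) (hY'.at x) ((hs j).at x)).add
        (hT.smoothAt g ((hs i).at x) (hY'.at x) ((hs j).at x)))
    exact h.contMDiffWithinAt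
  · intro X Y Z hX hY hZ x
    have h1 := hD (hX.diff x) (hY.diff x) (hZ.diff x)
    have h2 := hD (hX.diff x) (hZ.diff x) (hY.diff x)
    have h3 := koszul_metric g (X := X) (Y := Y) (Z := Z) (x := x)
    rw [hT.swap₂₃ x (X x) (Z x)] at h2
    rw [g.symm x (Y x)]
    linarith
  · intro x u v w
    rw [htor, htor, hT.swap₂₃]

end PrescribedTorsion

/-! ### Pointwise algebra of almost `3`-contact metric structures -/

section Algebra

/-- `(i, j, k)` is an even permutation of the indices. -/
structure EvenTriple (i j k : Fin 3) : Prop where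
  snd : j = i + 1
  trd : k = i + 2

theorem EvenTriple.of (i : Fin 3) : EvenTriple i (i + 1) (i + 2) := ⟨rfl, rfl⟩

theorem EvenTriple.rot {i j k : Fin 3} (h : EvenTriple i j k) : EvenTriple j k i := by
  obtain ⟨rfl, rfl⟩ := h
  constructor <;> fin_cases i <;> rfl

theorem EvenTriple.sum {i j k : Fin 3} (h : EvenTriple i j k) {R : Type*} [AddCommMonoid R]
    (f : Fin 3 → R) : ∑ m, f m = f i + f j + f k := by
  obtain ⟨rfl, rfl⟩ := h
  rw [Fin.sum_univ_three]
  fin_cases i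
  · rfl
  · change f 0 + f 1 + f 2 = f 1 + f 2 + f 0
    abel
  · change f 0 + f 1 + f 2 = f 2 + f 0 + f 1
    abel

theorem EvenTriple.cases {i j k : Fin 3} (h : EvenTriple i j k) (m : Fin 3) :
    m = i ∨ m = j ∨ m = k := by
  obtain ⟨rfl, rfl⟩ := h
  revert i m
  decide

variable {E : Type*} [NormedAddCommGroup E] [NormedSpace ℝ E]
  {H : Type*} [TopologicalSpace H] {I : ModelWithCorners ℝ E H}
  {M : Type*} [TopologicalSpace M] [ChartedSpace H M] [IsManifold I ∞ M]

namespace AlmostThreeContactMetric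

variable (S : AlmostThreeContactMetric I M) {i j k : Fin 3} (x : M)

theorem mul_even (h : EvenTriple i j k) (v : TangentSpace I x) :
    S.φ i x (S.φ j x v) = S.φ k x v + S.η j x v • S.ξ i x := by
  obtain ⟨rfl, rfl⟩ := h
  rw [S.φ_mul]; abel

theorem mul_odd (h : EvenTriple i j k) (v : TangentSpace I x) :
    S.φ j x (S.φ i x v) = - S.φ k x v + S.η i x v • S.ξ j x := by
  obtain ⟨rfl, rfl⟩ := h
  rw [S.φ_mul']; abel

theorem reeb_even (h : EvenTriple i j k) : S.φ i x (S.ξ j x) = S.ξ k x := by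
  obtain ⟨rfl, rfl⟩ := h
  rw [S.φ_ξ]

theorem reeb_odd (h : EvenTriple i j k) : S.φ j x (S.ξ i x) = - S.ξ k x := by
  obtain ⟨rfl, rfl⟩ := h
  rw [S.φ_ξ', neg_neg]

theorem form_even (h : EvenTriple i j k) (v : TangentSpace I x) :
    S.η i x (S.φ j x v) = S.η k x v := by
  obtain ⟨rfl, rfl⟩ := h
  rw [S.η_φ]

theorem form_odd (h : EvenTriple i j k) (v : TangentSpace I x) :
    S.η j x (S.φ i x v) = - S.η k x v := by
  obtain ⟨rfl, rfl⟩ := h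
  rw [S.η_φ', neg_neg]

theorem inner_reeb (i : Fin 3) (v : TangentSpace I x) : S.g.inner x v (S.ξ i x) = S.η i x v := by
  have h := S.compat i x v (S.ξ i x)
  rw [S.φ_ξ_self, map_zero, S.η_ξ] at h
  linarith

theorem reeb_inner (i : Fin 3) (v : TangentSpace I x) : S.g.inner x (S.ξ i x) v = S.η i x v := by
  rw [S.g.symm, inner_reeb]

theorem form_self (i : Fin 3) (v : TangentSpace I x) : S.η i x (S.φ i x v) = 0 := by
  have h := S.compat i x (S.φ i x v) (S.ξ i x)
  rw [S.φ_ξ_self, map_zero, S.η_ξ, inner_reeb] at h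
  have h1 := congrArg (S.φ i x) (S.φ_sq i x v)
  rw [S.φ_sq] at h1
  simp only [map_add, map_neg, map_smul, S.φ_ξ_self, smul_zero, add_zero] at h1
  have h2 : S.η i x (S.φ i x v) • S.ξ i x = 0 := by simpa using h1
  have h3 := congrArg (S.η i x) h2
  simpa [S.η_ξ] using h3

theorem reeb_form_even (h : EvenTriple i j k) : S.η i x (S.ξ j x) = 0 := by
  have h1 := S.form_self x i (S.ξ k x)
  rw [S.reeb_odd x h.rot.rot, map_neg] at h1
  linarith

theorem reeb_form_odd (h : EvenTriple i j k) : S.η j x (S.ξ i x) = 0 := by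
  rw [← inner_reeb, S.g.symm, inner_reeb, S.reeb_form_even x h]

theorem inner_φ (i : Fin 3) (u v : TangentSpace I x) :
    S.g.inner x (S.φ i x u) v = - S.g.inner x u (S.φ i x v) := by
  have h := S.compat i x u (S.φ i x v)
  rw [S.φ_sq, S.form_self, map_add, map_neg, map_smul, inner_reeb, S.form_self] at h
  simp at h
  linarith

/-- The projection of a vector onto the horizontal distribution. -/
def hor (v : TangentSpace I x) : TangentSpace I x := v - ∑ i, S.η i x v • S.ξ i x

theorem reeb_form (i j : Fin 3) : S.η i x (S.ξ j x) = if i = j then 1 else 0 := by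
  have h := EvenTriple.of i
  rcases h.cases j with rfl | rfl | rfl
  · rw [if_pos rfl, S.η_ξ]
  · rw [S.reeb_form_even x h, if_neg (by clear h; revert i; decide)]
  · rw [S.reeb_form_odd x h.rot.rot, if_neg (by clear h; revert i; decide)]

theorem form_hor (i : Fin 3) (v : TangentSpace I x) : S.η i x (S.hor x v) = 0 := by
  simp [hor, map_sub, map_sum, reeb_form]

theorem hor_of_horizontal {v : TangentSpace I x} (hv : ∀ i, S.η i x v = 0) : S.hor x v = v := by
  simp [hor, hv]

theorem hor_reeb (i : Fin 3) : S.hor x (S.ξ i x) = 0 := by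
  simp [hor, reeb_form]

theorem hor_add_vert (h : EvenTriple i j k) (v : TangentSpace I x) :
    v = S.hor x v + (S.η i x v • S.ξ i x + S.η j x v • S.ξ j x + S.η k x v • S.ξ k x) := by
  rw [hor, h.sum, sub_add_cancel]

theorem hor_add (u v : TangentSpace I x) : S.hor x (u + v) = S.hor x u + S.hor x v := by
  simp only [hor, map_add, add_smul, Finset.sum_add_distrib]
  abel

theorem hor_smul (c : ℝ) (v : TangentSpace I x) : S.hor x (c • v) = c • S.hor x v := by
  simp only [hor, map_smul, smul_sub, Finset.smul_sum, smul_smul, smul_eq_mul]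

theorem φ_horizontal (i : Fin 3) {v : TangentSpace I x} (hv : ∀ i, S.η i x v = 0) (j : Fin 3) :
    S.η j x (S.φ i x v) = 0 := by
  have h := EvenTriple.of i
  rcases h.cases j with rfl | rfl | rfl
  · exact S.form_self x _ v
  · rw [S.form_odd x h, hv, neg_zero]
  · rw [S.form_even x h.rot.rot, hv]

theorem φ_sq_horizontal (i : Fin 3) {v : TangentSpace I x} (hv : ∀ i, S.η i x v = 0) :
    S.φ i x (S.φ i x v) = - v := by
  rw [S.φ_sq, hv, zero_smul, add_zero]

theorem Phi_swap (i : Fin 3) (u v : TangentSpace I x) : S.Phi i x u v = - S.Phi i x v u := by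
  rw [Phi, Phi, ← inner_φ, S.g.symm]

theorem smooth_hor {X : VField I M} {x : M} (hX : SmoothVFAt X x) :
    SmoothVFAt (fun y => S.hor y (X y)) x :=
  SmoothVFAt.sub hX (SmoothVFAt.sum fun i =>
    SmoothVFAt.smul (form_smoothAt (S.smooth_η i) hX) ((S.smooth_ξ i).at x))

theorem exists_horizontal [FiniteDimensional ℝ E] [T2Space M] {v : TangentSpace I x} (hv : ∀ i, S.η i x v = 0) :
    ∃ X, S.Horizontal X ∧ X x = v := by
  obtain ⟨X, hX, hv'⟩ := exists_smoothVF_eq (I := I) v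
  refine ⟨fun y => S.hor y (X y), ⟨fun y => S.smooth_hor (hX.at y), fun i y => S.form_hor y i _⟩, ?_⟩
  simp only [hv', S.hor_of_horizontal x hv]

end AlmostThreeContactMetric

end Algebra

/-! ### Covariant derivatives of endomorphism fields -/

section CovTensor

variable {E : Type*} [NormedAddCommGroup E] [NormedSpace ℝ E] [FiniteDimensional ℝ E]
  {H : Type*} [TopologicalSpace H] {I : ModelWithCorners ℝ E H}
  {M : Type*} [TopologicalSpace M] [ChartedSpace H M] [IsManifold I ∞ M]

variable (D : LinConn I M) {φ : EndoField I M} {X Y Z : VField I M} {x : M}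

theorem LinConn.add (hX : DiffVFAt X x) (hY : DiffVFAt Y x) : D (X + Y) x = D X x + D Y x :=
  D.isCovariantDerivativeOnUniv.add hX hY

theorem LinConn.smul {f : M → ℝ} (hX : DiffVFAt X x) (hf : DiffFunAt I f x) (u : TangentSpace I x) :
    D (f • X) x u = f x • D X x u + mvfderiv I f x u • X x := by
  rw [D.isCovariantDerivativeOnUniv.leibniz hX hf]; rfl

theorem LinConn.bracket (hX : DiffVFAt X x) (hY : DiffVFAt Y x) :
    mlieBracket I X Y x = D Y x (X x) - D X x (Y x) - D.torsion x (X x) (Y x) := by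
  rw [D.torsion_apply hX hY]; abel

/-- The tensor `(∇_u φ) v`. -/
def covTensor (D : LinConn I M) (φ : EndoField I M) (x : M) (u v : TangentSpace I x) :
    TangentSpace I x :=
  D (endoApply φ (FiberBundle.extend E v)) x u - φ x (D (FiberBundle.extend E v : VField I M) x u)

theorem covEndo_tensorial (hφ : SmoothEndo φ) (u : TangentSpace I x) :
    TensorialAt I E (fun Y : VField I M => D (endoApply φ Y) x u - φ x (D Y x u)) x where
  smul {f Y} hf hY := by
    have h : endoApply φ (f • Y) = f • endoApply φ Y := by
      funext y; simp [endoApply]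
    rw [h, LinConn.smul D (endo_diffAt hφ hY) hf, LinConn.smul D hY hf, map_add, map_smul,
      map_smul, smul_sub]
    simp only [endoApply]
    abel
  add {Y Y'} hY hY' := by
    have h : endoApply φ (Y + Y') = endoApply φ Y + endoApply φ Y' := by
      funext y; simp [endoApply]
    rw [h, LinConn.add D (endo_diffAt hφ hY) (endo_diffAt hφ hY'), LinConn.add D hY hY', add_apply,
      add_apply, map_add]
    abel

theorem covEndo_eq (hφ : SmoothEndo φ) (hY : DiffVFAt Y x) :
    covEndo D φ X Y x = covTensor D φ x (X x) (Y x) :=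
  TensorialAt.pointwise (covEndo_tensorial D hφ (X x)) hY (diffVFAt_extend (Y x)) (by simp)

theorem covTensor_add_left (u u' v : TangentSpace I x) :
    covTensor D φ x (u + u') v = covTensor D φ x u v + covTensor D φ x u' v := by
  simp only [covTensor, map_add]; abel

theorem covTensor_smul_left (c : ℝ) (u v : TangentSpace I x) :
    covTensor D φ x (c • u) v = c • covTensor D φ x u v := by
  simp only [covTensor, map_smul, smul_sub]

theorem covTensor_neg_left (u v : TangentSpace I x) :
    covTensor D φ x (-u) v = - covTensor D φ x u v := by
  simp only [covTensor, map_neg]; abel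

theorem covTensor_add_right (hφ : SmoothEndo φ) (u v v' : TangentSpace I x) :
    covTensor D φ x u (v + v') = covTensor D φ x u v + covTensor D φ x u v' :=
  map_add (TensorialAt.mkHom _ x (covEndo_tensorial D hφ u)) v v'

theorem covTensor_smul_right (hφ : SmoothEndo φ) (c : ℝ) (u v : TangentSpace I x) :
    covTensor D φ x u (c • v) = c • covTensor D φ x u v :=
  map_smul (TensorialAt.mkHom _ x (covEndo_tensorial D hφ u)) c v

theorem cov_endoApply (hφ : SmoothEndo φ) (hY : DiffVFAt Y x) (u : TangentSpace I x) :
    D (endoApply φ Y) x u = covTensor D φ x u (Y x) + φ x (D Y x u) := by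
  have := TensorialAt.pointwise (covEndo_tensorial D hφ u) hY (diffVFAt_extend (Y x)) (by simp)
  rw [covTensor, ← this]
  abel

/-- The Nijenhuis torsion in terms of a connection. -/
theorem nijenhuis_eq (hφ : SmoothEndo φ) (hX : DiffVFAt X x) (hY : DiffVFAt Y x) :
    nijenhuis φ X Y x =
      covTensor D φ x (φ x (X x)) (Y x) - covTensor D φ x (φ x (Y x)) (X x)
        + φ x (covTensor D φ x (Y x) (X x)) - φ x (covTensor D φ x (X x) (Y x))
        - (D.torsion x (φ x (X x)) (φ x (Y x)) + φ x (φ x (D.torsion x (X x) (Y x)))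
          - φ x (D.torsion x (φ x (X x)) (Y x)) - φ x (D.torsion x (X x) (φ x (Y x)))) := by
  have hX' := endo_diffAt hφ hX
  have hY' := endo_diffAt hφ hY
  rw [nijenhuis, LinConn.bracket D hX' hY', LinConn.bracket D hX hY, LinConn.bracket D hX' hY,
    LinConn.bracket D hX hY', cov_endoApply D hφ hX, cov_endoApply D hφ hY, cov_endoApply D hφ hX,
    cov_endoApply D hφ hY]
  simp only [endoApply, map_sub, map_add]
  abel

/-- The covariant derivative of a smooth vector field along a smooth vector field is smooth. -/
theorem IsMetricSkew.smooth_apply {g : RMetric I M} {D : LinConn I M} (hD : IsMetricSkew g D) {X Y : VField I M}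
    (hX : SmoothVF X) (hY : SmoothVF Y) : SmoothVF (fun y => D Y y (X y)) := by
  intro y
  have h := hD.smooth.contMDiff.contMDiff (σ := Y) (contMDiffOn_univ.2 hY)
  rw [contMDiffOn_univ] at h
  exact ContMDiffAt.clm_bundle_apply (h y) (hX y)

end CovTensor

/-! ### The structure tensors in terms of a metric connection -/

section MetricConnection

variable {E : Type*} [NormedAddCommGroup E] [NormedSpace ℝ E] [FiniteDimensional ℝ E]
  {H : Type*} [TopologicalSpace H] {I : ModelWithCorners ℝ E H}
  {M : Type*} [TopologicalSpace M] [ChartedSpace H M] [IsManifold I ∞ M]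

section

variable {g : RMetric I M} {D : LinConn I M}

theorem torsionForm_swap₁₂ (g : RMetric I M) (D : LinConn I M) (x : M) (u v w : TangentSpace I x) :
    torsionForm g D x u v w = - torsionForm g D x v u w := by
  simp only [torsionForm]
  rw [D.torsion_antisymm, map_neg, neg_apply]

theorem covTensor_skew [T2Space M] (hD : IsMetricSkew g D) {φ : EndoField I M} (hφ : SmoothEndo φ)
    (hg : ∀ x (u v : TangentSpace I x), g.inner x (φ x u) v = - g.inner x u (φ x v))
    (x : M) (u v w : TangentSpace I x) :
    g.inner x (covTensor D φ x u v) w = - g.inner x (covTensor D φ x u w) v := by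
  obtain ⟨X, hX, rfl⟩ := exists_smoothVF_eq (I := I) u
  obtain ⟨Y, hY, rfl⟩ := exists_smoothVF_eq (I := I) v
  obtain ⟨Z, hZ, rfl⟩ := exists_smoothVF_eq (I := I) w
  have h1 := hD.metric X (endoApply φ Y) Z hX (endo_smooth hφ hY) hZ x
  have h2 := hD.metric X (endoApply φ Z) Y hX (endo_smooth hφ hZ) hY x
  have h3 : (fun y => g.inner y (endoApply φ Y y) (Z y))
      = fun y => - g.inner y (endoApply φ Z y) (Y y) := by
    funext y
    simp only [endoApply]
    rw [hg, g.symm]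
  rw [h3, lieFun_neg, h2, cov_endoApply D hφ (hY.diff x), cov_endoApply D hφ (hZ.diff x)] at h1
  simp only [endoApply, map_add, add_apply, hg] at h1
  rw [g.symm x (Z x), g.symm x (Y x), hg, hg] at h1
  linarith

theorem covTensor_smooth (hD : IsMetricSkew g D) {φ : EndoField I M} (hφ : SmoothEndo φ)
    {X Y : VField I M} (hX : SmoothVF X) (hY : SmoothVF Y) :
    SmoothVF (fun y => covTensor D φ y (X y) (Y y)) := by
  have h : (fun y => covTensor D φ y (X y) (Y y)) =
      (fun y => D (endoApply φ Y) y (X y)) - endoApply φ (fun y => D Y y (X y)) := by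
    funext y
    rw [Pi.sub_apply, cov_endoApply D hφ (hY.diff y)]
    simp [endoApply]
  rw [h]
  exact fun y => SmoothVFAt.sub (hD.smooth_apply hX (endo_smooth hφ hY) y)
    (endo_smooth hφ (hD.smooth_apply hX hY) y)

/-- Two metric connections with skew torsion differ by half the difference of their torsions. -/
theorem IsMetricSkew.inner_eq [T2Space M] (hD : IsMetricSkew g D) {D' : LinConn I M}
    (hD' : IsMetricSkew g D') {Y : VField I M} (hY : SmoothVF Y) (x : M) (u w : TangentSpace I x) :
    g.inner x (D' Y x u) w = g.inner x (D Y x u) w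
      + (torsionForm g D' x u (Y x) w - torsionForm g D x u (Y x) w) / 2 := by
  obtain ⟨X, hX, rfl⟩ := exists_smoothVF_eq (I := I) u
  obtain ⟨Z, hZ, rfl⟩ := exists_smoothVF_eq (I := I) w
  have h1 := hD.koszul g hX hY hZ x
  have h2 := hD'.koszul g hX hY hZ x
  linarith

theorem IsMetricSkew.inner_covTensor_eq [T2Space M] (hD : IsMetricSkew g D) {D' : LinConn I M}
    (hD' : IsMetricSkew g D') {φ : EndoField I M} (hφ : SmoothEndo φ)
    (hg : ∀ x (u v : TangentSpace I x), g.inner x (φ x u) v = - g.inner x u (φ x v))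
    (x : M) (u v w : TangentSpace I x) :
    g.inner x (covTensor D' φ x u v) w = g.inner x (covTensor D φ x u v) w
      + (torsionForm g D' x u (φ x v) w - torsionForm g D x u (φ x v) w) / 2
      + (torsionForm g D' x u v (φ x w) - torsionForm g D x u v (φ x w)) / 2 := by
  obtain ⟨Y, hY, rfl⟩ := exists_smoothVF_eq (I := I) v
  have h1 := hD.inner_eq hD' (endo_smooth hφ hY) x u w
  have h2 := hD.inner_eq hD' hY x u (φ x w)
  rw [cov_endoApply D hφ (hY.diff x), cov_endoApply D' hφ (hY.diff x)] at h1
  simp only [map_add, add_apply, hg] at h1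
  simp only [endoApply] at h1
  linarith

end

namespace AlmostThreeContactMetric

variable (S : AlmostThreeContactMetric I M) {D : LinConn I M}

/-- `dη_i` in terms of a metric connection with skew torsion. -/
theorem dOne_eq (hD : IsMetricSkew S.g D) (i : Fin 3) {X Y : VField I M} (hX : SmoothVF X)
    (hY : SmoothVF Y) (x : M) :
    dOne (S.η i) X Y x = S.g.inner x (D (S.ξ i) x (X x)) (Y x)
      - S.g.inner x (D (S.ξ i) x (Y x)) (X x) + torsionForm S.g D x (X x) (Y x) (S.ξ i x) := by
  have h1 := hD.metric X Y (S.ξ i) hX hY (S.smooth_ξ i) x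
  have h2 := hD.metric Y X (S.ξ i) hY hX (S.smooth_ξ i) x
  simp only [inner_reeb] at h1 h2
  rw [dOne, h1, h2, LinConn.bracket D (hX.diff x) (hY.diff x), torsionForm, inner_reeb,
    S.g.symm x (Y x), S.g.symm x (X x)]
  simp only [map_sub]
  ring

theorem cov_reeb_skew [T2Space M] (hD : IsMetricSkew S.g D) {i : Fin 3} (hK : IsKilling S.g (S.ξ i)) (x : M)
    (u v : TangentSpace I x) :
    S.g.inner x (D (S.ξ i) x u) v = - S.g.inner x (D (S.ξ i) x v) u := by
  obtain ⟨X, hX, rfl⟩ := exists_smoothVF_eq (I := I) u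
  obtain ⟨Y, hY, rfl⟩ := exists_smoothVF_eq (I := I) v
  have h := hK X Y hX hY x
  have hs := (S.smooth_ξ i).diff x
  have s := hD.skew x (S.ξ i x) (X x) (Y x)
  simp only [torsionForm] at s
  rw [hD.metric _ X Y (S.smooth_ξ i) hX hY, LinConn.bracket D hs (hX.diff x),
    LinConn.bracket D hs (hY.diff x)] at h
  simp only [map_sub, sub_apply] at h
  rw [S.g.symm x (X x), S.g.symm x (X x) (D (S.ξ i) x (Y x)), S.g.symm x (X x) (D.torsion x _ _)] at h
  linarith

theorem cov_reeb_metric [T2Space M] (hD : IsMetricSkew S.g D) (i j : Fin 3) (x : M)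
    (u : TangentSpace I x) :
    S.g.inner x (D (S.ξ i) x u) (S.ξ j x) = - S.g.inner x (D (S.ξ j) x u) (S.ξ i x) := by
  obtain ⟨X, hX, rfl⟩ := exists_smoothVF_eq (I := I) u
  have h := hD.metric X _ _ hX (S.smooth_ξ i) (S.smooth_ξ j) x
  simp only [inner_reeb, reeb_form] at h
  rw [lieFun_const] at h
  rw [← inner_reeb, S.g.symm x (S.ξ i x)] at h
  rw [inner_reeb] at h ⊢
  linarith

theorem dTwo_Phi_eq (hD : IsMetricSkew S.g D) (i : Fin 3) {X Y Z : VField I M}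
    (hX : SmoothVF X) (hY : SmoothVF Y) (hZ : SmoothVF Z) (x : M) :
    dTwo (S.Phi i) X Y Z x =
      (S.g.inner x (covTensor D (S.φ i) x (X x) (Z x)) (Y x)
          + torsionForm S.g D x (X x) (Y x) (S.φ i x (Z x)))
      + (S.g.inner x (covTensor D (S.φ i) x (Y x) (X x)) (Z x)
          + torsionForm S.g D x (Y x) (Z x) (S.φ i x (X x)))
      + (S.g.inner x (covTensor D (S.φ i) x (Z x) (Y x)) (X x)
          + torsionForm S.g D x (Z x) (X x) (S.φ i x (Y x))) := by
  have key : ∀ {X Y Z : VField I M}, SmoothVF X → SmoothVF Y → SmoothVF Z →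
      lieFun X (fun y => S.Phi i y (Y y) (Z y)) x - S.Phi i x (mlieBracket I X Y x) (Z x)
        = S.g.inner x (covTensor D (S.φ i) x (X x) (Z x)) (Y x)
          + torsionForm S.g D x (X x) (Y x) (S.φ i x (Z x))
          + S.g.inner x (D X x (Y x)) (S.φ i x (Z x))
          - S.g.inner x (D Z x (X x)) (S.φ i x (Y x)) := by
    intro X Y Z hX hY hZ
    have h := hD.metric X Y _ hX hY (endo_smooth (S.smooth_φ i) hZ) x
    rw [cov_endoApply D (S.smooth_φ i) (hZ.diff x)] at h
    have e : (fun y => S.Phi i y (Y y) (Z y))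
      = fun y => S.g.inner y (Y y) (endoApply (S.φ i) Z y) := rfl
    have a := S.inner_φ x i (D Z x (X x)) (Y x)
    rw [e, h, Phi, LinConn.bracket D (hX.diff x) (hY.diff x)]
    simp only [map_sub, map_add, sub_apply, endoApply, torsionForm]
    rw [S.g.symm x (Y x) (S.φ i x _), S.g.symm x (Y x) (covTensor _ _ _ _ _)]
    linarith
  rw [dTwo, key hX hY hZ, key hY hZ hX, key hZ hX hY]
  ring

theorem covTensor_φ_skew [T2Space M] (hD : IsMetricSkew S.g D) (i : Fin 3) (x : M)
    (u v w : TangentSpace I x) :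
    S.g.inner x (covTensor D (S.φ i) x u v) w = - S.g.inner x (covTensor D (S.φ i) x u w) v :=
  covTensor_skew hD (S.smooth_φ i) (fun x => S.inner_φ x i) x u v w

theorem covTensor_φ_horizontal [T2Space M] (D : LinConn I M) (i : Fin 3) (x : M)
    (u : TangentSpace I x) {v w : TangentSpace I x} (hv : ∀ m, S.η m x v = 0)
    (hw : ∀ m, S.η m x w = 0) :
    S.g.inner x (covTensor D (S.φ i) x u (S.φ i x v)) w
      = S.g.inner x (covTensor D (S.φ i) x u v) (S.φ i x w) := by
  obtain ⟨Y, hY, rfl⟩ := S.exists_horizontal x hv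
  have hφ := S.smooth_φ i
  have h0 : endoApply (S.φ i) (endoApply (S.φ i) Y) = (fun _ : M => (-1 : ℝ)) • Y := by
    funext y
    simp only [endoApply, Pi.smul_apply', neg_smul, one_smul]
    exact S.φ_sq_horizontal y i fun m => hY.2 m y
  have h1 := cov_endoApply D hφ (endo_smooth hφ hY.1 |>.diff x) u
  rw [cov_endoApply D hφ (hY.1.diff x), h0, LinConn.smul D (hY.1.diff x) mdifferentiableAt_const,
    mvfderiv_const] at h1
  simp only [zero_apply, zero_smul, add_zero, map_add, S.φ_sq] at h1
  have h2 := congrArg (fun v => S.g.inner x v w) h1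
  simp only [map_add, add_apply, map_smul, smul_apply, map_neg, neg_apply, reeb_inner, hw,
    inner_φ, smul_eq_mul] at h2
  simp only [endoApply] at h2
  linarith

/-- `N_i` on horizontal vectors in terms of the Levi-Civita connection. -/
theorem N3_eq (hT : D.torsion = 0) (i : Fin 3) {X Y Z : VField I M}
    (hX : SmoothVF X) (hY : SmoothVF Y) (x : M) (hZ : ∀ m, S.η m x (Z x) = 0) :
    S.N3 i X Y Z x =
      S.g.inner x (covTensor D (S.φ i) x (S.φ i x (X x)) (Y x)) (Z x)
      - S.g.inner x (covTensor D (S.φ i) x (S.φ i x (Y x)) (X x)) (Z x)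
      - S.g.inner x (covTensor D (S.φ i) x (Y x) (X x)) (S.φ i x (Z x))
      + S.g.inner x (covTensor D (S.φ i) x (X x) (Y x)) (S.φ i x (Z x)) := by
  rw [N3, N, nijenhuis_eq D (S.smooth_φ i) (hX.diff x) (hY.diff x), hT]
  simp only [map_add, map_sub, map_smul, add_apply, sub_apply, smul_apply, reeb_inner, hZ,
    Pi.zero_apply, zero_apply, map_zero, sub_zero, smul_zero, add_zero, inner_φ]
  ring

/-- `A_ij` in terms of the Levi-Civita connection. -/
theorem A_eq [T2Space M] (hD : IsMetricSkew S.g D) (hT : D.torsion = 0) (i j : Fin 3)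
    (hK : IsKilling S.g (S.ξ j)) {X Y : VField I M} (hX : SmoothVF X) (hY : SmoothVF Y) (x : M) :
    S.A i j X Y x = S.g.inner x (covTensor D (S.φ i) x (S.ξ j x) (X x)) (Y x)
      + S.g.inner x (D (S.ξ j) x (S.φ i x (X x))) (Y x)
      + S.g.inner x (D (S.ξ j) x (X x)) (S.φ i x (Y x)) := by
  have hφ := S.smooth_φ i
  have k := S.cov_reeb_skew hD hK x
  have k1 := k (S.φ i x (X x)) (Y x)
  have k2 := k (S.φ i x (Y x)) (X x)
  have hs := (S.smooth_ξ j).diff x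
  rw [A, lieEndo, S.dOne_eq hD j hX (endo_smooth hφ hY), S.dOne_eq hD j (endo_smooth hφ hX) hY,
    LinConn.bracket D hs (endo_smooth hφ hX |>.diff x), LinConn.bracket D hs (hX.diff x),
    cov_endoApply D hφ (hX.diff x), torsionForm, torsionForm, hT]
  simp only [map_add, map_sub, add_apply, sub_apply, Pi.zero_apply, zero_apply, map_zero, sub_zero,
    add_zero, inner_φ, endoApply]
  linarith

end AlmostThreeContactMetric

end MetricConnection

/-! ### The canonical connection -/

section CanonicalConnection

variable {E : Type*} [NormedAddCommGroup E] [NormedSpace ℝ E] [FiniteDimensional ℝ E]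
  {H : Type*} [TopologicalSpace H] {I : ModelWithCorners ℝ E H}
  {M : Type*} [TopologicalSpace M] [ChartedSpace H M] [IsManifold I ∞ M]

theorem isSmoothThreeForm_zero [T2Space M] : IsSmoothThreeForm (I := I) (M := M) fun _ _ _ _ => 0 where
  add := by simp
  smul := by simp
  swap₁₂ := by simp
  swap₂₃ := by simp
  smooth x := by
    obtain ⟨s, b, hs, hb⟩ := exists_frame (I := I) x
    exact ⟨_, s, b, hs, hb, fun _ _ _ => contMDiffAt_const⟩

/-- The Levi-Civita connection exists. -/
theorem exists_leviCivita [T2Space M] (g : RMetric I M) :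
    ∃ D : LinConn I M, IsMetricSkew g D ∧ D.torsion = 0 := by
  obtain ⟨D, hD, hT⟩ := exists_metricSkew g (isSmoothThreeForm_zero (I := I) (M := M))
  refine ⟨D, hD, ?_⟩
  funext x
  ext u v
  exact RMetric.eq_of_inner g fun w => by simpa [torsionForm] using hT x u v w

namespace AlmostThreeContactMetric

variable (S : AlmostThreeContactMetric I M) (D : LinConn I M)

theorem IsReebKillingFunction.even {S : AlmostThreeContactMetric I M} {β : M → ℝ}
    (hβ : S.IsReebKillingFunction β) {i j k : Fin 3} (h : EvenTriple i j k) {X Y : VField I M}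
    (hX : S.Horizontal X) (hY : S.Horizontal Y) (x : M) :
    S.A i j X Y x = β x * S.Phi k x (X x) (Y x) := by
  obtain ⟨rfl, rfl⟩ := h
  exact (hβ.2 i X Y hX hY x).2.1

theorem IsReebKillingFunction.odd {S : AlmostThreeContactMetric I M} {β : M → ℝ}
    (hβ : S.IsReebKillingFunction β) {i j k : Fin 3} (h : EvenTriple i j k) {X Y : VField I M}
    (hX : S.Horizontal X) (hY : S.Horizontal Y) (x : M) :
    S.A j i X Y x = - (β x * S.Phi k x (X x) (Y x)) := by
  obtain ⟨rfl, rfl⟩ := h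
  exact (hβ.2 i X Y hX hY x).2.2

/-- `g((∇_u φ_i) v, w)`. -/
def covPhi (i : Fin 3) (x : M) (u v w : TangentSpace I x) : ℝ :=
  S.g.inner x (covTensor D (S.φ i) x u v) w

/-- The horizontal part of the canonical torsion, in terms of the Levi-Civita connection. -/
def horTorsion (i : Fin 3) (x : M) (u v w : TangentSpace I x) : ℝ :=
  S.covPhi D i x u v (S.φ i x w) - S.covPhi D i x v u (S.φ i x w)
    - S.covPhi D i x (S.φ i x w) u v

variable {D}

theorem covPhi_swap [T2Space M] (hD : IsMetricSkew S.g D) (i : Fin 3) (x : M)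
    (u v w : TangentSpace I x) : S.covPhi D i x u v w = - S.covPhi D i x u w v :=
  S.covTensor_φ_skew hD i x u v w

theorem covPhi_neg_left (i : Fin 3) (x : M) (u v w : TangentSpace I x) :
    S.covPhi D i x (-u) v w = - S.covPhi D i x u v w := by
  rw [covPhi, covTensor_neg_left, map_neg, neg_apply, covPhi]

theorem covPhi_neg_right (i : Fin 3) (x : M) (u v w : TangentSpace I x) :
    S.covPhi D i x u v (-w) = - S.covPhi D i x u v w := map_neg _ _

theorem covPhi_φ [T2Space M] (i : Fin 3) (x : M) (u : TangentSpace I x) {v w : TangentSpace I x}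
    (hv : ∀ m, S.η m x v = 0) (hw : ∀ m, S.η m x w = 0) :
    S.covPhi D i x u (S.φ i x v) w = S.covPhi D i x u v (S.φ i x w) :=
  S.covTensor_φ_horizontal D i x u hv hw

theorem horTorsion_swap₁₂ [T2Space M] (hD : IsMetricSkew S.g D) (i : Fin 3) (x : M)
    (u v w : TangentSpace I x) : S.horTorsion D i x u v w = - S.horTorsion D i x v u w := by
  have := S.covPhi_swap hD i x (S.φ i x w) u v
  rw [horTorsion, horTorsion]
  linarith

section Canonical

variable [T2Space M] {S}
  {x : M} {u v w : TangentSpace I x}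

theorem IsCanonical.horTorsion_swap₂₃ (hS : S.IsCanonical) (hD : IsMetricSkew S.g D)
    (hT : D.torsion = 0) (hu : ∀ m, S.η m x u = 0)
    (hv : ∀ m, S.η m x v = 0) (hw : ∀ m, S.η m x w = 0) (i : Fin 3) :
    S.horTorsion D i x u v w = - S.horTorsion D i x u w v := by
  obtain ⟨X, hX, rfl⟩ := S.exists_horizontal x hu
  obtain ⟨Y, hY, rfl⟩ := S.exists_horizontal x hv
  obtain ⟨Z, hZ, rfl⟩ := S.exists_horizontal x hw
  have h := hS.skew i X Y Z hX hY hZ x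
  rw [S.N3_eq hT i hX.1 hY.1 x hw, S.N3_eq hT i hX.1 hZ.1 x hv] at h
  have s1 := S.covPhi_swap hD i x (S.φ i x (X x)) (Y x) (Z x)
  have s2 := S.covPhi_swap hD i x (S.φ i x (Y x)) (Z x) (X x)
  have s3 := S.covPhi_swap hD i x (S.φ i x (Z x)) (X x) (Y x)
  simp only [covPhi] at s1 s2 s3
  simp only [horTorsion, covPhi]
  linarith

theorem IsCanonical.horTorsion_eq (hS : S.IsCanonical) (hD : IsMetricSkew S.g D)
    (hT : D.torsion = 0) (hu : ∀ m, S.η m x u = 0)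
    (hv : ∀ m, S.η m x v = 0) (hw : ∀ m, S.η m x w = 0) (i j : Fin 3) :
    S.horTorsion D i x u v w = S.horTorsion D j x u v w := by
  obtain ⟨X, hX, rfl⟩ := S.exists_horizontal x hu
  obtain ⟨Y, hY, rfl⟩ := S.exists_horizontal x hv
  obtain ⟨Z, hZ, rfl⟩ := S.exists_horizontal x hw
  have key : ∀ i, S.N3 i X Y Z x
        - dTwo (S.Phi i) (endoApply (S.φ i) X) (endoApply (S.φ i) Y) (endoApply (S.φ i) Z) x
      = S.horTorsion D i x (X x) (Y x) (Z x) := by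
    intro i
    have e : ∀ {A B C : VField I M}, S.Horizontal A → S.Horizontal B → S.Horizontal C →
        S.covPhi D i x (S.φ i x (A x)) (S.φ i x (B x)) (S.φ i x (C x))
          = - S.covPhi D i x (S.φ i x (A x)) (B x) (C x) := by
      intro A B C hA hB hC
      rw [S.covPhi_φ i x _ (fun m => hB.2 m x) (S.φ_horizontal x i fun m => hC.2 m x),
        S.φ_sq_horizontal x i fun m => hC.2 m x, covPhi_neg_right]
    have e1 := e hX hZ hY
    have e2 := e hY hX hZ
    have e3 := e hZ hY hX
    have s1 := S.covPhi_swap hD i x (S.φ i x (X x)) (Y x) (Z x)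
    have s2 := S.covPhi_swap hD i x (S.φ i x (Y x)) (Z x) (X x)
    have s3 := S.covPhi_swap hD i x (S.φ i x (Z x)) (X x) (Y x)
    rw [S.N3_eq hT i hX.1 hY.1 x hw, S.dTwo_Phi_eq hD i (endo_smooth (S.smooth_φ i) hX.1)
      (endo_smooth (S.smooth_φ i) hY.1) (endo_smooth (S.smooth_φ i) hZ.1)]
    simp only [torsionForm, hT, Pi.zero_apply, zero_apply, map_zero, endoApply, horTorsion]
    simp only [covPhi] at *
    linarith
  rw [← key, ← key]
  exact hS.compare i j X Y Z hX hY hZ x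

theorem IsCanonical.covPhi_horTorsion (hS : S.IsCanonical) (hD : IsMetricSkew S.g D)
    (hT : D.torsion = 0) (hu : ∀ m, S.η m x u = 0)
    (hv : ∀ m, S.η m x v = 0) (hw : ∀ m, S.η m x w = 0) (i : Fin 3) :
    2 * S.covPhi D i x u v w + S.horTorsion D i x u (S.φ i x v) w
      + S.horTorsion D i x u v (S.φ i x w) = 0 := by
  rw [hS.horTorsion_swap₂₃ hD hT hu (S.φ_horizontal x i hv) hw]
  simp only [horTorsion, S.φ_sq_horizontal x i hv, S.φ_sq_horizontal x i hw, covPhi_neg_right,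
    covPhi_neg_left]
  have s1 := S.covPhi_swap hD i x u v w
  have s2 := S.covPhi_swap hD i x v u w
  have s3 := S.covPhi_swap hD i x w u v
  linarith

end Canonical

/-- The vertical part `dη_i + 2β η_j ∧ η_k` of the canonical torsion. -/
def reebTorsion (D : LinConn I M) (β : ℝ) (i : Fin 3) (x : M) (u v : TangentSpace I x) : ℝ :=
  2 * S.g.inner x (D (S.ξ i) x u) v
    + 2 * β * (S.η (i + 1) x u * S.η (i + 2) x v - S.η (i + 1) x v * S.η (i + 2) x u)

theorem reebTorsion_eq (β : ℝ) {i j k : Fin 3} (h : EvenTriple i j k) (x : M) (u v : TangentSpace I x) :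
    S.reebTorsion D β i x u v = 2 * S.g.inner x (D (S.ξ i) x u) v
      + 2 * β * (S.η j x u * S.η k x v - S.η j x v * S.η k x u) := by
  obtain ⟨rfl, rfl⟩ := h
  rfl

section Reeb

variable {S} {β : ℝ} {x : M}

theorem reebTorsion_add (i : Fin 3) (u v v' : TangentSpace I x) :
    S.reebTorsion D β i x u (v + v') = S.reebTorsion D β i x u v + S.reebTorsion D β i x u v' := by
  simp only [reebTorsion, map_add]; ring

theorem reebTorsion_smul (i : Fin 3) (c : ℝ) (u v : TangentSpace I x) :
    S.reebTorsion D β i x u (c • v) = c * S.reebTorsion D β i x u v := by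
  simp only [reebTorsion, map_smul, smul_eq_mul]; ring

theorem reebTorsion_swap [T2Space M] (hS : S.IsCanonical) (hD : IsMetricSkew S.g D) (i : Fin 3)
    (u v : TangentSpace I x) : S.reebTorsion D β i x u v = - S.reebTorsion D β i x v u := by
  have h := S.cov_reeb_skew hD (hS.killing i) x u v
  simp only [reebTorsion]
  linarith

theorem reebTorsion_reeb [T2Space M] (hD : IsMetricSkew S.g D) (i j : Fin 3)
    (u : TangentSpace I x) :
    S.reebTorsion D β i x u (S.ξ j x) = - S.reebTorsion D β j x u (S.ξ i x) := by
  have m := S.cov_reeb_metric hD i j x u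
  have h := EvenTriple.of i
  rcases h.cases j with e | e | e
  · subst e
    have h1 := S.reeb_form_odd x h
    have h2 := S.reeb_form_even x h.rot.rot
    rw [S.reebTorsion_eq β h, h1, h2]
    linarith
  · rw [e] at m ⊢
    have h1 := S.reeb_form_even x h.rot.rot
    have h2 := S.reeb_form_odd x h.rot
    rw [S.reebTorsion_eq β h, S.reebTorsion_eq β h.rot, S.η_ξ, S.η_ξ, h1, h2]
    linarith
  · rw [e] at m ⊢
    have h1 := S.reeb_form_odd x h
    have h2 := S.reeb_form_even x h.rot
    rw [S.reebTorsion_eq β h, S.reebTorsion_eq β h.rot.rot, S.η_ξ, S.η_ξ, h1, h2]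
    linarith

theorem reebTorsion_vert [T2Space M] (hD : IsMetricSkew S.g D) (i : Fin 3)
    (u v : TangentSpace I x) :
    ∑ m, S.reebTorsion D β m x u (S.ξ i x) * S.η m x v
      = S.reebTorsion D β i x u (S.hor x v) - S.reebTorsion D β i x u v := by
  have h := EvenTriple.of i
  conv_rhs => rw [S.hor_add_vert x h v]
  have e := S.hor_of_horizontal x (v := S.hor x v) fun m => S.form_hor x m v
  rw [h.sum, S.reebTorsion_reeb hD (i + 1) i, S.reebTorsion_reeb hD (i + 2) i]
  have h0 := S.reebTorsion_reeb (β := β) hD i i u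
  simp only [hor_add, hor_smul, hor_reeb, e, reebTorsion_add, reebTorsion_smul, smul_zero, add_zero]
  linear_combination (S.η i x v) * h0

end Reeb

/-- The torsion of the canonical connection. -/
def canTorsion (D : LinConn I M) (β : ℝ) (x : M) (u v w : TangentSpace I x) : ℝ :=
  S.horTorsion D 0 x (S.hor x u) (S.hor x v) (S.hor x w)
    + ∑ i, (S.reebTorsion D β i x u v * S.η i x w
      + S.reebTorsion D β i x (S.hor x w) u * S.η i x v
      + S.reebTorsion D β i x (S.hor x v) (S.hor x w) * S.η i x u)

theorem reebTorsion_vert_swap [T2Space M] (hD : IsMetricSkew S.g D) (β : ℝ) (x : M)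
    (a u v : TangentSpace I x) :
    ∑ m, (S.reebTorsion D β m x a u - S.reebTorsion D β m x a (S.hor x u)) * S.η m x v
      = - ∑ m, (S.reebTorsion D β m x a v - S.reebTorsion D β m x a (S.hor x v)) * S.η m x u := by
  have h : ∀ m (u : TangentSpace I x),
      S.reebTorsion D β m x a u - S.reebTorsion D β m x a (S.hor x u)
        = ∑ l, S.reebTorsion D β m x a (S.ξ l x) * S.η l x u := by
    intro m u
    rw [← neg_sub, ← reebTorsion_vert hD, ← Finset.sum_neg_distrib]
    exact Finset.sum_congr rfl fun l _ => by rw [reebTorsion_reeb hD l m]; ring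
  simp only [h, Finset.sum_mul, ← Finset.sum_neg_distrib]
  rw [Finset.sum_comm]
  refine Finset.sum_congr rfl fun m _ => Finset.sum_congr rfl fun l _ => ?_
  rw [reebTorsion_reeb hD l m]
  ring

theorem covPhi_add_right (i : Fin 3) (x : M) (u v w w' : TangentSpace I x) :
    S.covPhi D i x u v (w + w') = S.covPhi D i x u v w + S.covPhi D i x u v w' := map_add _ _ _

theorem covPhi_smul_right (i : Fin 3) (x : M) (c : ℝ) (u v w : TangentSpace I x) :
    S.covPhi D i x u v (c • w) = c * S.covPhi D i x u v w := map_smul _ _ _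

theorem horTorsion_add (i : Fin 3) (x : M) (u v w w' : TangentSpace I x) :
    S.horTorsion D i x u v (w + w') = S.horTorsion D i x u v w + S.horTorsion D i x u v w' := by
  simp only [horTorsion, map_add, covPhi_add_right]
  simp only [covPhi, covTensor_add_left, map_add, add_apply]
  ring

theorem horTorsion_smul (i : Fin 3) (x : M) (c : ℝ) (u v w : TangentSpace I x) :
    S.horTorsion D i x u v (c • w) = c * S.horTorsion D i x u v w := by
  simp only [horTorsion, map_smul, covPhi_smul_right]
  simp only [covPhi, covTensor_smul_left, map_smul, smul_apply, smul_eq_mul]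
  ring

theorem canTorsion_smooth (hD : IsMetricSkew S.g D) (β : ℝ) {X Y Z : VField I M} (hX : SmoothVF X)
    (hY : SmoothVF Y) (hZ : SmoothVF Z) (x : M) :
    SmoothFunAt I (fun y => S.canTorsion D β y (X y) (Y y) (Z y)) x := by
  have hq : ∀ (i : Fin 3) {X Y Z : VField I M}, SmoothVF X → SmoothVF Y → SmoothVF Z →
      SmoothFunAt I (fun y => S.covPhi D i y (X y) (Y y) (Z y)) x := fun i X Y Z hX hY hZ =>
    inner_smoothAt S.g (covTensor_smooth hD (S.smooth_φ i) hX hY x) (hZ x)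
  have hφ : ∀ (i : Fin 3) {X : VField I M}, SmoothVF X → SmoothVF (fun y => S.φ i y (X y)) :=
    fun i X hX => endo_smooth (S.smooth_φ i) hX
  have hh : ∀ {X : VField I M}, SmoothVF X → SmoothVF (fun y => S.hor y (X y)) :=
    fun hX y => S.smooth_hor (hX y)
  have hη : ∀ (i : Fin 3) {X : VField I M}, SmoothVF X → SmoothFunAt I (fun y => S.η i y (X y)) x :=
    fun i X hX => form_smoothAt (S.smooth_η i) (hX x)
  have hω : ∀ (i : Fin 3) {X Y : VField I M}, SmoothVF X → SmoothVF Y →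
      SmoothFunAt I (fun y => S.reebTorsion D β i y (X y) (Y y)) x := fun i X Y hX hY =>
    (contMDiffAt_const.mul (inner_smoothAt S.g (hD.smooth_apply hX (S.smooth_ξ i) x) (hY x))).add
      (contMDiffAt_const.mul (((hη _ hX).mul (hη _ hY)).sub ((hη _ hY).mul (hη _ hX))))
  refine ContMDiffAt.add (((hq 0 (hh hX) (hh hY) (hφ 0 (hh hZ))).sub
    (hq 0 (hh hY) (hh hX) (hφ 0 (hh hZ)))).sub (hq 0 (hφ 0 (hh hZ)) (hh hX) (hh hY)))
    (ContMDiffAt.sum fun i _ => ?_)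
  exact (((hω i hX hY).mul (hη i hZ)).add ((hω i (hh hZ) hX).mul (hη i hY))).add
    ((hω i (hh hY) (hh hZ)).mul (hη i hX))

variable {S} in
theorem IsCanonical.isSmoothThreeForm_canTorsion [T2Space M] (hS : S.IsCanonical)
    (hD : IsMetricSkew S.g D) (hT : D.torsion = 0) (β : ℝ) :
    IsSmoothThreeForm (S.canTorsion D β) where
  add x u v w w' := by
    simp only [canTorsion, hor_add, horTorsion_add, map_add, reebTorsion_add,
      Finset.sum_add_distrib, reebTorsion_swap hS hD _ _ u, mul_add, add_mul, neg_mul,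
      Finset.sum_neg_distrib]
    ring
  smul x c u v w := by
    simp only [canTorsion, hor_smul, horTorsion_smul, map_smul, smul_eq_mul, reebTorsion_smul,
      reebTorsion_swap hS hD _ _ u, mul_add, Finset.mul_sum]
    congr 1
    exact Finset.sum_congr rfl fun i _ => by ring
  swap₁₂ x u v w := by
    have h1 := S.horTorsion_swap₁₂ hD 0 x (S.hor x u) (S.hor x v) (S.hor x w)
    have h2 := S.reebTorsion_vert_swap hD β x (S.hor x w) u v
    rw [canTorsion, canTorsion, h1, neg_add, ← sub_eq_zero]
    rw [← sub_eq_zero, sub_neg_eq_add, ← Finset.sum_add_distrib] at h2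
    rw [← h2, ← Finset.sum_neg_distrib, add_sub_add_left_eq_sub, ← Finset.sum_sub_distrib]
    refine Finset.sum_congr rfl fun i _ => ?_
    have s1 := reebTorsion_swap (β := β) hS hD i u v
    have s2 := reebTorsion_swap (β := β) hS hD i (S.hor x v) (S.hor x w)
    have s3 := reebTorsion_swap (β := β) hS hD i (S.hor x u) (S.hor x w)
    rw [s1, s2, s3]
    ring
  swap₂₃ x u v w := by
    have h1 := hS.horTorsion_swap₂₃ hD hT (fun m => S.form_hor x m u) (fun m => S.form_hor x m v)
      (fun m => S.form_hor x m w) 0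
    have h2 := S.reebTorsion_vert_swap hD β x u v w
    rw [canTorsion, canTorsion, h1, neg_add, ← sub_eq_zero]
    rw [← sub_eq_zero, sub_neg_eq_add, ← Finset.sum_add_distrib] at h2
    rw [← h2, ← Finset.sum_neg_distrib, add_sub_add_left_eq_sub, ← Finset.sum_sub_distrib]
    refine Finset.sum_congr rfl fun i _ => ?_
    have s1 := reebTorsion_swap (β := β) hS hD i u (S.hor x v)
    have s2 := reebTorsion_swap (β := β) hS hD i u (S.hor x w)
    have s3 := reebTorsion_swap (β := β) hS hD i (S.hor x v) (S.hor x w)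
    rw [s1, s2, s3]
    ring
  smooth x := by
    obtain ⟨s, b, hs, hb⟩ := exists_frame (I := I) x
    exact ⟨_, s, b, hs, hb, fun i j k => S.canTorsion_smooth hD β (hs i) (hs j) (hs k) x⟩

theorem canTorsion_reeb [T2Space M] (hD : IsMetricSkew S.g D) (β : ℝ) (i : Fin 3) (x : M)
    (hS : S.IsCanonical) (u w : TangentSpace I x) :
    S.canTorsion D β x u (S.ξ i x) w = - S.reebTorsion D β i x u w := by
  have h := reebTorsion_vert (β := β) hD i u w
  have h0 : S.horTorsion D 0 x (S.hor x u) (S.hor x (S.ξ i x)) (S.hor x w) = 0 := by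
    have z : ∀ p : TangentSpace I x, covTensor D (S.φ 0) x p 0 = 0 := fun p => by
      simpa using covTensor_smul_right D (S.smooth_φ 0) (x := x) 0 p 0
    have z' : ∀ p : TangentSpace I x, covTensor D (S.φ 0) x 0 p = 0 := fun p => by
      simp [covTensor]
    rw [hor_reeb]
    simp only [horTorsion, covPhi, z, z', map_zero, zero_apply, sub_zero]
  have h1 : ∀ m (q : TangentSpace I x), S.reebTorsion D β m x 0 q = 0 := fun m q => by
    simp [reebTorsion]
  rw [canTorsion, h0, zero_add]
  simp only [hor_reeb, h1, zero_mul, add_zero, Finset.sum_add_distrib, h, reeb_form, mul_ite, mul_one,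
    mul_zero, Finset.sum_ite_eq', Finset.mem_univ, if_true]
  rw [reebTorsion_swap hS hD i u (S.hor x w)]
  ring

end AlmostThreeContactMetric

end CanonicalConnection

/-! ### Existence of the canonical connection -/

section CanonicalExistence

variable {E : Type*} [NormedAddCommGroup E] [NormedSpace ℝ E] [FiniteDimensional ℝ E]
  {H : Type*} [TopologicalSpace H] {I : ModelWithCorners ℝ E H}
  {M : Type*} [TopologicalSpace M] [ChartedSpace H M] [IsManifold I ∞ M]

namespace AlmostThreeContactMetric

variable {S : AlmostThreeContactMetric I M} {D D' : LinConn I M} {β : ℝ} {i j k : Fin 3}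

/-- `covTensor` of the structure endomorphism on a Reeb vector field. -/
theorem covTensor_reeb (D : LinConn I M) (x : M) (i m : Fin 3) (u : TangentSpace I x) :
    covTensor D (S.φ i) x u (S.ξ m x)
      = D (endoApply (S.φ i) (S.ξ m)) x u - S.φ i x (D (S.ξ m) x u) := by
  rw [cov_endoApply D (S.smooth_φ i) ((S.smooth_ξ m).diff x)]
  abel

theorem cov_neg (D : LinConn I M) {Y : VField I M} {x : M} (hY : DiffVFAt Y x)
    (u : TangentSpace I x) : D (-Y) x u = - D Y x u := by
  have h : (-Y : VField I M) = (fun _ : M => (-1 : ℝ)) • Y := by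
    funext y; simp
  rw [h, LinConn.smul D hY mdifferentiableAt_const, mvfderiv_const]
  simp

/-- The right hand side of the equation for the canonical connection. -/
def covTarget (S : AlmostThreeContactMetric I M) (β : ℝ) (i : Fin 3) (x : M) (u v : TangentSpace I x) :
    TangentSpace I x :=
  β • (S.η (i + 2) x u • S.φ (i + 1) x v - S.η (i + 1) x u • S.φ (i + 2) x v)

theorem covTarget_eq (h : EvenTriple i j k) (x : M) (u v : TangentSpace I x) :
    S.covTarget β i x u v = β • (S.η k x u • S.φ j x v - S.η j x u • S.φ k x v) := by
  obtain ⟨rfl, rfl⟩ := h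
  rfl

/-- On Reeb vector fields the equation for `∇ φ_i` follows from that for `∇ ξ_m`. -/
theorem covTensor_reeb_eq
    (hξ : ∀ {i j k : Fin 3}, EvenTriple i j k → ∀ x (u : TangentSpace I x),
      D (S.ξ i) x u = β • (S.η k x u • S.ξ j x - S.η j x u • S.ξ k x))
    (i m : Fin 3) (x : M) (u : TangentSpace I x) :
    covTensor D (S.φ i) x u (S.ξ m x) = S.covTarget β i x u (S.ξ m x) := by
  have h := EvenTriple.of i
  generalize hj : i + 1 = j at h
  generalize hk : i + 2 = k at h
  rw [covTensor_reeb, covTarget_eq h]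
  rcases h.cases m with rfl | rfl | rfl
  · have e : endoApply (S.φ m) (S.ξ m) = 0 := funext fun y => S.φ_ξ_self m y
    rw [e, D.zero, hξ h, S.reeb_odd x h, S.reeb_even x h.rot.rot]
    simp only [map_smul, map_sub, S.reeb_even x h, S.reeb_odd x h.rot.rot]
    simp only [Pi.zero_apply, zero_apply, smul_sub, smul_neg]
    abel
  · have e : endoApply (S.φ i) (S.ξ m) = S.ξ k := funext fun y => S.reeb_even y h
    rw [e, hξ h.rot, hξ h.rot.rot, S.φ_ξ_self, S.reeb_odd x h.rot]
    simp only [map_smul, map_sub, S.φ_ξ_self, S.reeb_odd x h.rot.rot]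
    simp only [smul_sub, smul_neg, smul_zero]
    abel
  · have e : endoApply (S.φ i) (S.ξ m) = - S.ξ j := funext fun y => S.reeb_odd y h.rot.rot
    rw [e, cov_neg D ((S.smooth_ξ _).diff x), hξ h.rot, hξ h.rot.rot, S.φ_ξ_self,
      S.reeb_even x h.rot]
    simp only [map_smul, map_sub, S.φ_ξ_self, S.reeb_even x h]
    simp only [smul_sub, smul_zero]
    abel

theorem covTarget_skew (i : Fin 3) (x : M) (u v w : TangentSpace I x) :
    S.g.inner x (S.covTarget β i x u v) w = - S.g.inner x (S.covTarget β i x u w) v := by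
  simp only [covTarget, map_smul, map_sub, smul_apply, sub_apply, smul_eq_mul]
  rw [inner_φ, inner_φ, S.g.symm x v, S.g.symm x v]
  ring

variable [T2Space M]

theorem covTensor_eq_of_horizontal (hD : IsMetricSkew S.g D) (i : Fin 3) (x : M)
    (h1 : ∀ u v w : TangentSpace I x, (∀ m, S.η m x u = 0) → (∀ m, S.η m x v = 0) →
      (∀ m, S.η m x w = 0) → S.g.inner x (covTensor D (S.φ i) x u v) w = 0)
    (h2 : ∀ (l : Fin 3) (v w : TangentSpace I x), (∀ m, S.η m x v = 0) →
      (∀ m, S.η m x w = 0) → S.g.inner x (covTensor D (S.φ i) x (S.ξ l x) v) w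
        = S.g.inner x (S.covTarget β i x (S.ξ l x) v) w)
    (h3 : ∀ (l : Fin 3) (u : TangentSpace I x),
      covTensor D (S.φ i) x u (S.ξ l x) = S.covTarget β i x u (S.ξ l x))
    (u v : TangentSpace I x) : covTensor D (S.φ i) x u v = S.covTarget β i x u v := by
  have hφ := S.smooth_φ i
  have h12 : ∀ u v w : TangentSpace I x, (∀ m, S.η m x v = 0) → (∀ m, S.η m x w = 0) →
      S.g.inner x (covTensor D (S.φ i) x u v) w = S.g.inner x (S.covTarget β i x u v) w := by
    intro u v w hv hw
    have a1 := h1 (S.hor x u) v w (fun m => S.form_hor x m u) hv hw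
    have a2 := h2 0 v w hv hw
    have a3 := h2 1 v w hv hw
    have a4 := h2 2 v w hv hw
    have a5 : S.covTarget β i x (S.hor x u) v = 0 := by simp [covTarget, form_hor]
    have e := S.hor_add_vert x (EvenTriple.of 0) u
    have t : S.covTarget β i x u v = S.η 0 x u • S.covTarget β i x (S.ξ 0 x) v
        + S.η 1 x u • S.covTarget β i x (S.ξ 1 x) v
        + S.η 2 x u • S.covTarget β i x (S.ξ 2 x) v := by
      fin_cases i <;> simp [covTarget, reeb_form, smul_sub, smul_smul, mul_comm]
      all_goals abel
    rw [t]
    conv_lhs => rw [e]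
    simp only [covTensor_add_left, covTensor_smul_left, map_add, map_smul, add_apply, smul_apply,
      smul_eq_mul]
    have z : (0 : Fin 3) + 1 = 1 := rfl
    have z' : (0 : Fin 3) + 2 = 2 := rfl
    rw [z, z', a1, a2, a3, a4]
    ring
  have h3' : ∀ (l : Fin 3) (u v : TangentSpace I x), S.g.inner x (covTensor D (S.φ i) x u v) (S.ξ l x)
      = S.g.inner x (S.covTarget β i x u v) (S.ξ l x) := by
    intro l u v
    rw [S.covTensor_φ_skew hD, h3, covTarget_skew, neg_neg]
  have h123 : ∀ u v w : TangentSpace I x, (∀ m, S.η m x v = 0) →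
      S.g.inner x (covTensor D (S.φ i) x u v) w = S.g.inner x (S.covTarget β i x u v) w := by
    intro u v w hv
    rw [S.hor_add_vert x (EvenTriple.of 0) w]
    simp only [map_add, map_smul, h3', h12 u v _ hv fun m => S.form_hor x m w]
  refine RMetric.eq_of_inner S.g fun w => ?_
  rw [S.covTensor_φ_skew hD, covTarget_skew, S.hor_add_vert x (EvenTriple.of 0) v]
  simp only [map_add, map_smul]
  have a : S.g.inner x (covTensor D (S.φ i) x u w) (S.hor x v)
      = S.g.inner x (S.covTarget β i x u w) (S.hor x v) := by
    rw [S.covTensor_φ_skew hD, covTarget_skew, h123 u _ w fun m => S.form_hor x m v]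
  rw [a, h3', h3', h3']

/-- The canonical connection of a canonical almost `3`-contact metric manifold. -/
theorem exists_isCanonicalConnection (hS : S.IsCanonical)
    (hβ : S.IsReebKillingFunction (fun _ => β)) :
    ∃ D' : LinConn I M, S.IsCanonicalConnection (fun _ => β) D' := by
  obtain ⟨D, hD, hT⟩ := exists_leviCivita S.g
  have h3 := hS.isSmoothThreeForm_canTorsion hD hT β
  obtain ⟨D', hD', hT'⟩ := exists_metricSkew S.g h3
  have hT0 : ∀ x u v w, torsionForm S.g D x u v w = 0 := fun x u v w => by
    simp [torsionForm, hT]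
  have hξ : ∀ {i j k : Fin 3}, EvenTriple i j k → ∀ x (u : TangentSpace I x),
      D' (S.ξ i) x u = β • (S.η k x u • S.ξ j x - S.η j x u • S.ξ k x) := by
    intro i j k h x u
    refine RMetric.eq_of_inner S.g fun w => ?_
    rw [hD.inner_eq hD' (S.smooth_ξ i), hT', hT0, S.canTorsion_reeb hD β i x hS,
      S.reebTorsion_eq β h]
    simp only [map_smul, map_sub, smul_apply, sub_apply, reeb_inner, smul_eq_mul]
    ring
  refine ⟨D', hD', fun i X Y hX hY x => ?_⟩
  rw [covEndo_eq D' (S.smooth_φ i) (hY.diff x)]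
  have hc := hD.inner_covTensor_eq hD' (S.smooth_φ i) (fun x => S.inner_φ x i) x
  simp only [hT', hT0, sub_zero] at hc
  refine covTensor_eq_of_horizontal hD' i x ?_ ?_ (fun l u => covTensor_reeb_eq hξ i l x u) _ _
  · intro u v w hu hv hw
    have h := hS.covPhi_horTorsion hD hT hu hv hw i
    have hφv := S.φ_horizontal x i hv
    have hφw := S.φ_horizontal x i hw
    rw [hS.horTorsion_eq hD hT hu hφv hw i 0, hS.horTorsion_eq hD hT hu hv hφw i 0] at h
    rw [hc]
    simp only [canTorsion, S.hor_of_horizontal x hu, S.hor_of_horizontal x hv,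
      S.hor_of_horizontal x hw, S.hor_of_horizontal x hφv, S.hor_of_horizontal x hφw, hu, hv, hw,
      hφv, hφw, mul_zero, add_zero, Finset.sum_const_zero]
    simp only [covPhi] at h
    linarith
  · intro l v w hv hw
    obtain ⟨V, hV, rfl⟩ := S.exists_horizontal x hv
    obtain ⟨W, hW, rfl⟩ := S.exists_horizontal x hw
    have hA := S.A_eq hD hT i l (hS.killing l) hV.1 hW.1 x
    have hφv := S.φ_horizontal x i hv
    have hφw := S.φ_horizontal x i hw
    have t : ∀ {v w : TangentSpace I x}, (∀ m, S.η m x v = 0) → (∀ m, S.η m x w = 0) →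
        S.canTorsion D β x (S.ξ l x) v w = 2 * S.g.inner x (D (S.ξ l) x v) w := by
      intro v w hv hw
      rw [h3.swap₁₂, S.canTorsion_reeb hD β l x hS, neg_neg, reebTorsion]
      simp [hv]
    rw [hc, t hφv hw, t hv hφw]
    have e : S.g.inner x (S.covTarget β i x (S.ξ l x) (V x)) (W x) = S.A i l V W x := by
      have h := EvenTriple.of i
      generalize hj : i + 1 = j at h
      generalize hk : i + 2 = k at h
      rw [covTarget_eq h]
      rcases h.cases l with rfl | rfl | rfl
      · rw [(hβ.2 l V W hV hW x).1, S.reeb_form_odd x h, S.reeb_form_even x h.rot.rot]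
        simp
      · rw [hβ.even h hV hW, S.η_ξ, S.reeb_form_odd x h.rot, Phi]
        simp [inner_φ]
      · rw [hβ.odd h.rot.rot hV hW, S.η_ξ, S.reeb_form_even x h.rot, Phi]
        simp [inner_φ]
    rw [e, hA]
    ring

end AlmostThreeContactMetric

end CanonicalExistence

/-! ### The modified connection -/

section Modified

variable {E : Type*} [NormedAddCommGroup E] [NormedSpace ℝ E] [FiniteDimensional ℝ E]
  {H : Type*} [TopologicalSpace H] {I : ModelWithCorners ℝ E H}
  {M : Type*} [TopologicalSpace M] [ChartedSpace H M] [IsManifold I ∞ M]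

/-- The torsion of a metric connection with skew torsion is a smooth `3`-form. -/
theorem isSmoothThreeForm_torsionForm [T2Space M] {D : LinConn I M} {g : RMetric I M} (hD : IsMetricSkew g D) :
    IsSmoothThreeForm (torsionForm g D) where
  add x u v w w' := map_add _ _ _
  smul x c u v w := map_smul _ _ _
  swap₁₂ := torsionForm_swap₁₂ g D
  swap₂₃ := hD.skew
  smooth x := by
    obtain ⟨s, b, hs, hb⟩ := exists_frame (I := I) x
    refine ⟨_, s, b, hs, hb, fun i j k => ?_⟩
    have e : (fun y => D.torsion y (s i y) (s j y)) =
        (fun y => D (s j) y (s i y)) - (fun y => D (s i) y (s j y)) - mlieBracket I (s i) (s j) := by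
      funext y
      rw [D.torsion_apply ((hs i).diff y) ((hs j).diff y)]
      rfl
    have hsm : SmoothVFAt (fun y => D.torsion y (s i y) (s j y)) x := by
      rw [e]
      exact SmoothVFAt.sub (SmoothVFAt.sub (hD.smooth_apply (hs i) (hs j) x)
        (hD.smooth_apply (hs j) (hs i) x)) (SmoothVFAt.bracket (hs i x) (hs j x))
    exact inner_smoothAt g hsm (hs k x)

namespace AlmostThreeContactMetric

variable {S : AlmostThreeContactMetric I M} {D D' : LinConn I M} {β : ℝ} {i j k : Fin 3}

/-- The `3`-form `∑ i, η_i ∧ Φ_i`. -/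
def wedgeSum (S : AlmostThreeContactMetric I M) (x : M) (u v w : TangentSpace I x) : ℝ :=
  ∑ i : Fin 3, wedgeOneTwo (S.η i) (S.Phi i) x u v w

theorem wedgeSum_reeb (h : EvenTriple i j k) (x : M) (u w : TangentSpace I x) :
    S.wedgeSum x u (S.ξ i x) w = 2 * (S.η j x u * S.η k x w - S.η k x u * S.η j x w)
      + S.g.inner x (S.φ i x u) w := by
  rw [wedgeSum, h.sum]
  simp only [wedgeOneTwo, Phi, S.η_ξ, S.reeb_form_odd x h, S.reeb_form_even x h.rot.rot, S.φ_ξ_self,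
    S.reeb_odd x h, S.reeb_even x h.rot.rot, map_zero, map_neg, inner_reeb, reeb_inner,
    S.form_even x h, S.form_odd x h.rot.rot, S.form_self]
  rw [S.g.symm x w]
  ring

theorem wedgeSum_φ (h : EvenTriple i j k) (x : M) (u v w : TangentSpace I x) :
    S.wedgeSum x u (S.φ i x v) w + S.wedgeSum x u v (S.φ i x w)
      = 2 * (S.η j x u * S.g.inner x (S.φ k x v) w - S.η k x u * S.g.inner x (S.φ j x v) w)
        - (S.g.inner x u v * S.η i x w - S.η i x v * S.g.inner x u w) := by
  have h1 : ∀ m, wedgeOneTwo (S.η m) (S.Phi m) x u (S.φ i x v) w =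
      - (S.η m x u * S.g.inner x (S.φ m x (S.φ i x v)) w)
      + S.η m x (S.φ i x v) * S.g.inner x (S.φ m x u) w
      + S.η m x w * S.g.inner x (S.φ i x (S.φ m x u)) v := by
    intro m
    simp only [wedgeOneTwo, Phi]
    rw [S.inner_φ x m (S.φ i x v), S.g.symm x w, S.inner_φ x i (S.φ m x u), S.inner_φ x m u w,
      S.inner_φ x m u (S.φ i x v)]
    ring
  have h2 : ∀ m, wedgeOneTwo (S.η m) (S.Phi m) x u v (S.φ i x w) =
      S.η m x u * S.g.inner x (S.φ i x (S.φ m x v)) w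
      - S.η m x v * S.g.inner x (S.φ i x (S.φ m x u)) w
      - S.η m x (S.φ i x w) * S.g.inner x (S.φ m x u) v := by
    intro m
    simp only [wedgeOneTwo, Phi]
    rw [S.g.symm x (S.φ i x w), S.inner_φ x i (S.φ m x v), S.inner_φ x i (S.φ m x u),
      S.inner_φ x m u (S.φ i x w), S.inner_φ x m u v, S.inner_φ x m v]
    ring
  rw [wedgeSum, wedgeSum, h.sum, h.sum]
  simp only [h1, h2, S.φ_sq, S.mul_even x h, S.mul_odd x h, S.mul_odd x h.rot.rot,
    S.mul_even x h.rot.rot, S.form_self, S.form_odd x h, S.form_even x h.rot.rot, map_add, map_neg,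
    map_smul, add_apply, neg_apply, smul_apply, reeb_inner, smul_eq_mul]
  ring

theorem IsCanonicalConnection.cov_reeb [T2Space M] (hD : S.IsCanonicalConnection (fun _ => β) D)
    (h : EvenTriple i j k) (x : M) (u : TangentSpace I x) :
    D (S.ξ i) x u = β • (S.η k x u • S.ξ j x - S.η j x u • S.ξ k x) := by
  obtain ⟨X, hX, rfl⟩ := exists_smoothVF_eq (I := I) u
  have e := hD.cov_φ i X (S.ξ i) hX (S.smooth_ξ i) x
  obtain ⟨hj, hk⟩ := id h
  rw [← hj, ← hk, covEndo, funext (S.φ_ξ_self i) (f := endoApply (S.φ i) (S.ξ i)) (g := 0), D.zero,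
    S.reeb_odd x h, S.reeb_even x h.rot.rot] at e
  have m := S.cov_reeb_metric hD.metricSkew i i x (X x)
  rw [inner_reeb] at m
  have m' : S.η i x (D (S.ξ i) x (X x)) = 0 := by linarith
  have f := congrArg (S.φ i x) e
  simp only [Pi.zero_apply, zero_apply, zero_sub, map_neg, map_smul, map_sub, S.φ_sq, m', zero_smul,
    add_zero, neg_neg, S.reeb_even x h, S.reeb_odd x h.rot.rot] at f
  rw [f]

theorem IsModifiedConnection.torsionForm_eq (h : S.IsModifiedConnection β D D') (x : M)
    (u v w : TangentSpace I x) :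
    torsionForm S.g D' x u v w - torsionForm S.g D x u v w = β * S.wedgeSum x u v w := by
  rw [h.torsion_eq, wedgeSum]
  ring

variable [T2Space M]

theorem IsModifiedConnection.cov_reeb (hD : S.IsCanonicalConnection (fun _ => β) D)
    (hD' : S.IsModifiedConnection β D D') (i : Fin 3) (x : M) (u : TangentSpace I x) :
    D' (S.ξ i) x u = (β / 2) • S.φ i x u := by
  have h := EvenTriple.of i
  refine RMetric.eq_of_inner S.g fun w => ?_
  rw [hD.metricSkew.inner_eq hD'.metricSkew (S.smooth_ξ i), hD'.torsionForm_eq, wedgeSum_reeb h,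
    hD.cov_reeb h]
  simp only [map_smul, map_sub, smul_apply, sub_apply, reeb_inner, smul_eq_mul]
  ring

theorem IsModifiedConnection.covTensor_φ (hD : S.IsCanonicalConnection (fun _ => β) D)
    (hD' : S.IsModifiedConnection β D D') (i : Fin 3) (x : M) (u v : TangentSpace I x) :
    covTensor D' (S.φ i) x u v
      = (β / 2) • (S.η i x v • u - S.g.inner x u v • S.ξ i x) := by
  have h := EvenTriple.of i
  refine RMetric.eq_of_inner S.g fun w => ?_
  obtain ⟨X, hX, rfl⟩ := exists_smoothVF_eq (I := I) u
  obtain ⟨Y, hY, rfl⟩ := exists_smoothVF_eq (I := I) v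
  have e := hD.cov_φ i X Y hX hY x
  rw [covEndo_eq D (S.smooth_φ i) (hY.diff x)] at e
  have f := S.wedgeSum_φ h x (X x) (Y x) w
  rw [hD.metricSkew.inner_covTensor_eq hD'.metricSkew (S.smooth_φ i) (fun x => S.inner_φ x i),
    hD'.torsionForm_eq, hD'.torsionForm_eq, e]
  simp only [map_smul, map_sub, smul_apply, sub_apply, reeb_inner, smul_eq_mul]
  linear_combination (β / 2) * f

theorem isSmoothThreeForm_modified {g : RMetric I M} {T : Π x : M, TangentSpace I x → TangentSpace I x →
    TangentSpace I x → ℝ} (hT : IsSmoothThreeForm T) (β : ℝ) :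
    IsSmoothThreeForm fun x u v w => T x u v w + β * S.wedgeSum x u v w where
  add x u v w w' := by
    simp only [hT.add, wedgeSum, wedgeOneTwo, Phi, map_add, add_apply, Fin.sum_univ_three]
    ring
  smul x c u v w := by
    simp only [hT.smul, wedgeSum, wedgeOneTwo, Phi, map_smul, smul_apply, Fin.sum_univ_three,
      smul_eq_mul]
    ring
  swap₁₂ x u v w := by
    have s := fun m => S.Phi_swap x m u v
    have s' := fun m => S.Phi_swap x m v w
    have s'' := fun m => S.Phi_swap x m u w
    simp only [wedgeSum, wedgeOneTwo, Fin.sum_univ_three, s, s', s'', hT.swap₁₂ x u v w]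
    ring
  swap₂₃ x u v w := by
    have s := fun m => S.Phi_swap x m u v
    have s' := fun m => S.Phi_swap x m v w
    have s'' := fun m => S.Phi_swap x m u w
    simp only [wedgeSum, wedgeOneTwo, Fin.sum_univ_three, s, s', s'', hT.swap₂₃ x u v w]
    ring
  smooth x := by
    obtain ⟨s, b, hs, hb⟩ := exists_frame (I := I) x
    refine ⟨_, s, b, hs, hb, fun i j k => (hT.smoothAt g (hs i x) (hs j x) (hs k x)).add
      (contMDiffAt_const.mul (ContMDiffAt.sum fun m _ => ?_))⟩
    have hη : ∀ i, SmoothFunAt I (fun y => S.η m y (s i y)) x := fun i =>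
      form_smoothAt (S.smooth_η m) (hs i x)
    have hΦ : ∀ i j, SmoothFunAt I (fun y => S.Phi m y (s i y) (s j y)) x := fun i j =>
      inner_smoothAt S.g (hs i x) (endo_smooth (S.smooth_φ m) (hs j) x)
    exact (((hη i).mul (hΦ j k)).add ((hη j).mul (hΦ k i))).add ((hη k).mul (hΦ i j))

theorem exists_isModifiedConnection (hD : IsMetricSkew S.g D) (β : ℝ) :
    ∃ D' : LinConn I M, S.IsModifiedConnection β D D' := by
  obtain ⟨D', hD', hT'⟩ := exists_metricSkew S.g
    (isSmoothThreeForm_modified (S := S) (g := S.g) (isSmoothThreeForm_torsionForm hD) β)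
  exact ⟨D', hD', hT'⟩

end AlmostThreeContactMetric

end Modified

/-! ### The bracket as a commutator of derivations -/

section Commutator

variable {E : Type*} [NormedAddCommGroup E] [NormedSpace ℝ E] [FiniteDimensional ℝ E]
  {H : Type*} [TopologicalSpace H] {I : ModelWithCorners ℝ E H}
  {M : Type*} [TopologicalSpace M] [ChartedSpace H M] [IsManifold I ∞ M]

theorem jacobi {U V W : VField I M} {x : M} (hU : SmoothVFAt U x) (hV : SmoothVFAt V x)
    (hW : SmoothVFAt W x) :
    mlieBracket I U (mlieBracket I V W) x =
      mlieBracket I (mlieBracket I U V) W x + mlieBracket I V (mlieBracket I U W) x := by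
  have h3 : IsManifold I (minSmoothness ℝ 3) M := by
    rw [minSmoothness_of_isRCLikeNormedField]
    exact IsManifold.of_le (n := ∞) (WithTop.coe_le_coe.2 le_top)
  have h2 : minSmoothness ℝ 2 ≤ (∞ : WithTop ℕ∞) := by
    rw [minSmoothness_of_isRCLikeNormedField]
    exact WithTop.coe_le_coe.2 le_top
  exact leibniz_identity_mlieBracket_apply (hU.of_le h2) (hV.of_le h2) (hW.of_le h2)

theorem bracket_congr {U U' V : VField I M} {x : M} (h : ∀ᶠ y in nhds x, U y = U' y) :
    mlieBracket I V U x = mlieBracket I V U' x :=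
  Filter.EventuallyEq.mlieBracket_vectorField_eq (Filter.EventuallyEq.refl _ V) h

/-- The bracket is the commutator of derivations. -/
theorem lieFun_bracket [T2Space M] {U V : VField I M} (hU : SmoothVF U) (hV : SmoothVF V)
    {f : M → ℝ} {x : M} (hf : SmoothFunAt I f x) :
    lieFun (mlieBracket I U V) f x = lieFun U (lieFun V f) x - lieFun V (lieFun U f) x := by
  by_cases h0 : ∃ v : TangentSpace I x, v ≠ 0
  · obtain ⟨v, hv⟩ := h0
    obtain ⟨W, hW, rfl⟩ := exists_smoothVF_eq (I := I) v
    have hf' : ∀ᶠ y in nhds x, DiffFunAt I f y :=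
      ((contMDiffAt_iff_contMDiffAt_nhds (n := 1) (by simp)).1
        (ContMDiffAt.of_le hf (by simp))).mono fun _ hy =>
        ContMDiffAt.mdifferentiableAt hy (by simp)
    have hfW : SmoothVFAt (f • W) x := SmoothVFAt.smul hf (hW x)
    have key : ∀ {A B : VField I M}, SmoothVF A → SmoothVF B →
        mlieBracket I A (mlieBracket I B (f • W)) x =
          f x • mlieBracket I A (mlieBracket I B W) x + lieFun A f x • mlieBracket I B W x
          + (lieFun B f x • mlieBracket I A W x + lieFun A (lieFun B f) x • W x) := by
      intro A B hA hB
      have e : ∀ᶠ y in nhds x, mlieBracket I B (f • W) y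
          = (f • mlieBracket I B W + lieFun B f • W) y := by
        filter_upwards [hf'] with y hy
        rw [bracket_smul_right hy (hW.diff y)]
        rfl
      have hBW := SmoothVFAt.bracket (hB x) (hW x)
      have hBf := lieFun_smoothAt (hB x) hf
      rw [bracket_congr e, bracket_add_right (SmoothVFAt.smul hf hBW).diff
        (SmoothVFAt.smul hBf (hW x)).diff, bracket_smul_right hf.diff hBW.diff,
        bracket_smul_right hBf.diff (hW.diff x)]
    have j1 := jacobi (hU x) (hV x) hfW
    have j2 := jacobi (hU x) (hV x) (hW x)
    rw [key hU hV, key hV hU, bracket_smul_right hf.diff (hW.diff x), j2] at j1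
    have h : (lieFun (mlieBracket I U V) f x - (lieFun U (lieFun V f) x - lieFun V (lieFun U f) x))
        • W x = 0 := by
      rw [← sub_eq_zero] at j1
      rw [← neg_eq_zero, ← j1]
      module
    rcases smul_eq_zero.1 h with h | h
    · linarith
    · exact absurd h hv
  · push Not at h0
    simp [lieFun, h0 (mlieBracket I U V x), h0 (U x), h0 (V x)]

/-- Smooth functions separate tangent vectors. -/
theorem eq_of_mvfderiv {x : M} {v w : TangentSpace I x}
    (h : ∀ f : M → ℝ, SmoothFunAt I f x → mvfderiv I f x v = mvfderiv I f x w) : v = w := by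
  have h1 : ∀ ℓ : E →L[ℝ] ℝ, ℓ (mfderiv I 𝓘(ℝ, E) (extChartAt I x) x v)
      = ℓ (mfderiv I 𝓘(ℝ, E) (extChartAt I x) x w) := by
    intro ℓ
    have hc : ContMDiffAt I 𝓘(ℝ, E) ∞ (extChartAt I x) x := contMDiffAt_extChartAt
    have hℓ : ContMDiff 𝓘(ℝ, E) 𝓘(ℝ, ℝ) ∞ ℓ := ℓ.contDiff.contMDiff
    have h2 := h (ℓ ∘ extChartAt I x) (hℓ.contMDiffAt.comp x hc)
    have h3 : mfderiv I 𝓘(ℝ, ℝ) (ℓ ∘ extChartAt I x) x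
        = (mfderiv 𝓘(ℝ, E) 𝓘(ℝ, ℝ) ℓ (extChartAt I x x)).comp
          (mfderiv I 𝓘(ℝ, E) (extChartAt I x) x) :=
      mfderiv_comp x (hℓ.mdifferentiableAt (by simp)) (hc.mdifferentiableAt (by simp))
    have h4 : mfderiv 𝓘(ℝ, E) 𝓘(ℝ, ℝ) ℓ (extChartAt I x x) = ℓ := by
      rw [mfderiv_eq_fderiv]; exact ℓ.fderiv
    have h5 : ∀ u : TangentSpace I x, mvfderiv I (ℓ ∘ extChartAt I x) x u
        = ℓ (mfderiv I 𝓘(ℝ, E) (extChartAt I x) x u) := by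
      intro u
      change mfderiv I 𝓘(ℝ, ℝ) (ℓ ∘ extChartAt I x) x u = _
      rw [h3, h4]; rfl
    rwa [h5, h5] at h2
  have h2 : mfderiv I 𝓘(ℝ, E) (extChartAt I x) x v = mfderiv I 𝓘(ℝ, E) (extChartAt I x) x w := by
    by_contra hne
    obtain ⟨ℓ, hℓ⟩ := SeparatingDual.exists_separating_of_ne (R := ℝ) (V := E) hne
    exact hℓ (h1 ℓ)
  exact (isInvertible_mfderiv_extChartAt (mem_extChartAt_source x)).injective h2

end Commutator

/-! ### Vector fields on the cone -/

section ConeFields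

variable {E : Type*} [NormedAddCommGroup E] [NormedSpace ℝ E] [FiniteDimensional ℝ E]
  {H : Type*} [TopologicalSpace H] {I : ModelWithCorners ℝ E H}
  {M : Type*} [TopologicalSpace M] [ChartedSpace H M] [IsManifold I ∞ M]

/-- The lift of a vector field to the cone. -/
def coneLift (X : VField I M) : VField (coneModel I) (ConeSpace M) :=
  fun p => coneIncl p (X p.1)

/-- The radial coordinate. -/
def coneRadius (p : ConeSpace M) : ℝ := p.2

theorem coneRadius_pos (p : ConeSpace M) : 0 < coneRadius p := p.2.2

theorem coneRadius_smooth : ContMDiff (coneModel I) 𝓘(ℝ, ℝ) ∞ (coneRadius (M := M)) :=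
  contMDiff_subtype_val.comp contMDiff_snd

variable {X Y : VField I M} {p : ConeSpace M} {f : M → ℝ}

theorem coneLift_smooth (hX : SmoothVF X) : SmoothVF (coneLift X) := by
  intro p
  have h1 : ContMDiffAt (coneModel I) (I.prod 𝓘(ℝ, E)) ∞
      (fun q : ConeSpace M => TotalSpace.mk' E (E := fun x : M => TangentSpace I x) q.1 (X q.1)) p :=
    ContMDiffAt.comp p (hX p.1) contMDiffAt_fst
  have h2 : ContMDiffAt (coneModel I) (𝓘(ℝ, ℝ).prod 𝓘(ℝ, ℝ)) ∞
      (fun q : ConeSpace M => TotalSpace.mk' ℝ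
        (E := fun r : PosHalfLine => TangentSpace 𝓘(ℝ, ℝ) r) q.2 0) p :=
    ContMDiffAt.comp p (Bundle.contMDiff_zeroSection ℝ
      (fun r : PosHalfLine => TangentSpace 𝓘(ℝ, ℝ) r) p.2) contMDiffAt_snd
  exact ContMDiffAt.comp p ((contMDiff_equivTangentBundleProd_symm (n := ∞) (I := I) (M := M)
    (I' := 𝓘(ℝ, ℝ)) (M' := PosHalfLine)).contMDiffAt) (h1.prodMk h2)

theorem mvfderiv_comp_fst (hf : DiffFunAt I f p.1) (w : TangentSpace (coneModel I) p) :
    mvfderiv (coneModel I) (fun q : ConeSpace M => f q.1) p w = mvfderiv I f p.1 (coneProj p w) := by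
  have h : mfderiv (coneModel I) 𝓘(ℝ, ℝ) (f ∘ Prod.fst) p
      = (mfderiv I 𝓘(ℝ, ℝ) f p.1).comp (mfderiv (coneModel I) I Prod.fst p) :=
    mfderiv_comp p hf mdifferentiableAt_fst
  rw [mfderiv_coneProj] at h
  exact congrArg (fun L : E × ℝ →L[ℝ] ℝ => L w) h

theorem comp_fst_smoothAt (hf : SmoothFunAt I f p.1) :
    SmoothFunAt (coneModel I) (fun q : ConeSpace M => f q.1) p :=
  ContMDiffAt.comp p hf contMDiffAt_fst

theorem comp_fst_diffAt (hf : DiffFunAt I f p.1) :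
    DiffFunAt (coneModel I) (fun q : ConeSpace M => f q.1) p :=
  MDifferentiableAt.comp p hf mdifferentiableAt_fst

theorem lieFun_congr_right {X : VField I M} {x : M} {f h : M → ℝ} (e : f =ᶠ[nhds x] h) :
    lieFun X f x = lieFun X h x := by
  change mfderiv I 𝓘(ℝ, ℝ) f x (X x) = mfderiv I 𝓘(ℝ, ℝ) h x (X x)
  rw [e.mfderiv_eq]
  rfl

theorem lieFun_lift (hf : DiffFunAt I f p.1) :
    lieFun (coneLift X) (fun q : ConeSpace M => f q.1) p = lieFun X f p.1 := by
  rw [lieFun, mvfderiv_comp_fst hf]; rfl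

theorem lieFun_radial (hf : DiffFunAt I f p.1) :
    lieFun (coneRadial (I := I)) (fun q : ConeSpace M => f q.1) p = 0 := by
  rw [lieFun, mvfderiv_comp_fst hf, coneProj_radial, map_zero]

theorem lieFun_radius (V : VField (coneModel I) (ConeSpace M)) :
    lieFun V (coneRadius (M := M)) p = coneDr (I := I) p (V p) := by
  rw [lieFun, ← mfderiv_coneDr]; rfl

theorem cone_ext {v w : TangentSpace (coneModel I) p} (h1 : coneProj p v = coneProj p w)
    (h2 : coneDr p v = coneDr p w) : v = w := by
  rw [cone_decomp p v, cone_decomp p w, h1, h2]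

variable [T2Space M]

theorem coneRadial_smooth (g : RMetric I M) : SmoothVF (coneRadial (I := I) (M := M)) := by
  intro p
  obtain ⟨s, b, hs, hb⟩ := exists_frame (I := coneModel I) p
  refine smoothVFAt_of_inner (coneMetric g 1 one_pos) (fun i => hs i p) b hb fun j => ?_
  have e : (fun q => (coneMetric g 1 one_pos).inner q (coneRadial q) (s j q))
      = lieFun (s j) (coneRadius (M := M)) := by
    funext q
    rw [lieFun_radius]
    change coneForm g 1 q _ _ = _
    rw [coneForm_apply, coneProj_radial, coneDr_radial, map_zero]
    simp
  rw [e]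
  exact lieFun_smoothAt (hs j p) (coneRadius_smooth p)

theorem bracket_lift (hX : SmoothVF X) (hY : SmoothVF Y) :
    mlieBracket (coneModel I) (coneLift X) (coneLift Y) p = coneIncl p (mlieBracket I X Y p.1) := by
  have hX' := coneLift_smooth hX
  have hY' := coneLift_smooth hY
  refine cone_ext (eq_of_mvfderiv fun f hf => ?_) ?_
  · have e : ∀ {X : VField I M}, SmoothVF X → ∀ᶠ q in nhds p,
        lieFun (coneLift X) (fun q : ConeSpace M => f q.1) q = (fun q => lieFun X f q.1) q := by
      intro X hX
      have h := ((contMDiffAt_iff_contMDiffAt_nhds (n := 1) (by simp)).1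
        (ContMDiffAt.of_le hf (by simp)))
      filter_upwards [continuous_fst.continuousAt.eventually h] with q hq
      exact lieFun_lift (ContMDiffAt.mdifferentiableAt hq (by simp))
    have c := lieFun_bracket hX' hY' (comp_fst_smoothAt (p := p) hf)
    have c' := lieFun_bracket hX hY hf
    have d : ∀ {A B : VField I M}, SmoothVF A → SmoothVF B →
        lieFun (coneLift A) (lieFun (coneLift B) (fun q : ConeSpace M => f q.1)) p
          = lieFun A (lieFun B f) p.1 := by
      intro A B hA hB
      rw [← lieFun_lift (lieFun_smoothAt (hB p.1) hf).diff]
      exact lieFun_congr_right (e hB)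
    rw [d hX hY, d hY hX, ← c'] at c
    rw [lieFun, mvfderiv_comp_fst hf.diff] at c
    exact c
  · have c := lieFun_bracket hX' hY' (coneRadius_smooth p)
    have d : ∀ A : VField I M, lieFun (coneLift A) (coneRadius (M := M)) = fun _ => 0 := fun A =>
      funext fun q => lieFun_radius _
    rw [d, d, lieFun_const, lieFun_const, lieFun_radius] at c
    rw [c, coneDr_incl, sub_zero]

theorem bracket_radial_lift (g : RMetric I M) (hX : SmoothVF X) :
    mlieBracket (coneModel I) coneRadial (coneLift X) p = 0 := by
  have hX' := coneLift_smooth hX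
  have hr := coneRadial_smooth (I := I) (M := M) g
  refine cone_ext (eq_of_mvfderiv fun f hf => ?_) ?_
  · have hev := ((contMDiffAt_iff_contMDiffAt_nhds (n := 1) (by simp)).1
      (ContMDiffAt.of_le hf (by simp)))
    have c := lieFun_bracket hr hX' (comp_fst_smoothAt (p := p) hf)
    have e1 : lieFun (coneLift X) (fun q : ConeSpace M => f q.1)
        =ᶠ[nhds p] fun q => lieFun X f q.1 := by
      filter_upwards [continuous_fst.continuousAt.eventually hev] with q hq
      exact lieFun_lift (ContMDiffAt.mdifferentiableAt hq (by simp))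
    have e2 : lieFun (coneRadial (I := I)) (fun q : ConeSpace M => f q.1) =ᶠ[nhds p] fun _ => 0 := by
      filter_upwards [continuous_fst.continuousAt.eventually hev] with q hq
      exact lieFun_radial (ContMDiffAt.mdifferentiableAt hq (by simp))
    have d1 : lieFun (coneRadial (I := I)) (lieFun (coneLift X) (fun q : ConeSpace M => f q.1)) p
        = lieFun (coneRadial (I := I)) (fun q : ConeSpace M => lieFun X f q.1) p :=
      lieFun_congr_right e1
    have d2 : lieFun (coneLift X) (lieFun (coneRadial (I := I)) (fun q : ConeSpace M => f q.1)) p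
        = lieFun (coneLift X) (fun _ => 0) p :=
      lieFun_congr_right e2
    rw [d1, d2, lieFun_const, lieFun_radial (lieFun_smoothAt (hX p.1) hf).diff, lieFun,
      mvfderiv_comp_fst hf.diff] at c
    rw [c, map_zero, map_zero, sub_zero]
  · have c := lieFun_bracket hr hX' (coneRadius_smooth p)
    have d1 : lieFun (coneLift X) (coneRadius (M := M)) = fun _ => 0 :=
      funext fun q => lieFun_radius _
    have d2 : lieFun (coneRadial (I := I)) (coneRadius (M := M)) = fun _ => 1 :=
      funext fun q => lieFun_radius _
    rw [d1, d2, lieFun_const, lieFun_const, lieFun_radius] at c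
    rw [c, map_zero, sub_zero]

end ConeFields

/-! ### The almost hyperhermitian structure of the cone -/

section ConeStructure

variable {E : Type*} [NormedAddCommGroup E] [NormedSpace ℝ E] [FiniteDimensional ℝ E]
  {H : Type*} [TopologicalSpace H] {I : ModelWithCorners ℝ E H}
  {M : Type*} [TopologicalSpace M] [ChartedSpace H M] [IsManifold I ∞ M]

theorem coneMetric_inner (g : RMetric I M) {a : ℝ} (ha : 0 < a) (p : ConeSpace M)
    (v w : TangentSpace (coneModel I) p) :
    (coneMetric g a ha).inner p v w =
      a ^ 2 * coneRadius p ^ 2 * g.inner p.1 (coneProj p v) (coneProj p w)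
        + coneDr p v * coneDr p w := rfl

/-- A frame of the cone whose members are lifts or the radial vector field. -/
theorem exists_coneFrame [T2Space M] (g : RMetric I M) (p : ConeSpace M) :
    ∃ (m : ℕ) (s : Fin m → VField (coneModel I) (ConeSpace M))
      (b : Module.Basis (Fin m) ℝ (TangentSpace (coneModel I) p)), (∀ i, SmoothVF (s i)) ∧
      (∀ i, s i p = b i) ∧ ∀ i, ∃ (X : VField I M) (c : ℝ), SmoothVF X ∧
        ∀ q, s i q = coneIncl q (X q.1) + c • coneRadial q := by
  obtain ⟨s, b, hs, hb⟩ := exists_frame (I := I) p.1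
  let b' : Module.Basis (Fin (Module.finrank ℝ E) ⊕ Unit) ℝ (TangentSpace (coneModel I) p) :=
    Module.Basis.prod (M := TangentSpace I p.1) (M' := ℝ) b (Module.Basis.singleton Unit ℝ)
  let s' : Fin (Module.finrank ℝ E) ⊕ Unit → VField (coneModel I) (ConeSpace M) :=
    Sum.elim (fun i => coneLift (s i)) fun _ => coneRadial
  have h1 : ∀ z, SmoothVF (s' z) := by
    rintro (j | j)
    · exact coneLift_smooth (hs j)
    · exact coneRadial_smooth g
  have h2 : ∀ z, s' z p = b' z := by
    rintro (j | j)
    · refine (congrArg (coneIncl p) (hb j)).trans ?_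
      exact (Prod.ext (Module.Basis.prod_apply_inl_fst (M := TangentSpace I p.1) (M' := ℝ) b _ j)
        (Module.Basis.prod_apply_inl_snd (M := TangentSpace I p.1) (M' := ℝ) b _ j)).symm
    · exact (Prod.ext (Module.Basis.prod_apply_inr_fst (M := TangentSpace I p.1) (M' := ℝ) b _ j)
        ((Module.Basis.prod_apply_inr_snd (M := TangentSpace I p.1) (M' := ℝ) b _ j).trans
          (Module.Basis.singleton_apply Unit ℝ j))).symm
  have h3 : ∀ z, ∃ (X : VField I M) (c : ℝ), SmoothVF X ∧
      ∀ q, s' z q = coneIncl q (X q.1) + c • coneRadial q := by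
    rintro (j | j)
    · exact ⟨s j, 0, hs j, fun q => by rw [zero_smul, add_zero]; rfl⟩
    · refine ⟨0, 1, Bundle.contMDiff_zeroSection ℝ _, fun q => ?_⟩
      rw [one_smul, Pi.zero_apply, map_zero, zero_add]
      rfl
  let e := Fintype.equivFin (Fin (Module.finrank ℝ E) ⊕ Unit)
  exact ⟨_, fun i => s' (e.symm i), b'.reindex e, fun i => h1 _,
    fun i => by rw [Module.Basis.reindex_apply]; exact h2 _, fun i => h3 _⟩

namespace AlmostThreeContactMetric

variable (S : AlmostThreeContactMetric I M) {a : ℝ}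

theorem proj_coneJ (a : ℝ) (i : Fin 3) (p : ConeSpace M) (w : TangentSpace (coneModel I) p) :
    coneProj p (S.coneJ a i p w) = coneSign i • ((coneDr p w * (a * coneRadius p)⁻¹) • S.ξ i p.1
      - S.φ i p.1 (coneProj p w)) := by
  rw [mul_smul]
  simp only [coneJ, smul_apply, sub_apply, ContinuousLinearMap.comp_apply, map_smul, map_sub,
    ContinuousLinearMap.smulRight_apply, coneProj_incl, coneProj_radial, smul_zero, sub_zero]
  rfl

theorem dr_coneJ (a : ℝ) (i : Fin 3) (p : ConeSpace M) (w : TangentSpace (coneModel I) p) :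
    coneDr p (S.coneJ a i p w) = - (coneSign i * (a * coneRadius p * S.η i p.1 (coneProj p w))) := by
  simp only [coneJ, smul_apply, sub_apply, ContinuousLinearMap.comp_apply, map_smul, map_sub,
    ContinuousLinearMap.smulRight_apply, coneDr_incl, coneDr_radial, smul_eq_mul, mul_one]
  rw [coneRadius]
  ring

theorem coneSign_sq (i : Fin 3) : coneSign i * coneSign i = 1 := by
  fin_cases i <;> simp [coneSign]

theorem coneJ_lift (a : ℝ) (i : Fin 3) (Y : VField I M) :
    endoApply (S.coneJ a i) (coneLift Y) = fun q => coneSign i •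
      (- coneIncl q (S.φ i q.1 (Y q.1)) - (a * S.η i q.1 (Y q.1)) • (coneRadius q • coneRadial q)) := by
  funext q
  refine cone_ext ?_ ?_
  · rw [endoApply, proj_coneJ]
    simp [coneLift, coneProj_incl, coneDr_incl, coneProj_radial]
  · rw [endoApply, dr_coneJ]
    simp only [coneLift, coneProj_incl, coneDr_incl, coneDr_radial, map_smul, map_sub, map_neg,
      smul_eq_mul]
    ring

theorem coneJ_euler (ha : 0 < a) (i : Fin 3) :
    endoApply (S.coneJ a i) (fun q => coneRadius q • coneRadial q)
      = fun q => coneSign i • (a⁻¹ • coneIncl q (S.ξ i q.1)) := by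
  funext q
  have hr := (coneRadius_pos q).ne'
  refine cone_ext ?_ ?_
  · rw [endoApply, proj_coneJ]
    simp only [map_smul, coneProj_incl, coneDr_radial, coneProj_radial, smul_eq_mul, mul_one,
      smul_zero, map_zero, sub_zero]
    congr 2
    field_simp
  · rw [endoApply, dr_coneJ]
    simp [coneDr_incl, coneProj_radial]

variable [T2Space M]

theorem coneJ_smooth (i : Fin 3) (ha : 0 < a) : SmoothEndo (S.coneJ a i) := by
  intro p
  obtain ⟨m, s, b, hs, hb, hX⟩ := exists_coneFrame S.g p
  refine endo_contMDiffAt_of_frame (coneMetric S.g a ha) (fun i => hs i p) b hb fun j => ?_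
  obtain ⟨X, c, hX, e⟩ := hX j
  have hr := coneRadius_smooth (I := I) (M := M) p
  have hR := coneRadial_smooth S.g p
  have e' : endoApply (S.coneJ a i) (s j) =
      (fun _ : ConeSpace M => coneSign i) • ((fun q : ConeSpace M => c * (a * coneRadius q)⁻¹) • coneLift (S.ξ i)
        - coneLift (endoApply (S.φ i) X) - (fun q : ConeSpace M => a * coneRadius q * S.η i q.1 (X q.1)) • coneRadial) := by
    funext q
    refine cone_ext ?_ ?_
    · rw [endoApply, proj_coneJ, e]
      simp [coneLift, coneProj_incl, coneDr_incl, coneProj_radial, coneDr_radial, endoApply]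
    · rw [endoApply, dr_coneJ, e]
      simp [coneLift, coneProj_incl, coneDr_incl, coneProj_radial, coneDr_radial]
  rw [e']
  have hinv : SmoothFunAt (coneModel I) (fun q : ConeSpace M => (a * coneRadius q)⁻¹) p :=
    (contMDiffAt_const.mul hr).inv₀ (mul_pos ha (coneRadius_pos p)).ne'
  exact SmoothVFAt.smul contMDiffAt_const (SmoothVFAt.sub (SmoothVFAt.sub
    (SmoothVFAt.smul (contMDiffAt_const.mul hinv) (coneLift_smooth (S.smooth_ξ i) p))
    (coneLift_smooth (endo_smooth (S.smooth_φ i) hX) p))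
    (SmoothVFAt.smul ((contMDiffAt_const.mul hr).mul
      (comp_fst_smoothAt (form_smoothAt (S.smooth_η i) (hX p.1)))) hR))

theorem coneJ_isAlmostHyperhermitian (ha : 0 < a) :
    IsAlmostHyperhermitian (coneMetric S.g a ha) (S.coneJ a) where
  smooth i := S.coneJ_smooth i ha
  sq i p w := by
    have hr := (coneRadius_pos p).ne'
    have hs := coneSign_sq i
    refine cone_ext ?_ ?_
    · rw [proj_coneJ, proj_coneJ, dr_coneJ]
      simp only [map_smul, map_sub, S.φ_ξ_self, S.φ_sq, map_neg]
      have e : -(coneSign i * (a * coneRadius p * S.η i p.1 (coneProj p w))) * (a * coneRadius p)⁻¹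
          = - (coneSign i * S.η i p.1 (coneProj p w)) := by field_simp
      rw [e]
      have e2 : coneSign i • ((-(coneSign i * S.η i p.1 (coneProj p w))) • S.ξ i p.1
          - coneSign i • ((coneDr p w * (a * coneRadius p)⁻¹) • (0 : TangentSpace I p.1)
            - (-coneProj p w + S.η i p.1 (coneProj p w) • S.ξ i p.1)))
          = (coneSign i * coneSign i) • -coneProj p w := by module
      rw [e2, hs, one_smul]
    · rw [dr_coneJ, proj_coneJ]
      simp only [map_smul, map_sub, S.η_ξ, form_self, smul_eq_mul, mul_one, sub_zero, map_neg]
      have e : coneDr p w = coneSign i * coneSign i * coneDr p w := by rw [hs, one_mul]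
      conv_rhs => rw [e]
      field_simp
  hermitian i p u w := by
    have hr := (coneRadius_pos p).ne'
    have hs := coneSign_sq i
    rw [coneMetric_inner, coneMetric_inner, proj_coneJ, proj_coneJ, dr_coneJ, dr_coneJ]
    simp only [map_smul, map_sub, smul_apply, sub_apply, smul_eq_mul, reeb_inner, inner_reeb,
      S.η_ξ, form_self, S.compat]
    field_simp
    linear_combination (a ^ 2 * coneRadius p ^ 2 * S.g.inner p.1 (coneProj p u) (coneProj p w)
      + coneDr p u * coneDr p w) * hs
  mul p w := by
    have hr := (coneRadius_pos p).ne'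
    have h : EvenTriple 0 1 2 := ⟨rfl, rfl⟩
    refine cone_ext ?_ ?_
    · rw [proj_coneJ, proj_coneJ, proj_coneJ, dr_coneJ]
      simp only [coneSign, Matrix.cons_val, one_smul, one_mul, map_smul, map_sub, S.mul_even _ h,
        S.reeb_even _ h]
      have e : -(a * coneRadius p * S.η 1 p.1 (coneProj p w)) * (a * coneRadius p)⁻¹
          = - S.η 1 p.1 (coneProj p w) := by field_simp
      rw [e]
      module
    · rw [dr_coneJ, dr_coneJ, proj_coneJ]
      simp only [coneSign, Matrix.cons_val, one_smul, one_mul, map_smul, map_sub, S.form_even _ h,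
        S.reeb_form_even _ h, smul_zero]
      ring
  mul' p w := by
    have hr := (coneRadius_pos p).ne'
    have h : EvenTriple 0 1 2 := ⟨rfl, rfl⟩
    refine cone_ext ?_ ?_
    · rw [map_neg, proj_coneJ, proj_coneJ, proj_coneJ, dr_coneJ]
      simp only [coneSign, Matrix.cons_val, one_smul, one_mul, map_smul, map_sub, S.mul_odd _ h,
        S.reeb_odd _ h]
      have e : -(a * coneRadius p * S.η 0 p.1 (coneProj p w)) * (a * coneRadius p)⁻¹
          = - S.η 0 p.1 (coneProj p w) := by field_simp
      rw [e]
      module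
    · rw [map_neg, dr_coneJ, dr_coneJ, proj_coneJ]
      simp only [coneSign, Matrix.cons_val, one_smul, one_mul, map_smul, map_sub, S.form_odd _ h,
        S.reeb_form_odd _ h, smul_zero]
      ring

end AlmostThreeContactMetric

end ConeStructure

/-! ### The appendant connection -/

section Appendant

variable {E : Type*} [NormedAddCommGroup E] [NormedSpace ℝ E] [FiniteDimensional ℝ E]
  {H : Type*} [TopologicalSpace H] {I : ModelWithCorners ℝ E H}
  {M : Type*} [TopologicalSpace M] [ChartedSpace H M] [IsManifold I ∞ M] [T2Space M]

variable {g : RMetric I M} {a : ℝ} {ha : 0 < a} {D : LinConn I M}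
  {Dbar : LinConn (coneModel I) (ConeSpace M)}

theorem isSmoothThreeForm_cone (hD : IsMetricSkew g D) (a : ℝ) :
    IsSmoothThreeForm (I := coneModel I) (M := ConeSpace M) fun p u v w =>
      a ^ 2 * coneRadius p ^ 2 * torsionForm g D p.1 (coneProj p u) (coneProj p v) (coneProj p w) where
  add p u v w w' := by
    rw [map_add, (isSmoothThreeForm_torsionForm hD).add]; ring
  smul p c u v w := by
    rw [map_smul, (isSmoothThreeForm_torsionForm hD).smul]; ring
  swap₁₂ p u v w := by
    rw [torsionForm_swap₁₂]; ring
  swap₂₃ p u v w := by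
    rw [hD.skew]; ring
  smooth p := by
    obtain ⟨m, s, b, hs, hb, h⟩ := exists_coneFrame g p
    refine ⟨m, s, b, hs, hb, fun i j k => ?_⟩
    choose X c hX e using h
    have e' : ∀ i (q : ConeSpace M), coneProj q (s i q) = X i q.1 := fun i q => by
      rw [e, map_add, map_smul, coneProj_incl, coneProj_radial, smul_zero, add_zero]
    simp only [e']
    exact (contMDiffAt_const.mul ((coneRadius_smooth p).pow 2)).mul (comp_fst_smoothAt
      ((isSmoothThreeForm_torsionForm hD).smoothAt g (hX i p.1) (hX j p.1) (hX k p.1)))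

theorem exists_isAppendant (hD : IsMetricSkew g D) (ha : 0 < a) :
    ∃ Dbar : LinConn (coneModel I) (ConeSpace M), IsAppendant g a ha D Dbar := by
  obtain ⟨Dbar, hDbar, hT⟩ := exists_metricSkew (coneMetric g a ha) (isSmoothThreeForm_cone hD a)
  refine ⟨Dbar, hDbar, fun p u v => RMetric.eq_of_inner (coneMetric g a ha) fun w => ?_,
    fun p w => RMetric.eq_of_inner (coneMetric g a ha) fun z => ?_⟩
  · refine (hT p _ _ w).trans ?_
    rw [coneMetric_inner, coneProj_incl, coneProj_incl, coneProj_incl, coneDr_incl, torsionForm]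
    ring
  · refine (hT p _ _ z).trans ?_
    simp [coneProj_radial, torsionForm]

namespace IsAppendant

variable {X Y Z : VField I M} {p : ConeSpace M}

theorem torsionForm_eq (h : IsAppendant g a ha D Dbar) (p : ConeSpace M)
    (u v w : TangentSpace (coneModel I) p) :
    torsionForm (coneMetric g a ha) Dbar p u v w = a ^ 2 * coneRadius p ^ 2 *
      torsionForm g D p.1 (coneProj p u) (coneProj p v) (coneProj p w) := by
  have e : Dbar.torsion p u v = coneIncl p (D.torsion p.1 (coneProj p u) (coneProj p v)) := by
    conv_lhs => rw [cone_decomp p u, cone_decomp p v]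
    simp only [map_add, map_smul, add_apply, smul_apply, h.torsion_radial, smul_zero, add_zero,
      h.torsion_incl]
    rw [Dbar.torsion_antisymm, h.torsion_radial, neg_zero, smul_zero, add_zero]
  rw [torsionForm, e, coneMetric_inner, coneProj_incl, coneDr_incl, torsionForm]
  ring

theorem lieFun_cone (a : ℝ) (V : VField (coneModel I) (ConeSpace M)) {f : M → ℝ}
    (hf : DiffFunAt I f p.1) :
    lieFun V (fun q => a ^ 2 * coneRadius q ^ 2 * f q.1) p
      = a ^ 2 * coneRadius p ^ 2 * mvfderiv I f p.1 (coneProj p (V p))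
        + 2 * a ^ 2 * coneRadius p * f p.1 * coneDr p (V p) := by
  have hr : DiffFunAt (coneModel I) (coneRadius (M := M)) p :=
    SmoothFunAt.diff (coneRadius_smooth p)
  have h1 : DiffFunAt (coneModel I) (fun q : ConeSpace M => coneRadius q * coneRadius q) p :=
    MDifferentiableAt.mul hr hr
  have e : (fun q : ConeSpace M => a ^ 2 * coneRadius q ^ 2 * f q.1)
      = fun q => a ^ 2 * ((coneRadius q * coneRadius q) * f q.1) := by
    funext q; ring
  have h2 : DiffFunAt (coneModel I)
      (fun q : ConeSpace M => (coneRadius q * coneRadius q) * f q.1) p :=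
    MDifferentiableAt.mul h1 (comp_fst_diffAt hf)
  rw [e, lieFun_mul mdifferentiableAt_const h2, lieFun_const, lieFun_mul h1 (comp_fst_diffAt hf), lieFun_mul hr hr, lieFun_radius, lieFun,
    mvfderiv_comp_fst hf]
  ring

theorem inner_lift_lift (ha : 0 < a) (X Y : VField I M) (q : ConeSpace M) :
    (coneMetric g a ha).inner q (coneLift X q) (coneLift Y q)
      = a ^ 2 * coneRadius q ^ 2 * g.inner q.1 (X q.1) (Y q.1) := by
  rw [coneMetric_inner, coneLift, coneLift, coneProj_incl, coneProj_incl, coneDr_incl, zero_mul,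
    add_zero]

theorem inner_incl_radial (ha : 0 < a) (q : ConeSpace M) (u : TangentSpace I q.1) :
    (coneMetric g a ha).inner q (coneIncl q u) (coneRadial q) = 0 := by
  rw [coneMetric_inner, coneProj_radial, coneDr_incl, map_zero, mul_zero, zero_mul, add_zero]

theorem inner_radial_incl (ha : 0 < a) (q : ConeSpace M) (u : TangentSpace I q.1) :
    (coneMetric g a ha).inner q (coneRadial q) (coneIncl q u) = 0 := by
  rw [(coneMetric g a ha).symm, inner_incl_radial]

theorem inner_radial_radial (ha : 0 < a) (q : ConeSpace M) :
    (coneMetric g a ha).inner q (coneRadial q) (coneRadial q) = 1 := by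
  rw [coneMetric_inner, coneProj_radial, coneDr_radial, map_zero, mul_zero, one_mul, zero_add]

theorem inner_incl_incl (ha : 0 < a) (q : ConeSpace M) (u v : TangentSpace I q.1) :
    (coneMetric g a ha).inner q (coneIncl q u) (coneIncl q v)
      = a ^ 2 * coneRadius q ^ 2 * g.inner q.1 u v := by
  rw [coneMetric_inner, coneProj_incl, coneProj_incl, coneDr_incl, zero_mul, add_zero]

theorem eq_of_cone_inner (ha : 0 < a) {v w : TangentSpace (coneModel I) p}
    (h1 : ∀ Z : VField I M, SmoothVF Z → (coneMetric g a ha).inner p v (coneLift Z p)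
      = (coneMetric g a ha).inner p w (coneLift Z p))
    (h2 : (coneMetric g a ha).inner p v (coneRadial p)
      = (coneMetric g a ha).inner p w (coneRadial p)) : v = w := by
  refine RMetric.eq_of_inner (coneMetric g a ha) fun z => ?_
  obtain ⟨Z, hZ, e⟩ := exists_smoothVF_eq (I := I) (coneProj p z)
  have h3 := h1 Z hZ
  rw [coneLift, e] at h3
  rw [cone_decomp p z]
  simp only [map_add, map_smul, h2, h3]

theorem koszul_lift (ha : 0 < a) (hX : SmoothVF X) (hY : SmoothVF Y) (hZ : SmoothVF Z) :
    koszul (coneMetric g a ha) (coneLift X) (coneLift Y) (coneLift Z) p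
      = a ^ 2 * coneRadius p ^ 2 * koszul g X Y Z p.1 := by
  have d := fun {A B : VField I M} (hA : SmoothVF A) (hB : SmoothVF B) =>
    inner_diffAt g (hA.diff p.1) (hB.diff p.1)
  simp only [koszul, inner_lift_lift, bracket_lift hX hY, bracket_lift hX hZ, bracket_lift hY hZ]
  rw [lieFun_cone a _ (d hY hZ), lieFun_cone a _ (d hX hZ), lieFun_cone a _ (d hX hY)]
  simp only [coneLift, coneProj_incl, coneDr_incl, inner_incl_incl, lieFun]
  ring

theorem bracket_lift_radial (g : RMetric I M) (hX : SmoothVF X) :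
    mlieBracket (coneModel I) (coneLift X) coneRadial p = 0 := by
  rw [bracket_swap, bracket_radial_lift g hX, neg_zero]

theorem koszul_lift_radial (ha : 0 < a) (hX : SmoothVF X) (hY : SmoothVF Y) :
    koszul (coneMetric g a ha) (coneLift X) (coneLift Y) coneRadial p
      = - (2 * a ^ 2 * coneRadius p * g.inner p.1 (X p.1) (Y p.1)) := by
  have d := inner_diffAt g (hX.diff p.1) (hY.diff p.1)
  simp only [koszul, inner_lift_lift, bracket_lift hX hY, bracket_lift_radial g hX,
    bracket_lift_radial g hY]
  rw [lieFun_cone a _ d]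
  simp only [coneLift, coneProj_radial, coneDr_radial, inner_incl_radial, lieFun_const, map_zero,
    zero_apply]
  ring

theorem koszul_radial_lift (ha : 0 < a) (hY : SmoothVF Y) (hZ : SmoothVF Z) :
    koszul (coneMetric g a ha) coneRadial (coneLift Y) (coneLift Z) p
      = 2 * a ^ 2 * coneRadius p * g.inner p.1 (Y p.1) (Z p.1) := by
  have d := inner_diffAt g (hY.diff p.1) (hZ.diff p.1)
  simp only [koszul, inner_lift_lift, bracket_lift hY hZ,
    bracket_radial_lift g hY, bracket_radial_lift g hZ]
  rw [lieFun_cone a _ d]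
  simp only [coneLift, coneProj_radial, coneDr_radial, inner_radial_incl, inner_incl_radial,
    lieFun_const, map_zero, zero_apply]
  ring

theorem koszul_radial_lift_radial (ha : 0 < a) (hY : SmoothVF Y) :
    koszul (coneMetric g a ha) coneRadial (coneLift Y) coneRadial p = 0 := by
  simp only [koszul, inner_radial_radial, bracket_lift_radial g hY, bracket_radial_lift g hY]
  have e : mlieBracket (coneModel I) (coneRadial (I := I) (M := M)) coneRadial p = 0 := by
    simp
  rw [e]
  simp only [coneLift, inner_radial_incl, inner_incl_radial, lieFun_const, map_zero,
    zero_apply]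
  ring

theorem koszul_radial_radial_lift (ha : 0 < a) (hY : SmoothVF Y) :
    koszul (coneMetric g a ha) coneRadial coneRadial (coneLift Y) p = 0 := by
  have h := koszul_metric (coneMetric g a ha) (X := coneRadial) (Y := coneRadial) (Z := coneLift Y)
    (x := p)
  rw [koszul_radial_lift_radial ha hY] at h
  simp only [coneLift, inner_radial_incl, lieFun_const] at h
  simpa using h

theorem koszul_radial (ha : 0 < a) :
    koszul (coneMetric g a ha) coneRadial coneRadial coneRadial p = 0 := by
  have h := koszul_metric (coneMetric g a ha) (X := coneRadial) (Y := coneRadial)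
    (Z := coneRadial) (x := p)
  simp only [inner_radial_radial, lieFun_const] at h
  linarith

theorem cov_lift (h : IsAppendant g a ha D Dbar) (hD : IsMetricSkew g D) (hY : SmoothVF Y)
    (u : TangentSpace I p.1) :
    Dbar (coneLift Y) p (coneIncl p u) = coneIncl p (D Y p.1 u)
      - (a ^ 2 * coneRadius p * g.inner p.1 u (Y p.1)) • coneRadial p := by
  obtain ⟨X, hX, rfl⟩ := exists_smoothVF_eq (I := I) u
  have k := fun {Z} (hZ : SmoothVF Z) => h.metricSkew.koszul _ (coneLift_smooth hX)
    (coneLift_smooth hY) hZ p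
  simp only [h.torsionForm_eq] at k
  refine eq_of_cone_inner (g := g) ha (fun Z hZ => ?_) ?_
  · have k1 := k (coneLift_smooth hZ)
    have k2 := hD.koszul g hX hY hZ p.1
    rw [koszul_lift ha hX hY hZ] at k1
    simp only [coneLift, coneProj_incl] at k1
    simp only [coneLift, map_sub, map_smul, sub_apply, smul_apply, inner_radial_incl,
      inner_incl_incl, smul_zero, sub_zero]
    linear_combination k1 / 2 - a ^ 2 * coneRadius p ^ 2 / 2 * k2
  · have k1 := k (coneRadial_smooth g)
    rw [koszul_lift_radial ha hX hY] at k1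
    simp only [coneLift, coneProj_incl, coneProj_radial, torsionForm, map_zero] at k1
    simp only [map_sub, map_smul, sub_apply, smul_apply, inner_incl_radial, inner_radial_radial,
      smul_eq_mul, mul_one, zero_sub]
    linarith

theorem cov_lift_radial (h : IsAppendant g a ha D Dbar) (hY : SmoothVF Y) :
    Dbar (coneLift Y) p (coneRadial p) = (coneRadius p)⁻¹ • coneIncl p (Y p.1) := by
  have hr := (coneRadius_pos p).ne'
  have k := fun {Z} (hZ : SmoothVF Z) => h.metricSkew.koszul _ (coneRadial_smooth g)
    (coneLift_smooth hY) hZ p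
  simp only [torsionForm, h.torsion_radial, map_zero, zero_apply] at k
  refine eq_of_cone_inner (g := g) ha (fun Z hZ => ?_) ?_
  · have k1 := k (coneLift_smooth hZ)
    rw [koszul_radial_lift ha hY hZ] at k1
    simp only [map_smul, smul_apply, smul_eq_mul, coneLift, inner_incl_incl] at k1 ⊢
    field_simp
    linarith
  · have k1 := k (coneRadial_smooth g)
    rw [koszul_radial_lift_radial ha hY] at k1
    simp only [map_smul, smul_apply, inner_incl_radial, smul_zero]
    linarith

theorem cov_radial_radial (h : IsAppendant g a ha D Dbar) :
    Dbar coneRadial p (coneRadial p) = 0 := by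
  have k := fun {Z} (hZ : SmoothVF Z) => h.metricSkew.koszul _ (coneRadial_smooth g)
    (coneRadial_smooth g) hZ p
  simp only [torsionForm, h.torsion_radial, map_zero, zero_apply] at k
  refine eq_of_cone_inner (g := g) ha (fun Z hZ => ?_) ?_
  · have k1 := k (coneLift_smooth hZ)
    rw [koszul_radial_radial_lift ha hZ] at k1
    rw [map_zero, zero_apply]
    linarith
  · have k1 := k (coneRadial_smooth g)
    rw [koszul_radial ha] at k1
    rw [map_zero, zero_apply]
    linarith

theorem cov_radial (h : IsAppendant g a ha D Dbar) (u : TangentSpace I p.1) :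
    Dbar coneRadial p (coneIncl p u) = (coneRadius p)⁻¹ • coneIncl p u := by
  obtain ⟨X, hX, rfl⟩ := exists_smoothVF_eq (I := I) u
  have hr := coneRadial_smooth (M := M) g
  have t := Dbar.torsion_apply (hr.diff p) ((coneLift_smooth hX).diff p)
  rw [h.torsion_radial, h.cov_lift_radial hX, bracket_radial_lift g hX, sub_zero] at t
  exact (sub_eq_zero.1 t.symm).symm

theorem cov_euler (h : IsAppendant g a ha D Dbar) (w : TangentSpace (coneModel I) p) :
    Dbar (fun q => coneRadius q • coneRadial q) p w = w := by
  have hr := (coneRadius_pos p).ne'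
  have e := LinConn.smul Dbar ((coneRadial_smooth (M := M) g).diff p)
    (SmoothFunAt.diff (coneRadius_smooth p)) w
  have e' : mvfderiv (coneModel I) (coneRadius (M := M)) p w = coneDr p w := by
    rw [← mfderiv_coneDr]; rfl
  refine e.trans ?_
  rw [e']
  conv_lhs => rw [cone_decomp p w]
  conv_rhs => rw [cone_decomp p w]
  simp only [map_add, map_smul, h.cov_radial, h.cov_radial_radial, coneDr_incl, coneDr_radial,
    smul_zero, add_zero, smul_smul, mul_inv_cancel₀ hr, one_smul, zero_add, smul_eq_mul, mul_one]

end IsAppendant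

end Appendant

/-! ### Parallelism of the complex structures of the cone -/

section Parallel

variable {E : Type*} [NormedAddCommGroup E] [NormedSpace ℝ E] [FiniteDimensional ℝ E]
  {H : Type*} [TopologicalSpace H] {I : ModelWithCorners ℝ E H}
  {M : Type*} [TopologicalSpace M] [ChartedSpace H M] [IsManifold I ∞ M] [T2Space M]

namespace AlmostThreeContactMetric

variable {S : AlmostThreeContactMetric I M} {a : ℝ} {ha : 0 < a} {D : LinConn I M}
  {Dbar : LinConn (coneModel I) (ConeSpace M)} {i : Fin 3}

theorem mvfderiv_form (hD : IsMetricSkew S.g D)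
    (hξ : ∀ x (u : TangentSpace I x), D (S.ξ i) x u = (-a) • S.φ i x u)
    {Y : VField I M} (hY : SmoothVF Y) (x : M) (u : TangentSpace I x) :
    mvfderiv I (fun y => S.η i y (Y y)) x u = S.η i x (D Y x u) + a * S.g.inner x u (S.φ i x (Y x)) := by
  obtain ⟨X, hX, rfl⟩ := exists_smoothVF_eq (I := I) u
  have h := hD.metric X Y _ hX hY (S.smooth_ξ i) x
  simp only [inner_reeb] at h
  rw [lieFun] at h
  rw [h, hξ, map_smul, smul_eq_mul, S.g.symm x (Y x), inner_φ]
  ring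

theorem covTensor_coneJ_lift (h : IsAppendant S.g a ha D Dbar) (hD : IsMetricSkew S.g D)
    (hξ : ∀ x (u : TangentSpace I x), D (S.ξ i) x u = (-a) • S.φ i x u)
    (hφ : ∀ x (u v : TangentSpace I x), covTensor D (S.φ i) x u v
      = (-a) • (S.η i x v • u - S.g.inner x u v • S.ξ i x))
    {Y : VField I M} (hY : SmoothVF Y) (p : ConeSpace M) (u : TangentSpace (coneModel I) p) :
    covTensor Dbar (S.coneJ a i) p u (coneLift Y p) = 0 := by
  have hJ := S.coneJ_smooth i ha
  have hr := (coneRadius_pos p).ne'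
  have hl := (coneLift_smooth hY).diff p
  have hR : DiffVFAt (fun q : ConeSpace M => coneRadius q • coneRadial (I := I) q) p :=
    DiffVFAt.smul (SmoothFunAt.diff (coneRadius_smooth p)) ((coneRadial_smooth S.g).diff p)
  have hη : DiffFunAt I (fun x => S.η i x (Y x)) p.1 := form_diffAt (S.smooth_η i) (hY.diff p.1)
  have hφY := endo_smooth (S.smooth_φ i) hY
  have e : endoApply (S.coneJ a i) (coneLift Y) = (fun _ : ConeSpace M => - coneSign i) •
      (coneLift (endoApply (S.φ i) Y) + (fun q : ConeSpace M => S.η i q.1 (Y q.1)) •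
        (fun _ : ConeSpace M => a) • (fun q : ConeSpace M => coneRadius q • coneRadial q)) := by
    rw [coneJ_lift]
    funext q
    simp only [Pi.smul_apply', Pi.add_apply, coneLift, endoApply]
    module
  have hR' := DiffVFAt.smul (f := fun _ : ConeSpace M => a) mdifferentiableAt_const hR
  have c := cov_endoApply Dbar hJ hl u
  rw [e, LinConn.smul Dbar (DiffVFAt.add (coneLift_smooth hφY |>.diff p)
      (DiffVFAt.smul (comp_fst_diffAt hη) hR')) mdifferentiableAt_const,
    LinConn.add Dbar (coneLift_smooth hφY |>.diff p) (DiffVFAt.smul (comp_fst_diffAt hη) hR'),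
    add_apply, LinConn.smul Dbar hR' (comp_fst_diffAt hη),
    LinConn.smul Dbar hR mdifferentiableAt_const, h.cov_euler, mvfderiv_const, mvfderiv_const,
    mvfderiv_comp_fst hη, mvfderiv_form hD hξ hY] at c
  rw [← sub_eq_iff_eq_add] at c
  rw [← c, sub_eq_zero, cone_decomp p u]
  generalize coneProj p u = v
  generalize coneDr p u = t
  simp only [map_add, map_smul, h.cov_lift hD hφY, h.cov_lift hD hY, h.cov_lift_radial hφY,
    h.cov_lift_radial hY, cov_endoApply D (S.smooth_φ i) (hY.diff p.1), hφ, zero_apply, zero_smul,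
    add_zero, Pi.smul_apply', coneProj_incl, coneProj_radial, smul_zero]
  refine cone_ext ?_ ?_
  · simp only [map_add, map_sub, map_smul, proj_coneJ, coneProj_incl, coneProj_radial, coneDr_incl,
      coneDr_radial, endoApply, zero_mul, zero_smul, smul_zero, map_zero, sub_zero, zero_sub,
      add_zero, one_mul]
    have ea : a ^ 2 * coneRadius p * S.g.inner p.1 v (Y p.1)
      = a * S.g.inner p.1 v (Y p.1) * (a * coneRadius p) := by ring
    have hc := (mul_pos ha (coneRadius_pos p)).ne'
    rw [ea, mul_smul (a * S.g.inner p.1 v (Y p.1)), smul_comm (a * coneRadius p),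
      smul_smul (a * coneRadius p), mul_inv_cancel₀ hc]
    module
  · simp only [map_add, map_sub, map_smul, dr_coneJ, coneProj_incl, coneProj_radial, coneDr_incl,
      coneDr_radial, endoApply, smul_eq_mul, map_zero]
    field_simp
    ring

theorem covTensor_coneJ_euler (h : IsAppendant S.g a ha D Dbar) (hD : IsMetricSkew S.g D)
    (hξ : ∀ x (u : TangentSpace I x), D (S.ξ i) x u = (-a) • S.φ i x u)
    (p : ConeSpace M) (u : TangentSpace (coneModel I) p) :
    covTensor Dbar (S.coneJ a i) p u (coneRadius p • coneRadial p) = 0 := by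
  have hJ := S.coneJ_smooth i ha
  have hr := (coneRadius_pos p).ne'
  have hR : DiffVFAt (fun q : ConeSpace M => coneRadius q • coneRadial (I := I) q) p :=
    DiffVFAt.smul (SmoothFunAt.diff (coneRadius_smooth p)) ((coneRadial_smooth S.g).diff p)
  have hl := (coneLift_smooth (S.smooth_ξ i)).diff p
  have e : endoApply (S.coneJ a i) (fun q => coneRadius q • coneRadial q)
      = (fun _ : ConeSpace M => coneSign i * a⁻¹) • coneLift (S.ξ i) := by
    rw [coneJ_euler S ha]
    funext q
    simp only [Pi.smul_apply', coneLift, smul_smul]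
  have c := cov_endoApply Dbar hJ hR u
  rw [e, LinConn.smul Dbar hl mdifferentiableAt_const, mvfderiv_const, h.cov_euler,
    ← sub_eq_iff_eq_add] at c
  rw [← c, sub_eq_zero, zero_apply, zero_smul, add_zero, cone_decomp p u]
  generalize coneProj p u = v
  generalize coneDr p u = t
  simp only [map_add, map_smul, h.cov_lift hD (S.smooth_ξ i), h.cov_lift_radial (S.smooth_ξ i), hξ,
    inner_reeb]
  refine cone_ext ?_ ?_
  · simp only [map_add, map_sub, map_smul, proj_coneJ, coneProj_incl, coneProj_radial, coneDr_incl,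
      coneDr_radial, zero_mul, zero_smul, smul_zero, map_zero, sub_zero, zero_sub, one_mul]
    rw [mul_inv]
    match_scalars <;> field_simp
  · simp only [map_add, map_sub, map_smul, dr_coneJ, coneProj_incl, coneProj_radial, coneDr_incl,
      coneDr_radial, smul_eq_mul, map_zero]
    field_simp
    ring

theorem isParallelEndo_coneJ (h : IsAppendant S.g a ha D Dbar) (hD : IsMetricSkew S.g D)
    (hξ : ∀ x (u : TangentSpace I x), D (S.ξ i) x u = (-a) • S.φ i x u)
    (hφ : ∀ x (u v : TangentSpace I x), covTensor D (S.φ i) x u v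
      = (-a) • (S.η i x v • u - S.g.inner x u v • S.ξ i x)) :
    IsParallelEndo Dbar (S.coneJ a i) := by
  intro X Y _ hY p
  have hJ := S.coneJ_smooth i ha
  have hr := (coneRadius_pos p).ne'
  rw [covEndo_eq Dbar hJ (hY.diff p)]
  obtain ⟨Z, hZ, e⟩ := exists_smoothVF_eq (I := I) (coneProj p (Y p))
  have h1 := covTensor_coneJ_lift h hD hξ hφ hZ p (X p)
  have h2 := covTensor_coneJ_euler h hD hξ p (X p)
  have e2 : Y p = coneLift Z p
      + (coneDr p (Y p) * (coneRadius p)⁻¹) • (coneRadius p • coneRadial p) := by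
    conv_lhs => rw [cone_decomp p (Y p)]
    rw [smul_smul, mul_assoc, inv_mul_cancel₀ hr, mul_one, coneLift, e]
  rw [e2, covTensor_add_right Dbar hJ, covTensor_smul_right Dbar hJ, h1, h2, smul_zero, add_zero]

end AlmostThreeContactMetric

end Parallel

/-! ### Integrability in the `3`-`(α,δ)`-Sasaki case -/

section Integrability

variable {E : Type*} [NormedAddCommGroup E] [NormedSpace ℝ E] [FiniteDimensional ℝ E]
  {H : Type*} [TopologicalSpace H] {I : ModelWithCorners ℝ E H}
  {M : Type*} [TopologicalSpace M] [ChartedSpace H M] [IsManifold I ∞ M]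

namespace AlmostThreeContactMetric

variable {S : AlmostThreeContactMetric I M} {a α δ : ℝ} {D : LinConn I M} {i j k : Fin 3}

theorem IsThreeSasaki.dOne_eq (h : S.IsThreeSasaki α δ) (e : EvenTriple i j k) {X Y : VField I M}
    (hX : SmoothVF X) (hY : SmoothVF Y) (x : M) :
    dOne (S.η i) X Y x = 2 * α * S.Phi i x (X x) (Y x)
      + 2 * (α - δ) * (S.η j x (X x) * S.η k x (Y x) - S.η j x (Y x) * S.η k x (X x)) := by
  obtain ⟨rfl, rfl⟩ := e
  exact h.2 i X Y hX hY x

/-- The fundamental forms are closed on the horizontal distribution. -/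
theorem IsThreeSasaki.dTwo_horizontal (h : S.IsThreeSasaki α δ) (i : Fin 3) {X Y Z : VField I M}
    (hX : S.Horizontal X) (hY : S.Horizontal Y) (hZ : S.Horizontal Z) (x : M) :
    dTwo (S.Phi i) X Y Z x = 0 := by
  have h1 : ∀ {X Y : VField I M}, S.Horizontal X → S.Horizontal Y →
      (fun y => S.Phi i y (X y) (Y y)) = fun y => (-(2 * α)⁻¹) * S.η i y (mlieBracket I X Y y) := by
    intro X Y hX hY
    funext y
    have e := h.2 i X Y hX.1 hY.1 y
    simp only [dOne, hX.2, hY.2, lieFun_const] at e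
    have := h.1
    field_simp
    linarith
  have h2 : ∀ {X Y Z : VField I M}, S.Horizontal X → S.Horizontal Y → S.Horizontal Z →
      S.Phi i x (mlieBracket I X Y x) (Z x) = (2 * α)⁻¹ *
        (- lieFun Z (fun y => S.η i y (mlieBracket I X Y y)) x
          - S.η i x (mlieBracket I (mlieBracket I X Y) Z x)) := by
    intro X Y Z hX hY hZ
    have e := h.2 i (mlieBracket I X Y) Z (fun y => SmoothVFAt.bracket (hX.1 y) (hY.1 y)) hZ.1 x
    simp only [dOne, hZ.2, lieFun_const] at e
    have := h.1
    field_simp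
    linarith
  have h3 : ∀ {X Y Z : VField I M}, S.Horizontal X → S.Horizontal Y → S.Horizontal Z →
      lieFun X (fun y => S.Phi i y (Y y) (Z y)) x
        = (-(2 * α)⁻¹) * lieFun X (fun y => S.η i y (mlieBracket I Y Z y)) x := by
    intro X Y Z hX hY hZ
    rw [h1 hY hZ, lieFun_mul mdifferentiableAt_const
      (form_smoothAt (S.smooth_η i) (SmoothVFAt.bracket (hY.1 x) (hZ.1 x))).diff, lieFun_const,
      mul_zero, add_zero]
  have j := jacobi (hX.1 x) (hY.1 x) (hZ.1 x)
  have j1 : mlieBracket I (mlieBracket I Y Z) X x = - mlieBracket I X (mlieBracket I Y Z) x :=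
    bracket_swap
  have j2 : mlieBracket I (mlieBracket I Z X) Y x = mlieBracket I Y (mlieBracket I X Z) x := by
    rw [bracket_swap, mlieBracket_swap (V := Z) (W := X)]
    have e : (-mlieBracket I X Z : VField I M) = (fun _ : M => (-1 : ℝ)) • mlieBracket I X Z := by
      funext y; simp
    rw [e, bracket_smul_right mdifferentiableAt_const
      (SmoothVFAt.bracket (hX.1 x) (hZ.1 x)).diff, lieFun_const]
    simp
  have j3 := congrArg (S.η i x) j
  rw [map_add] at j3
  rw [dTwo, h3 hX hY hZ, h3 hY hZ hX, h3 hZ hX hY, h2 hX hY hZ, h2 hY hZ hX, h2 hZ hX hY, j1, j2,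
    map_neg, j3]
  ring

variable [T2Space M]

/-- A `3`-form on horizontal vectors which is annihilated by the derivation `φ_i` vanishes. -/
theorem IsThreeSasaki.torsion_horizontal (h : S.IsThreeSasaki α δ) (hD : IsMetricSkew S.g D)
    (hφ : ∀ i x (u v : TangentSpace I x), covTensor D (S.φ i) x u v
      = (-a) • (S.η i x v • u - S.g.inner x u v • S.ξ i x)) {x : M} {u v w : TangentSpace I x}
    (hu : ∀ m, S.η m x u = 0) (hv : ∀ m, S.η m x v = 0) (hw : ∀ m, S.η m x w = 0) :
    torsionForm S.g D x u v w = 0 := by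
  have hT := isSmoothThreeForm_torsionForm hD
  have key : ∀ {u v w : TangentSpace I x}, (∀ m, S.η m x u = 0) → (∀ m, S.η m x v = 0) →
      (∀ m, S.η m x w = 0) → torsionForm S.g D x (S.φ 0 x u) v w
        + torsionForm S.g D x u (S.φ 0 x v) w + torsionForm S.g D x u v (S.φ 0 x w) = 0 := by
    intro u v w hu hv hw
    obtain ⟨X, hX, rfl⟩ := S.exists_horizontal x hu
    obtain ⟨Y, hY, rfl⟩ := S.exists_horizontal x hv
    obtain ⟨Z, hZ, rfl⟩ := S.exists_horizontal x hw
    have e := S.dTwo_Phi_eq hD 0 hX.1 hY.1 hZ.1 x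
    rw [h.dTwo_horizontal 0 hX hY hZ] at e
    simp only [hφ, hu, hv, hw, map_smul, map_sub, smul_apply, sub_apply, zero_smul, map_zero,
      zero_apply, reeb_inner, smul_zero, sub_zero, zero_add] at e
    rw [hT.cycle x (S.φ 0 x (X x)), ← hT.cycle x (Z x) (X x)]
    linarith
  have f : ∀ {v : TangentSpace I x}, (∀ m, S.η m x v = 0) → S.φ 0 x (S.φ 0 x v) = (-1 : ℝ) • v :=
    fun hv => by rw [S.φ_sq_horizontal x 0 hv, neg_one_smul]
  have k1 := key (S.φ_horizontal x 0 hu) hv hw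
  have k2 := key hu (S.φ_horizontal x 0 hv) hw
  have k3 := key hu hv (S.φ_horizontal x 0 hw)
  have k4 := key (S.φ_horizontal x 0 hu) (S.φ_horizontal x 0 hv) (S.φ_horizontal x 0 hw)
  rw [f hu] at k1 k4
  rw [f hv] at k2 k4
  rw [f hw] at k3 k4
  simp only [hT.smul, hT.smul_left, hT.smul_mid] at k1 k2 k3 k4
  linarith

theorem IsThreeSasaki.torsion_reeb (h : S.IsThreeSasaki α δ) (hD : IsMetricSkew S.g D)
    (hξ : ∀ i x (u : TangentSpace I x), D (S.ξ i) x u = (-a) • S.φ i x u) (e : EvenTriple i j k)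
    (x : M) (u v : TangentSpace I x) :
    torsionForm S.g D x u v (S.ξ i x) = 2 * (α - a) * S.Phi i x u v
      + 2 * (α - δ) * (S.η j x u * S.η k x v - S.η j x v * S.η k x u) := by
  obtain ⟨X, hX, rfl⟩ := exists_smoothVF_eq (I := I) u
  obtain ⟨Y, hY, rfl⟩ := exists_smoothVF_eq (I := I) v
  have h1 := S.dOne_eq hD i hX hY x
  rw [h.dOne_eq e hX hY] at h1
  simp only [hξ, map_smul, smul_apply, inner_φ, smul_eq_mul] at h1
  have h2 := S.Phi_swap x i (Y x) (X x)
  simp only [Phi] at *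
  linear_combination -h1 + a * h2

/-- The vertical volume form `η_i ∧ η_j ∧ η_k`. -/
def vertVolume (S : AlmostThreeContactMetric I M) (i j k : Fin 3) (x : M) (u v w : TangentSpace I x) : ℝ :=
  S.η i x u * (S.η j x v * S.η k x w - S.η j x w * S.η k x v)
    + S.η i x v * (S.η j x w * S.η k x u - S.η j x u * S.η k x w)
    + S.η i x w * (S.η j x u * S.η k x v - S.η j x v * S.η k x u)

theorem wedgeSum_horizontal {x : M} {u v w : TangentSpace I x}
    (hu : ∀ m, S.η m x u = 0) (hv : ∀ m, S.η m x v = 0) (hw : ∀ m, S.η m x w = 0) :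
    S.wedgeSum x u v w = 0 := by
  simp [wedgeSum, wedgeOneTwo, hu, hv, hw]

theorem isSmoothThreeForm_wedgeSum (S : AlmostThreeContactMetric I M) :
    IsSmoothThreeForm S.wedgeSum := by
  have h := isSmoothThreeForm_modified (S := S) (g := S.g) (isSmoothThreeForm_zero (I := I) (M := M)) 1
  simpa using h

theorem eq_zero_of_reeb {R : Π x : M, TangentSpace I x → TangentSpace I x → TangentSpace I x → ℝ}
    (x : M) (hadd : ∀ u v w w' : TangentSpace I x, R x u v (w + w') = R x u v w + R x u v w')
    (hsmul : ∀ (c : ℝ) (u v w : TangentSpace I x), R x u v (c • w) = c * R x u v w)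
    (hcyc : ∀ u v w : TangentSpace I x, R x u v w = R x v w u)
    (hξ : ∀ m (u v : TangentSpace I x), R x u v (S.ξ m x) = 0)
    (hH : ∀ u v w : TangentSpace I x, (∀ m, S.η m x u = 0) → (∀ m, S.η m x v = 0) →
      (∀ m, S.η m x w = 0) → R x u v w = 0) (u v w : TangentSpace I x) : R x u v w = 0 := by
  have step : ∀ u v w : TangentSpace I x, R x u v w = R x u v (S.hor x w) := by
    intro u v w
    conv_lhs => rw [S.hor_add_vert x (EvenTriple.of 0) w]
    simp only [hadd, hsmul, hξ, mul_zero, add_zero]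
  rw [step, hcyc, hcyc, step, hcyc, hcyc, step, hcyc, hcyc]
  rw [hcyc, hcyc]
  apply hH <;> intro m <;> exact S.form_hor x m _

theorem IsThreeSasaki.torsion_eq (h : S.IsThreeSasaki α δ) (hD : IsMetricSkew S.g D)
    (hξ : ∀ i x (u : TangentSpace I x), D (S.ξ i) x u = (-a) • S.φ i x u)
    (hφ : ∀ i x (u v : TangentSpace I x), covTensor D (S.φ i) x u v
      = (-a) • (S.η i x v • u - S.g.inner x u v • S.ξ i x)) (e : EvenTriple i j k)
    (x : M) (u v w : TangentSpace I x) :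
    torsionForm S.g D x u v w = 2 * (α - a) * S.wedgeSum x u v w
      + (2 * (α - δ) + 4 * (α - a)) * S.vertVolume i j k x u v w := by
  have hT := isSmoothThreeForm_torsionForm hD
  have hW := isSmoothThreeForm_wedgeSum S
  have hWξ : ∀ {i j k : Fin 3}, EvenTriple i j k → ∀ u v : TangentSpace I x,
      S.wedgeSum x u v (S.ξ i x) = S.Phi i x u v
        - 2 * (S.η j x u * S.η k x v - S.η j x v * S.η k x u) := by
    intro i j k e u v
    rw [hW.swap₂₃, wedgeSum_reeb e, Phi, inner_φ]
    ring
  have key := eq_zero_of_reeb (S := S) (R := fun x u v w => torsionForm S.g D x u v w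
    - (2 * (α - a) * S.wedgeSum x u v w
      + (2 * (α - δ) + 4 * (α - a)) * S.vertVolume i j k x u v w)) x ?_ ?_ ?_ ?_ ?_ u v w
  · linarith
  · intro u v w w'
    simp only [hT.add, hW.add, vertVolume, map_add]
    ring
  · intro r u v w
    simp only [hT.smul, hW.smul, vertVolume, map_smul, smul_eq_mul]
    ring
  · intro u v w
    simp only [hT.cycle x u v w, hW.cycle x u v w, vertVolume]
    ring
  · intro m u v
    simp only [vertVolume]
    rcases e.cases m with rfl | rfl | rfl
    · rw [h.torsion_reeb hD hξ e, hWξ e, S.η_ξ, S.reeb_form_odd x e, S.reeb_form_even x e.rot.rot]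
      ring
    · rw [h.torsion_reeb hD hξ e.rot, hWξ e.rot, S.η_ξ, S.reeb_form_odd x e.rot,
        S.reeb_form_even x e]
      ring
    · rw [h.torsion_reeb hD hξ e.rot.rot, hWξ e.rot.rot, S.η_ξ, S.reeb_form_odd x e.rot.rot,
        S.reeb_form_even x e.rot]
      ring
  · intro u v w hu hv hw
    simp only [h.torsion_horizontal hD hφ hu hv hw, wedgeSum_horizontal hu hv hw, vertVolume, hu,
      hv, hw]
    ring

theorem IsThreeSasaki.torsion_φ_reeb (h : S.IsThreeSasaki α δ) (hD : IsMetricSkew S.g D)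
    (hξ : ∀ i x (u : TangentSpace I x), D (S.ξ i) x u = (-a) • S.φ i x u) (i : Fin 3)
    (x : M) (v w : TangentSpace I x) :
    torsionForm S.g D x (S.φ i x v) w (S.ξ i x) + torsionForm S.g D x v (S.φ i x w) (S.ξ i x) = 0 := by
  have e := EvenTriple.of i
  rw [h.torsion_reeb hD hξ e, h.torsion_reeb hD hξ e]
  simp only [Phi, S.form_odd x e, S.form_even x e.rot.rot, S.compat, S.φ_sq, map_add, map_neg,
    map_smul, inner_reeb, smul_eq_mul]
  ring

theorem IsThreeSasaki.torsion_φ_φ (h : S.IsThreeSasaki α δ) (hD : IsMetricSkew S.g D)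
    (hξ : ∀ i x (u : TangentSpace I x), D (S.ξ i) x u = (-a) • S.φ i x u)
    (hφ : ∀ i x (u v : TangentSpace I x), covTensor D (S.φ i) x u v
      = (-a) • (S.η i x v • u - S.g.inner x u v • S.ξ i x)) (i : Fin 3)
    (x : M) (u v w : TangentSpace I x) :
    torsionForm S.g D x u v w = torsionForm S.g D x (S.φ i x u) (S.φ i x v) w
      + torsionForm S.g D x (S.φ i x u) v (S.φ i x w)
      + torsionForm S.g D x u (S.φ i x v) (S.φ i x w) := by
  have hW := isSmoothThreeForm_wedgeSum S
  have e := EvenTriple.of i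
  generalize i + 1 = j at e
  generalize i + 2 = k at e
  have w1 := wedgeSum_φ (S := S) e x (S.φ i x u) v w
  have w2 := wedgeSum_φ (S := S) e x u v (S.φ i x w)
  have w3 := wedgeSum_reeb (S := S) e x u v
  rw [S.φ_sq, hW.add, ← neg_one_smul ℝ w, hW.smul, hW.smul, hW.swap₂₃ x u v (S.ξ i x), w3] at w2
  have e1 : S.g.inner x (S.φ k x v) (S.φ i x w)
      = S.g.inner x (S.φ j x v) w - S.η k x v * S.η i x w := by
    rw [← neg_eq_iff_eq_neg.2 (S.inner_φ x i (S.φ k x v) w), S.mul_odd x e.rot.rot, map_add, map_neg,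
      map_smul, add_apply, neg_apply, smul_apply, reeb_inner, smul_eq_mul]
    ring
  have e2 : S.g.inner x (S.φ j x v) (S.φ i x w)
      = - S.g.inner x (S.φ k x v) w - S.η j x v * S.η i x w := by
    rw [← neg_eq_iff_eq_neg.2 (S.inner_φ x i (S.φ j x v) w), S.mul_even x e, map_add,
      map_smul, add_apply, smul_apply, reeb_inner, smul_eq_mul]
    ring
  have e3 := S.inner_φ x i u w
  rw [e1, e2, S.form_self] at w2
  rw [S.form_odd x e, S.form_even x e.rot.rot] at w1
  have wA : S.wedgeSum x u v w = S.wedgeSum x (S.φ i x u) (S.φ i x v) w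
      + S.wedgeSum x (S.φ i x u) v (S.φ i x w) + S.wedgeSum x u (S.φ i x v) (S.φ i x w) := by
    linear_combination -w1 - w2 - S.η i x v * e3
  have vA : S.vertVolume i j k x u v w = S.vertVolume i j k x (S.φ i x u) (S.φ i x v) w
      + S.vertVolume i j k x (S.φ i x u) v (S.φ i x w)
      + S.vertVolume i j k x u (S.φ i x v) (S.φ i x w) := by
    simp only [vertVolume, S.form_odd x e, S.form_even x e.rot.rot, form_self]
    ring
  rw [h.torsion_eq hD hξ hφ e, h.torsion_eq hD hξ hφ e x (S.φ i x u) (S.φ i x v),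
    h.torsion_eq hD hξ hφ e x (S.φ i x u) v, h.torsion_eq hD hξ hφ e x u (S.φ i x v), wA, vA]
  ring

/-- The complex structures of the cone over a `3`-`(α,δ)`-Sasaki manifold are integrable. -/
theorem IsThreeSasaki.nijenhuis_coneJ (h : S.IsThreeSasaki α δ) (hD : IsMetricSkew S.g D)
    (hξ : ∀ i x (u : TangentSpace I x), D (S.ξ i) x u = (-a) • S.φ i x u)
    (hφ : ∀ i x (u v : TangentSpace I x), covTensor D (S.φ i) x u v
      = (-a) • (S.η i x v • u - S.g.inner x u v • S.ξ i x)) {ha : 0 < a}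
    {Dbar : LinConn (coneModel I) (ConeSpace M)} (hbar : IsAppendant S.g a ha D Dbar) (i : Fin 3)
    {X Y : VField (coneModel I) (ConeSpace M)} (hX : SmoothVF X) (hY : SmoothVF Y)
    (p : ConeSpace M) : nijenhuis (S.coneJ a i) X Y p = 0 := by
  have hJ := S.coneJ_isAlmostHyperhermitian ha
  have hT := isSmoothThreeForm_torsionForm hD
  have hpar := isParallelEndo_coneJ hbar hD (hξ i) (hφ i)
  have hc : ∀ u v : TangentSpace (coneModel I) p, covTensor Dbar (S.coneJ a i) p u v = 0 := by
    intro u v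
    obtain ⟨U, hU, rfl⟩ := exists_smoothVF_eq (I := coneModel I) u
    obtain ⟨V, hV, rfl⟩ := exists_smoothVF_eq (I := coneModel I) v
    rw [← covEndo_eq Dbar (hJ.smooth i) (hV.diff p)]
    exact hpar U V hU hV p
  have hs := coneSign_sq i
  have hJg : ∀ u v : TangentSpace (coneModel I) p, (coneMetric S.g a ha).inner p (S.coneJ a i p u) v
      = - (coneMetric S.g a ha).inner p u (S.coneJ a i p v) := by
    intro u v
    have := hJ.hermitian i p u (S.coneJ a i p v)
    rw [hJ.sq, map_neg] at this
    linarith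
  refine RMetric.eq_of_inner (coneMetric S.g a ha) fun w => ?_
  rw [nijenhuis_eq Dbar (hJ.smooth i) (hX.diff p) (hY.diff p)]
  simp only [hc, hJ.sq, map_zero, sub_zero, zero_sub, add_zero, zero_apply, map_neg, map_sub,
    map_add, neg_apply, sub_apply, add_apply, hJg]
  have t := hbar.torsionForm_eq p
  simp only [torsionForm] at t
  simp only [t]
  have ht : ∀ u v w : TangentSpace I p.1, S.g.inner p.1 (D.torsion p.1 u v) w
    = torsionForm S.g D p.1 u v w := fun _ _ _ => rfl
  simp only [ht, proj_coneJ]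
  generalize coneDr p w * (a * coneRadius p)⁻¹ = q
  generalize coneProj p (X p) = u
  generalize coneProj p (Y p) = v
  generalize coneProj p w = w
  generalize coneDr p (X p) * (a * coneRadius p)⁻¹ = r
  generalize coneDr p (Y p) * (a * coneRadius p)⁻¹ = s
  have sub : ∀ y z : TangentSpace I p.1, y - z = y + (-1 : ℝ) • z := fun y z => by
    rw [neg_one_smul, sub_eq_add_neg]
  have first : ∀ y z : TangentSpace I p.1, torsionForm S.g D p.1 (S.ξ i p.1) y z
      = torsionForm S.g D p.1 y z (S.ξ i p.1) := fun y z => hT.cycle _ _ _ _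
  have second : ∀ y z : TangentSpace I p.1, torsionForm S.g D p.1 y (S.ξ i p.1) z
      = - torsionForm S.g D p.1 y z (S.ξ i p.1) := fun y z => hT.swap₂₃ _ _ _ _
  have twice : ∀ y : TangentSpace I p.1,
      torsionForm S.g D p.1 y (S.ξ i p.1) (S.ξ i p.1) = 0 := fun y => by
    have := second y (S.ξ i p.1)
    linarith
  have A := h.torsion_φ_φ hD hξ hφ i p.1 u v w
  have B₁ := h.torsion_φ_reeb hD hξ i p.1 v w
  have B₂ := h.torsion_φ_reeb hD hξ i p.1 u w
  have B₃ := h.torsion_φ_reeb hD hξ i p.1 u v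
  simp only [sub, hT.smul, hT.smul_left, hT.smul_mid, hT.add, hT.add_left, hT.add_mid, twice, first,
    second]
  generalize coneSign i = ε at hs
  linear_combination (a ^ 2 * coneRadius p ^ 2) * (ε ^ 2 * (A + r * B₁ - s * B₂ + q * B₃)
    - torsionForm S.g D p.1 u v w * hs)

end AlmostThreeContactMetric

end Integrability

end

theorem mainTheorem10 {n : ℕ} {M : Type*} [TopologicalSpace M] [T2Space M]
    [ChartedSpace (EuclideanSpace ℝ (Fin (4 * n + 3))) M]
    [IsManifold (𝓡 (4 * n + 3)) ∞ M]
    (S : AlmostThreeContactMetric (𝓡 (4 * n + 3)) M) (hS : S.IsCanonical)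
    (β : ℝ) (hβ : S.IsReebKillingFunction (fun _ => β)) (hneg : β < 0)
    (a : ℝ) (ha : 0 < a) (haβ : a = -β / 2) :
    IsAlmostHyperhermitian (coneMetric S.g a ha) (S.coneJ a) ∧
    (∃ (D D' : LinConn (𝓡 (4 * n + 3)) M)
        (Dbar : LinConn (coneModel (𝓡 (4 * n + 3))) (ConeSpace M)),
      S.IsCanonicalConnection (fun _ => β) D ∧ S.IsModifiedConnection β D D' ∧
        IsAppendant S.g a ha D' Dbar) ∧
    (∀ (D D' : LinConn (𝓡 (4 * n + 3)) M)
        (Dbar : LinConn (coneModel (𝓡 (4 * n + 3))) (ConeSpace M)),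
      S.IsCanonicalConnection (fun _ => β) D → S.IsModifiedConnection β D D' →
        IsAppendant S.g a ha D' Dbar → ∀ i : Fin 3, IsParallelEndo Dbar (S.coneJ a i)) ∧
    (∀ α δ : ℝ, S.IsThreeSasaki α δ → IsHKT (coneMetric S.g a ha) (S.coneJ a)) := by
  obtain ⟨D, hD⟩ := S.exists_isCanonicalConnection hS hβ
  obtain ⟨D', hD'⟩ := S.exists_isModifiedConnection hD.metricSkew β
  obtain ⟨Dbar, hbar⟩ := exists_isAppendant hD'.metricSkew ha
  have hβa : β / 2 = -a := by rw [haβ]; ring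
  have hJ := S.coneJ_isAlmostHyperhermitian ha
  have parallel : ∀ (D D' : LinConn (𝓡 (4 * n + 3)) M)
      (Dbar : LinConn (coneModel (𝓡 (4 * n + 3))) (ConeSpace M)),
      S.IsCanonicalConnection (fun _ => β) D → S.IsModifiedConnection β D D' →
        IsAppendant S.g a ha D' Dbar → ∀ i : Fin 3, IsParallelEndo Dbar (S.coneJ a i) := by
    intro D D' Dbar hD hD' hbar i
    refine AlmostThreeContactMetric.isParallelEndo_coneJ hbar hD'.metricSkew (fun x u => ?_)
      fun x u v => ?_
    · rw [hD'.cov_reeb hD, hβa]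
    · rw [hD'.covTensor_φ hD, hβa]
  refine ⟨hJ, ⟨D, D', Dbar, hD, hD', hbar⟩, parallel, fun α δ h => ⟨hJ, ?_, Dbar, hbar.metricSkew,
    parallel D D' Dbar hD hD' hbar⟩⟩
  intro i X Y hX hY p
  refine h.nijenhuis_coneJ hD'.metricSkew (fun i x u => ?_) (fun i x u v => ?_) hbar i hX hY p
  · rw [hD'.cov_reeb hD, hβa]
  · rw [hD'.covTensor_φ hD, hβa]
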